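/- Let $q\in\mathbb R$ with $|q|>1$. For $n\ge 1$ let $A(S_q^{2n})$ be the unital complex $*$-algebra generated by $x_0=x_0^*,x_1,\dots,x_n$ with the relations $$x_ix_j=q\,x_jx_i\ (0\le i<j\le n),\qquad x_i^*x_j=q\,x_jx_i^*\ (i\ne j),\qquad [x_i,x_i^*]=(1-q^{-2})s_{i-1}\ (1\le i\le n),\qquad s_n=1,$$ where $s_0=x_0^2$ and $s_i=s_{i-1}+x_i^*x_i$. Let $A(S_q^{2n-1})$ be defined in the same way with the additional relation $x_0=0$. There are quotient maps $A(S_q^{2n})\to A(S_q^{2n-1})$, $x_0\mapsto 0$, $x_i\mapsto x_i$, and $A(S_q^{2n+1})\to A(S_q^{2n-1})$, $x_1\mapsto 0$, $x_i\mapsto x_{i-1}$ for $i\ge2$. Let $C(S_q^N)$ be the universal $C^*$-completion of $A(S_q^N)$, $\mathcal K$ the compact operators on $\ell^2(\mathbb N)$, and $\mathcal H_n$ the Hilbert space with orthonormal basis indexed by $\mathbb N^n$. Representations are unital $*$-representations by bounded operators on a Hilbert space. (a) For $n\ge1$ and each sign there is a representation $\psi_\pm^{(2n)}$ of $A(S_q^{2n})$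 on $\mathcal H_n$, with basis $|k_0,\dots,k_{n-1}\rangle$, such that $$\psi_\pm^{(2n)}(x_0)|k\rangle=\pm q^{-(k_0+\dots+k_{n-1})}|k\rangle,$$ $$\psi_\pm^{(2n)}(x_i)|k\rangle=(1-q^{-2k_{i-1}})^{1/2}q^{-\sum_{j=i}^{n-1}k_j}|\dots,k_{i-1}-1,\dots\rangle,$$ $$\psi_\pm^{(2n)}(x_i^*)|k\rangle=(1-q^{-2(k_{i-1}+1)})^{1/2}q^{-\sum_{j=i}^{n-1}k_j}|\dots,k_{i-1}+1,\dots\rangle\qquad(1\le i\le n).$$ These two representations are irreducible, do not factor through $A(S_q^{2n-1})$, and are not unitarily equivalent to each other. Every irreducible representation of $A(S_q^{2n})$ either factors through $A(S_q^{2n-1})$ or is unitarily equivalent to $\psi_+^{(2n)}$ or $\psi_-^{(2n)}$. (b) For $n\ge0$ and each $\lambda\in S^1$ there is a representation $\psi_\lambda^{(2n+1)}$ of $A(S_q^{2n+1})$ on $\mathcal H_n$, with basis $|k_1,\dots,k_n\rangle$, such that $$\psi_\lambda^{(2n+1)}(x_1)|k\rangle=\lambda q^{-(k_1+\dots+k_n)}|k\rangle,\qquad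 \psi_\lambda^{(2n+1)}(x_1^*)|k\rangle=\bar\lambda q^{-(k_1+\dots+k_n)}|k\rangle,$$ $$\psi_\lambda^{(2n+1)}(x_i)|k\rangle=(1-q^{-2k_{i-1}})^{1/2}q^{-\sum_{j=i}^{n}k_j}|\dots,k_{i-1}-1,\dots\rangle,$$ $$\psi_\lambda^{(2n+1)}(x_i^*)|k\rangle=(1-q^{-2(k_{i-1}+1)})^{1/2}q^{-\sum_{j=i}^{n}k_j}|\dots,k_{i-1}+1,\dots\rangle\qquad(2\le i\le n+1).$$ These representations are irreducible, pairwise unitarily inequivalent, and (for $n\ge1$) do not factor through $A(S_q^{2n-1})$. Every irreducible representation of $A(S_q^{2n+1})$ is unitarily equivalent to $\psi_\lambda^{(2n+1)}$ for some $\lambda\in S^1$ or, if $n\ge 1$, factors through $A(S_q^{2n-1})$. (c) For $n\ge1$ the quotient maps of the algebras extend to $*$-homomorphisms of the completions that fit into exact sequences of $C^*$-algebras $$0\to\mathcal K\oplus\mathcal K\to C(S_q^{2n})\to C(S_q^{2n-1})\to0,\qquad 0\to C(S^1)\otimes\mathcal K\to C(S_q^{2n+1})\to C(S_q^{2n-1})\to0.$$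 -/

import Mathlib

open scoped ENNReal InnerProductSpace

universe u v

noncomputable section

namespace QuantumSphere

/-! ### The free complex `*`-algebra -/

/-- The free unital complex `*`-algebra on a set `X` of generators, as an algebra: the free algebra
on the symbols `x` (`Sum.inl x`) and `x^*` (`Sum.inr x`). -/
def FreeStarAlgebra (X : Type u) : Type u := FreeAlgebra ℂ (X ⊕ X)

namespace FreeStarAlgebra

variable {X : Type u}

instance : Ring (FreeStarAlgebra X) := inferInstanceAs (Ring (FreeAlgebra ℂ (X ⊕ X)))

instance : Algebra ℂ (FreeStarAlgebra X) :=
  inferInstanceAs (Algebra ℂ (FreeAlgebra ℂ (X ⊕ X)))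

/-- The letters `x` and `x^*`. -/
def letter (y : X ⊕ X) : FreeStarAlgebra X := FreeAlgebra.ι ℂ y

/-- The opposite algebra with conjugate scalar action, the target of the involution. -/
def ConjOp (X : Type u) : Type u := (FreeStarAlgebra X)ᵐᵒᵖ

instance : Ring (ConjOp X) := inferInstanceAs (Ring (FreeStarAlgebra X)ᵐᵒᵖ)

instance : Algebra ℂ (ConjOp X) :=
  RingHom.toAlgebra' ((algebraMap ℂ (FreeStarAlgebra X)ᵐᵒᵖ).comp (starRingEnd ℂ))
    (fun c x => Algebra.commutes (A := (FreeStarAlgebra X)ᵐᵒᵖ) (starRingEnd ℂ c) x)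

/-- The conjugate-linear anti-automorphism exchanging `x` and `x^*`. -/
def starHom (X : Type u) : FreeAlgebra ℂ (X ⊕ X) →ₐ[ℂ] ConjOp X :=
  FreeAlgebra.lift ℂ (A := ConjOp X) fun y => MulOpposite.op (letter y.swap)

instance : Star (FreeStarAlgebra X) := ⟨fun a => MulOpposite.unop (starHom X a)⟩

theorem star_def (a : FreeStarAlgebra X) : star a = MulOpposite.unop (starHom X a) := rfl

theorem star_algebraMap' (c : ℂ) : star (algebraMap ℂ (FreeStarAlgebra X) c) =
    algebraMap ℂ (FreeStarAlgebra X) (starRingEnd ℂ c) := by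
  rw [star_def]
  exact congrArg MulOpposite.unop ((starHom X).commutes c)

theorem star_letter (y : X ⊕ X) : star (letter y) = letter y.swap := by
  rw [star_def]
  exact congrArg MulOpposite.unop (FreeAlgebra.lift_ι_apply (A := ConjOp X) _ _)

theorem star_mul' (a b : FreeStarAlgebra X) : star (a * b) = star b * star a := by
  rw [star_def]
  exact congrArg MulOpposite.unop (map_mul (starHom X) a b)

theorem star_add' (a b : FreeStarAlgebra X) : star (a + b) = star a + star b := by
  rw [star_def]
  exact congrArg MulOpposite.unop (map_add (starHom X) a b)

theorem induct {C : FreeStarAlgebra X → Prop} (hc : ∀ c : ℂ, C (algebraMap ℂ _ c))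
    (hι : ∀ y : X ⊕ X, C (letter y))
    (hm : ∀ a b, C a → C b → C (a * b)) (ha : ∀ a b, C a → C b → C (a + b))
    (a : FreeStarAlgebra X) : C a :=
  FreeAlgebra.induction ℂ (X ⊕ X) (motive := C) hc hι hm ha a

instance : StarRing (FreeStarAlgebra X) where
  star_involutive a := by
    induction a using induct with
    | hc c => rw [star_algebraMap', star_algebraMap', Complex.conj_conj]
    | hι y =>
      rw [star_letter, star_letter, Sum.swap_swap]
    | hm a b ha hb => rw [star_mul', star_mul', ha, hb]
    | ha a b ha hb => rw [star_add', star_add', ha, hb]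
  star_mul := star_mul'
  star_add := star_add'

instance : StarModule ℂ (FreeStarAlgebra X) where
  star_smul c a := by
    rw [Algebra.smul_def, star_mul', star_algebraMap', Algebra.smul_def]
    exact (Algebra.commutes _ _).symm

/-- The generators. -/
def gen (x : X) : FreeStarAlgebra X := letter (Sum.inl x)

theorem star_gen (x : X) : star (gen x) = letter (Sum.inr x) :=
  star_letter _

variable {B : Type v} [Ring B] [Algebra ℂ B] [StarRing B]

/-- The extension of `b : X → B` to the free `*`-algebra. -/
def liftAlg (b : X → B) : FreeStarAlgebra X →ₐ[ℂ] B :=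
  FreeAlgebra.lift ℂ (Sum.elim b fun x => star (b x))

theorem liftAlg_gen (b : X → B) (x : X) : liftAlg b (gen x) = b x :=
  FreeAlgebra.lift_ι_apply _ _

theorem liftAlg_star [StarModule ℂ B] (b : X → B) (a : FreeStarAlgebra X) :
    liftAlg b (star a) = star (liftAlg b a) := by
  induction a using induct with
  | hc c =>
    rw [star_algebraMap', AlgHom.commutes, AlgHom.commutes, ← algebraMap_star_comm]; rfl
  | hι y =>
    rw [star_letter]
    have h : ∀ z : X ⊕ X, liftAlg b (letter z) =
      Sum.elim b (fun x => star (b x)) z := fun z => FreeAlgebra.lift_ι_apply _ _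
    rw [h, h]
    cases y <;> simp
  | hm a b ha hb => rw [star_mul, map_mul, map_mul, star_mul, ha, hb]
  | ha a b ha hb => rw [star_add, map_add, map_add, star_add, ha, hb]

end FreeStarAlgebra

/-! ### The algebras of the quantum Euclidean spheres -/

section Relations

variable {B : Type v} [Ring B] [StarRing B]

/-- The partial radius `s_i = x_0^2 + ∑_{1 ≤ j ≤ i} x_j^* x_j`, that is `s_0 = x_0^2` and
`s_i = s_{i-1} + x_i^* x_i`. -/
def partialRadius {n : ℕ} (x : Fin (n + 1) → B) (i : Fin (n + 1)) : B :=
  x 0 ^ 2 + ∑ j ∈ Finset.Ioc 0 i, star (x j) * x j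

end Relations

/-- The defining relations of the `*`-algebra with generators `x_0 = x_0^*, x_1, …, x_n` (where
`x_0 = 0` in the case `odd`), closed under the involution. -/
inductive SphereRel (q : ℝ) (n : ℕ) (odd : Prop) :
    FreeStarAlgebra (Fin (n + 1)) → FreeStarAlgebra (Fin (n + 1)) → Prop
  | selfAdjoint : SphereRel q n odd (star (.gen 0)) (.gen 0)
  | zero (h : odd) : SphereRel q n odd (.gen 0) 0
  | comm (i j : Fin (n + 1)) (h : i < j) :
      SphereRel q n odd (.gen i * .gen j) ((q : ℂ) • (.gen j * .gen i))
  | comm_star (i j : Fin (n + 1)) (h : i ≠ j) :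
      SphereRel q n odd (star (.gen i) * .gen j) ((q : ℂ) • (.gen j * star (.gen i)))
  | bracket (i : Fin n) :
      SphereRel q n odd
        (.gen i.succ * star (.gen i.succ) - star (.gen i.succ) * .gen i.succ)
        ((1 - ((q : ℂ) ^ 2)⁻¹) • partialRadius FreeStarAlgebra.gen i.castSucc)
  | sphere : SphereRel q n odd (partialRadius FreeStarAlgebra.gen (Fin.last n)) 1
  | star {a b : FreeStarAlgebra (Fin (n + 1))} (h : SphereRel q n odd a b) :
      SphereRel q n odd (star a) (star b)

/-- The `*`-algebra with generators `x_0, …, x_n` and relations `SphereRel`. -/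
def SphereAlgebra (q : ℝ) (n : ℕ) (odd : Prop) : Type := RingQuot (SphereRel q n odd)

/-- `A(S_q^{2n})`. -/
abbrev EvenSphere (q : ℝ) (n : ℕ) : Type := SphereAlgebra q n False

/-- `A(S_q^{2n-1})`; the generator `x_0` is zero. -/
abbrev OddSphere (q : ℝ) (n : ℕ) : Type := SphereAlgebra q n True

namespace SphereAlgebra

variable {q : ℝ} {n : ℕ} {odd : Prop}

instance : Ring (SphereAlgebra q n odd) := inferInstanceAs (Ring (RingQuot (SphereRel q n odd)))

instance : Algebra ℂ (SphereAlgebra q n odd) :=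
  inferInstanceAs (Algebra ℂ (RingQuot (SphereRel q n odd)))

instance : StarRing (SphereAlgebra q n odd) :=
  RingQuot.starRing (SphereRel q n odd) fun _ _ h => .star h

/-- The quotient map. -/
def mk : FreeStarAlgebra (Fin (n + 1)) →ₐ[ℂ] SphereAlgebra q n odd :=
  RingQuot.mkAlgHom ℂ (SphereRel q n odd)

theorem mk_surjective : Function.Surjective (mk (q := q) (n := n) (odd := odd)) :=
  RingQuot.mkAlgHom_surjective ℂ _

theorem mk_star (a : FreeStarAlgebra (Fin (n + 1))) :
    mk (q := q) (odd := odd) (star a) = star (mk (q := q) (odd := odd) a) := by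
  have h : ∀ b, mk (q := q) (odd := odd) b = RingQuot.mkRingHom (SphereRel q n odd) b := fun b =>
    congrArg (fun f => f b) (RingQuot.mkAlgHom_coe ℂ (SphereRel q n odd))
  rw [h, h, RingQuot.mkRingHom_def]
  rfl

instance : StarModule ℂ (SphereAlgebra q n odd) where
  star_smul c a := by
    obtain ⟨a, rfl⟩ := mk_surjective a
    rw [← map_smul, ← mk_star, star_smul, map_smul, mk_star]

/-- The generators `x_0, …, x_n`. -/
def x (i : Fin (n + 1)) : SphereAlgebra q n odd := mk (.gen i)

theorem mk_rel {a b : FreeStarAlgebra (Fin (n + 1))} (h : SphereRel q n odd a b) :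
    mk (q := q) (odd := odd) a = mk b :=
  RingQuot.mkAlgHom_rel ℂ h

theorem mk_partialRadius (i : Fin (n + 1)) :
    mk (q := q) (odd := odd) (partialRadius FreeStarAlgebra.gen i) = partialRadius x i := by
  simp only [partialRadius, map_add, map_pow, map_sum, map_mul, mk_star]
  rfl

variable {B : Type v} [Ring B] [Algebra ℂ B] [StarRing B] [StarModule ℂ B]

theorem liftAlg_partialRadius (b : Fin (n + 1) → B) (i : Fin (n + 1)) :
    FreeStarAlgebra.liftAlg b (partialRadius FreeStarAlgebra.gen i) = partialRadius b i := by
  simp only [partialRadius, map_add, map_pow, map_sum, map_mul, FreeStarAlgebra.liftAlg_star,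
    FreeStarAlgebra.liftAlg_gen]

end SphereAlgebra

/-- `b_0, …, b_n` satisfy the defining relations. -/
structure IsSphereTuple (q : ℝ) {n : ℕ} (odd : Prop) {B : Type v} [Ring B] [Algebra ℂ B]
    [StarRing B] (b : Fin (n + 1) → B) : Prop where
  selfAdjoint : star (b 0) = b 0
  zero : odd → b 0 = 0
  comm : ∀ i j, i < j → b i * b j = (q : ℂ) • (b j * b i)
  comm_star : ∀ i j, i ≠ j → star (b i) * b j = (q : ℂ) • (b j * star (b i))
  bracket : ∀ i : Fin n, b i.succ * star (b i.succ) - star (b i.succ) * b i.succ =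
    (1 - ((q : ℂ) ^ 2)⁻¹) • partialRadius b i.castSucc
  sphere : partialRadius b (Fin.last n) = 1

namespace SphereAlgebra

variable {q : ℝ} {n : ℕ} {odd : Prop}

/-- The generators satisfy the defining relations. -/
theorem isSphereTuple_x : IsSphereTuple q odd (x : Fin (n + 1) → SphereAlgebra q n odd) where
  selfAdjoint := by
    have := mk_rel (SphereRel.selfAdjoint (q := q) (n := n) (odd := odd))
    rwa [mk_star] at this
  zero h := by
    have := mk_rel (SphereRel.zero (q := q) (n := n) h)
    rwa [map_zero] at this
  comm i j h := by
    have := mk_rel (SphereRel.comm (q := q) (n := n) (odd := odd) i j h)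
    rwa [map_smul, map_mul, map_mul] at this
  comm_star i j h := by
    have := mk_rel (SphereRel.comm_star (q := q) (n := n) (odd := odd) i j h)
    rwa [map_smul, map_mul, map_mul, mk_star] at this
  bracket i := by
    have := mk_rel (SphereRel.bracket (q := q) (n := n) (odd := odd) i)
    rwa [map_smul, map_sub, map_mul, map_mul, mk_star, mk_partialRadius] at this
  sphere := by
    have := mk_rel (SphereRel.sphere (q := q) (n := n) (odd := odd))
    rwa [map_one, mk_partialRadius] at this

variable {B : Type v} [Ring B] [Algebra ℂ B] [StarRing B] [StarModule ℂ B]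

theorem liftAlg_rel {b : Fin (n + 1) → B} (hb : IsSphereTuple q odd b)
    ⦃a a' : FreeStarAlgebra (Fin (n + 1))⦄ (h : SphereRel q n odd a a') :
    FreeStarAlgebra.liftAlg b a = FreeStarAlgebra.liftAlg b a' := by
  induction h with
  | selfAdjoint => simpa [FreeStarAlgebra.liftAlg_star, FreeStarAlgebra.liftAlg_gen] using hb.1
  | zero h => simpa [FreeStarAlgebra.liftAlg_gen] using hb.2 h
  | comm i j h =>
    simpa only [map_smul, map_mul, FreeStarAlgebra.liftAlg_gen] using hb.3 i j h
  | comm_star i j h =>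
    simpa only [map_smul, map_mul, FreeStarAlgebra.liftAlg_star, FreeStarAlgebra.liftAlg_gen]
      using hb.4 i j h
  | bracket i =>
    simpa only [map_sub, map_mul, map_smul, FreeStarAlgebra.liftAlg_star,
      FreeStarAlgebra.liftAlg_gen, liftAlg_partialRadius] using hb.5 i
  | sphere => simpa only [map_one, liftAlg_partialRadius] using hb.6
  | star h ih => rw [FreeStarAlgebra.liftAlg_star, FreeStarAlgebra.liftAlg_star, ih]

/-- The universal property: a tuple that satisfies the relations defines a `*`-homomorphism. -/
def lift (b : Fin (n + 1) → B) (hb : IsSphereTuple q odd b) : SphereAlgebra q n odd →⋆ₐ[ℂ] B :=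
  let f : SphereAlgebra q n odd →ₐ[ℂ] B :=
    RingQuot.liftAlgHom ℂ ⟨FreeStarAlgebra.liftAlg b, liftAlg_rel hb⟩
  have hf : ∀ a, f (mk a) = FreeStarAlgebra.liftAlg b a := fun a =>
    RingQuot.liftAlgHom_mkAlgHom_apply ℂ _ _ a
  { f with
    map_star' := fun a => by
      obtain ⟨a, rfl⟩ := mk_surjective a
      change f (star (mk a)) = star (f (mk a))
      rw [← mk_star, hf, hf, FreeStarAlgebra.liftAlg_star] }

theorem lift_x (b : Fin (n + 1) → B) (hb : IsSphereTuple q odd b) (i : Fin (n + 1)) :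
    lift b hb (x i) = b i :=
  (RingQuot.liftAlgHom_mkAlgHom_apply ℂ _ (liftAlg_rel hb) _).trans
    (FreeStarAlgebra.liftAlg_gen b i)

end SphereAlgebra

open SphereAlgebra

/-- The quotient map `A(S_q^{2n}) → A(S_q^{2n-1})`: `x_0 ↦ 0` and `x_i ↦ x_i` for `i ≥ 1`
(recall that `x_0 = 0` in the target). -/
def evenToOdd (q : ℝ) (n : ℕ) : EvenSphere q n →⋆ₐ[ℂ] OddSphere q n :=
  SphereAlgebra.lift x
    { isSphereTuple_x (q := q) (n := n) (odd := True) with zero := False.elim }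

/-- The images of the generators of `A(S_q^{2n+1})` in `A(S_q^{2n-1})`: `x_0, x_1 ↦ 0` and
`x_i ↦ x_{i-1}` for `i ≥ 2`. -/
def shiftGen (q : ℝ) (n : ℕ) : Fin (n + 2) → OddSphere q n :=
  Fin.cases 0 x

theorem partialRadius_shiftGen (q : ℝ) (n : ℕ) (i : Fin (n + 1)) :
    partialRadius (shiftGen q n) i.succ = partialRadius x i := by
  have h0 : shiftGen q n 0 = 0 := rfl
  have hs : ∀ j : Fin (n + 1), shiftGen q n j.succ = x j := fun _ => rfl
  have hx : (x 0 : OddSphere q n) = 0 := isSphereTuple_x.zero trivial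
  have key : ∀ m (f : Fin (m + 1) → OddSphere q n) (i : Fin (m + 1)), f 0 = 0 →
      ∑ j ∈ Finset.Ioc 0 i, f j = ∑ j ∈ Finset.Iic i, f j := by
    intro m f i hf
    refine Finset.sum_subset (fun j hj => Finset.mem_Iic.2 (Finset.mem_Ioc.1 hj).2) ?_
    intro j hj hj'
    have : j = 0 := by
      by_contra hne
      exact hj' (Finset.mem_Ioc.2 ⟨Fin.pos_iff_ne_zero.2 hne, Finset.mem_Iic.1 hj⟩)
    rw [this, hf]
  unfold partialRadius
  rw [key _ (fun j => star (x j) * x j) i (by simp [hx]), h0, hx]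
  congr 1
  refine (Finset.sum_bij (fun j _ => Fin.succ j) ?_ ?_ ?_ ?_).symm
  · intro j hj
    exact Finset.mem_Ioc.2 ⟨Fin.succ_pos j, Fin.succ_le_succ_iff.2 (Finset.mem_Iic.1 hj)⟩
  · intro a _ b _ h
    exact Fin.succ_injective _ h
  · intro j hj
    obtain ⟨h1, h2⟩ := Finset.mem_Ioc.1 hj
    obtain ⟨j, rfl⟩ := Fin.exists_succ_eq.2 h1.ne'
    exact ⟨j, Finset.mem_Iic.2 (Fin.succ_le_succ_iff.1 h2), rfl⟩
  · intro j _
    rw [hs]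

theorem isSphereTuple_shiftGen (q : ℝ) (n : ℕ) : IsSphereTuple q True (shiftGen q n) := by
  have h0 : shiftGen q n 0 = 0 := rfl
  have hs : ∀ j : Fin (n + 1), shiftGen q n j.succ = x j := fun _ => rfl
  have H := isSphereTuple_x (q := q) (n := n) (odd := True)
  have hx : (x 0 : OddSphere q n) = 0 := H.zero trivial
  refine ⟨by rw [h0, star_zero], fun _ => h0, ?_, ?_, ?_, ?_⟩
  · intro i j hij
    rcases Fin.eq_zero_or_eq_succ i with rfl | ⟨i, rfl⟩
    · simp [h0]
    rcases Fin.eq_zero_or_eq_succ j with rfl | ⟨j, rfl⟩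
    · simp [h0]
    rw [hs, hs]
    exact H.comm i j (Fin.succ_lt_succ_iff.1 hij)
  · intro i j hij
    rcases Fin.eq_zero_or_eq_succ i with rfl | ⟨i, rfl⟩
    · simp [h0]
    rcases Fin.eq_zero_or_eq_succ j with rfl | ⟨j, rfl⟩
    · simp [h0]
    rw [hs, hs]
    exact H.comm_star i j (fun h => hij (by rw [h]))
  · intro i
    rw [hs]
    rcases Fin.eq_zero_or_eq_succ i with rfl | ⟨i, rfl⟩
    · simp [hx, h0, partialRadius]
    · rw [H.bracket i, ← partialRadius_shiftGen]
      rfl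
  · exact (partialRadius_shiftGen q n (Fin.last n)).trans H.sphere

/-- The quotient map `A(S_q^{2n+1}) → A(S_q^{2n-1})`: `x_1 ↦ 0` and `x_i ↦ x_{i-1}` for
`i ≥ 2`. -/
def oddToOdd (q : ℝ) (n : ℕ) : OddSphere q (n + 1) →⋆ₐ[ℂ] OddSphere q n :=
  SphereAlgebra.lift (shiftGen q n) (isSphereTuple_shiftGen q n)

/-! ### Representations -/

section Representations

variable {A : Type*} [Ring A] [Algebra ℂ A] [StarRing A]

/-- A (unital) `*`-representation of `A` by bounded operators on the Hilbert space `H`. -/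
abbrev HilbertRep (A : Type*) [Ring A] [Algebra ℂ A] [StarRing A] (H : Type*) [NormedAddCommGroup H]
    [InnerProductSpace ℂ H] [CompleteSpace H] : Type _ :=
  A →⋆ₐ[ℂ] (H →L[ℂ] H)

variable {H : Type*} [NormedAddCommGroup H] [InnerProductSpace ℂ H] [CompleteSpace H]
variable {K : Type*} [NormedAddCommGroup K] [InnerProductSpace ℂ K] [CompleteSpace K]

/-- Irreducibility: `H ≠ 0` and the only closed invariant subspaces are `0` and `H`. -/
def IsIrreducibleRep (φ : HilbertRep A H) : Prop :=
  Nontrivial H ∧ ∀ W : Submodule ℂ H, IsClosed (W : Set H) →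
    (∀ a, ∀ w ∈ W, φ a w ∈ W) → W = ⊥ ∨ W = ⊤

/-- Unitary equivalence of representations. -/
def UnitarilyEquivalent (φ : HilbertRep A H) (ψ : HilbertRep A K) : Prop :=
  ∃ U : H ≃ₗᵢ[ℂ] K, ∀ a v, U (φ a v) = ψ a (U v)

/-- `φ` factors through the quotient map `π : A → B`. -/
def FactorsThrough {B : Type*} [Ring B] [Algebra ℂ B] [StarRing B] (φ : HilbertRep A H)
    (π : A →⋆ₐ[ℂ] B) : Prop :=
  ∃ φ' : HilbertRep B H, φ = φ'.comp π

end Representations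

/-- The Hilbert space with orthonormal basis `|k_1, …, k_n⟩`, `k_i ∈ ℕ`. -/
abbrev Fock (n : ℕ) : Type := lp (fun _ : Fin n → ℕ => ℂ) 2

/-- The basis vector `|k_1, …, k_n⟩`. -/
def ket {n : ℕ} (k : Fin n → ℕ) : Fock n := lp.single 2 k 1

/-- The formulas for `ψ_ε^{(2n)}`, `ε = ± 1`. The index `i : Fin n` stands for the index `i + 1` of
a generator, which lowers the quantum number `k_i`; `k = (k_0, …, k_{n-1})`. -/
structure IsEvenPsi (q : ℝ) (n : ℕ) (ε : ℤˣ) (ψ : HilbertRep (EvenSphere q n) (Fock n)) : Prop where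
  x_zero : ∀ k, ψ (x 0) (ket k) = (((ε : ℤ) : ℂ) * ((q⁻¹ ^ ∑ j, k j : ℝ) : ℂ)) • ket k
  x_succ : ∀ (i : Fin n) k, ψ (x i.succ) (ket k) =
    ((√(1 - q⁻¹ ^ (2 * k i)) * q⁻¹ ^ ∑ j ∈ Finset.Ioi i, k j : ℝ) : ℂ) •
      ket (Function.update k i (k i - 1))
  star_x_succ : ∀ (i : Fin n) k, ψ (star (x i.succ)) (ket k) =
    ((√(1 - q⁻¹ ^ (2 * (k i + 1))) * q⁻¹ ^ ∑ j ∈ Finset.Ioi i, k j : ℝ) : ℂ) •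
      ket (Function.update k i (k i + 1))

/-- The formulas for `ψ_z^{(2n+1)}`, `z ∈ S^1`. The index `i : Fin n` stands for the index `i + 2`
of a generator, which lowers the quantum number `k_{i+1}` of `(k_1, …, k_n)`. -/
structure IsOddPsi (q : ℝ) (n : ℕ) (z : Circle) (ψ : HilbertRep (OddSphere q (n + 1)) (Fock n)) :
    Prop where
  x_one : ∀ k, ψ (x 1) (ket k) = ((z : ℂ) * ((q⁻¹ ^ ∑ j, k j : ℝ) : ℂ)) • ket k
  star_x_one : ∀ k, ψ (star (x 1)) (ket k) =
    (starRingEnd ℂ (z : ℂ) * ((q⁻¹ ^ ∑ j, k j : ℝ) : ℂ)) • ket k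
  x_succ : ∀ (i : Fin n) k, ψ (x i.succ.succ) (ket k) =
    ((√(1 - q⁻¹ ^ (2 * k i)) * q⁻¹ ^ ∑ j ∈ Finset.Ioi i, k j : ℝ) : ℂ) •
      ket (Function.update k i (k i - 1))
  star_x_succ : ∀ (i : Fin n) k, ψ (star (x i.succ.succ)) (ket k) =
    ((√(1 - q⁻¹ ^ (2 * (k i + 1))) * q⁻¹ ^ ∑ j ∈ Finset.Ioi i, k j : ℝ) : ℂ) •
      ket (Function.update k i (k i + 1))

/-! ### The `C^*`-algebras -/

/-- The separable infinite-dimensional Hilbert space `ℓ²(ℕ)`. -/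
abbrev EllTwo : Type := lp (fun _ : ℕ => ℂ) 2

instance : Nontrivial EllTwo :=
  ⟨lp.single 2 0 1, 0, fun h => by
    have := congrArg (fun f : EllTwo => f 0) h
    simp at this⟩

/-- Bounded operators on `ℓ²(ℕ)`. -/
abbrev BEllTwo : Type := EllTwo →L[ℂ] EllTwo

section Bounded

variable {H : Type*} [NormedAddCommGroup H] [InnerProductSpace ℂ H] [CompleteSpace H]

theorem norm_le_of_isSphereTuple {q : ℝ} {n : ℕ} {odd : Prop} {b : Fin (n + 1) → (H →L[ℂ] H)}
    (hb : IsSphereTuple q odd b) (i : Fin (n + 1)) : ‖b i‖ ≤ 1 := by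
  have key : ∀ v, ‖b 0 v‖ ^ 2 + ∑ j ∈ Finset.Ioc 0 (Fin.last n), ‖b j v‖ ^ 2 = ‖v‖ ^ 2 := by
    intro v
    have h := congrArg (fun T : H →L[ℂ] H => (inner ℂ (T v) v).re) hb.sphere
    simp only [partialRadius, pow_two (b 0), add_apply,
      sum_apply, ContinuousLinearMap.mul_def, ContinuousLinearMap.comp_apply, inner_add_left, sum_inner,
      one_apply_eq_self, Complex.add_re, Complex.re_sum] at h
    have h1 : ∀ j, (inner ℂ ((star (b j)) (b j v)) v).re = ‖b j v‖ ^ 2 := by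
      intro j
      rw [ContinuousLinearMap.star_eq_adjoint, ContinuousLinearMap.adjoint_inner_left]
      exact inner_self_eq_norm_sq (𝕜 := ℂ) _
    have h2 : (inner ℂ v v).re = ‖v‖ ^ 2 := inner_self_eq_norm_sq (𝕜 := ℂ) _
    have h3 : (inner ℂ (b 0 (b 0 v)) v).re = ‖b 0 v‖ ^ 2 := by
      have := h1 0
      rwa [hb.selfAdjoint] at this
    rw [h2, h3, Finset.sum_congr rfl fun j _ => h1 j] at h
    exact h
  refine ContinuousLinearMap.opNorm_le_bound _ zero_le_one fun v => ?_
  rw [one_mul]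
  refine le_of_sq_le_sq ?_ (norm_nonneg _)
  rw [← key v]
  have hnn : ∀ j ∈ Finset.Ioc 0 (Fin.last n), 0 ≤ ‖b j v‖ ^ 2 := fun _ _ => sq_nonneg _
  by_cases hi : i = 0
  · rw [hi]
    linarith [Finset.sum_nonneg hnn]
  · have := Finset.single_le_sum hnn
      (Finset.mem_Ioc.2 ⟨Fin.pos_iff_ne_zero.2 hi, Fin.le_last i⟩)
    linarith [sq_nonneg ‖b 0 v‖]

theorem IsSphereTuple.map {q : ℝ} {n : ℕ} {odd : Prop} {A B : Type*} [Ring A] [Algebra ℂ A]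
    [StarRing A] [Ring B] [Algebra ℂ B] [StarRing B] {b : Fin (n + 1) → A}
    (hb : IsSphereTuple q odd b) (f : A →⋆ₐ[ℂ] B) : IsSphereTuple q odd (fun i => f (b i)) := by
  have hp : ∀ i, partialRadius (fun i => f (b i)) i = f (partialRadius b i) := fun i => by
    simp only [partialRadius, map_add, map_pow, map_sum, map_mul, map_star]
  refine ⟨?_, ?_, ?_, ?_, ?_, ?_⟩
  · rw [← map_star, hb.selfAdjoint]
  · intro h
    rw [hb.zero h, map_zero]
  · intro i j h
    rw [← map_mul, hb.comm i j h, map_smul, map_mul]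
  · intro i j h
    rw [← map_star, ← map_mul, hb.comm_star i j h, map_smul, map_mul]
  · intro i
    rw [← map_star, ← map_mul, ← map_mul, ← map_sub, hb.bracket i, map_smul, hp]
  · rw [hp, hb.sphere, map_one]

/-- Every element is bounded uniformly over all representations. -/
theorem exists_norm_rep_le {q : ℝ} {n : ℕ} {odd : Prop} [Nontrivial H]
    (a : SphereAlgebra q n odd) : ∃ C : ℝ, ∀ ψ : HilbertRep (SphereAlgebra q n odd) H, ‖ψ a‖ ≤ C := by
  obtain ⟨a, rfl⟩ := mk_surjective a
  induction a using FreeStarAlgebra.induct with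
  | hc c =>
    refine ⟨‖c‖, fun ψ => ?_⟩
    rw [AlgHom.commutes, AlgHomClass.commutes, norm_algebraMap']
  | hι y =>
    refine ⟨1, fun ψ => ?_⟩
    have h : ∀ i, ‖ψ (mk (.gen i))‖ ≤ 1 := norm_le_of_isSphereTuple (isSphereTuple_x.map ψ)
    cases y with
    | inl i => exact h i
    | inr i =>
      rw [← FreeStarAlgebra.star_gen, mk_star, map_star, norm_star]
      exact h i
  | hm a b ha hb =>
    obtain ⟨C, hC⟩ := ha
    obtain ⟨D, hD⟩ := hb
    refine ⟨C * D, fun ψ => ?_⟩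
    rw [map_mul, map_mul]
    exact (norm_mul_le _ _).trans
      (mul_le_mul (hC ψ) (hD ψ) (norm_nonneg _) ((norm_nonneg _).trans (hC ψ)))
  | ha a b ha hb =>
    obtain ⟨C, hC⟩ := ha
    obtain ⟨D, hD⟩ := hb
    refine ⟨C + D, fun ψ => ?_⟩
    rw [map_add, map_add]
    exact (norm_add_le _ _).trans (add_le_add (hC ψ) (hD ψ))

end Bounded

section Completion

/-- The `C^*`-algebra of all bounded families, indexed by `I`, of bounded operators on `H`, with
the supremum norm. -/
def BoundedFamilies (I : Type u) (H : Type v) [NormedAddCommGroup H] [InnerProductSpace ℂ H]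
    [CompleteSpace H] : Type (max u v) :=
  lp (fun _ : I => H →L[ℂ] H) ∞

section

variable {I : Type u} {H : Type v} [NormedAddCommGroup H] [InnerProductSpace ℂ H]
  [CompleteSpace H] [Nontrivial H]

instance : CStarAlgebra (BoundedFamilies I H) :=
  { (lp.inftyNormedRing : NormedRing (lp (fun _ : I => H →L[ℂ] H) ∞)),
    (lp.inftyStarRing : StarRing (lp (fun _ : I => H →L[ℂ] H) ∞)),
    (lp.inftyNormedAlgebra : NormedAlgebra ℂ (lp (fun _ : I => H →L[ℂ] H) ∞)) with
    complete := (inferInstance : CompleteSpace (lp (fun _ : I => H →L[ℂ] H) ∞)).complete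
    norm_mul_self_le := (lp.inftyCStarRing (B := fun _ : I => H →L[ℂ] H)).norm_mul_self_le
    star_smul := (inferInstance : StarModule ℂ (lp (fun _ : I => H →L[ℂ] H) ∞)).star_smul }

end

section

variable {A : Type u} [Ring A] [Algebra ℂ A] [StarRing A] {C : Type v} [CStarAlgebra C]

/-- The closure of the range of a `*`-homomorphism into a `C^*`-algebra. -/
def closedRange (f : A →⋆ₐ[ℂ] C) : StarSubalgebra ℂ C := f.range.topologicalClosure

/-- The closure of the range, as a `C^*`-algebra. -/
def ClosedRange (f : A →⋆ₐ[ℂ] C) : Type v := closedRange f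

instance (f : A →⋆ₐ[ℂ] C) : CStarAlgebra (ClosedRange f) :=
  StarSubalgebra.cstarAlgebra (closedRange f)
    (h_closed := StarSubalgebra.isClosed_topologicalClosure f.range)

/-- The corestriction to the closure of the range. -/
def toClosedRange (f : A →⋆ₐ[ℂ] C) : A →⋆ₐ[ℂ] ClosedRange f :=
  f.codRestrict (closedRange f) fun a =>
    StarSubalgebra.le_topologicalClosure f.range ⟨a, rfl⟩

end

variable (q : ℝ) (n : ℕ) (odd : Prop)

/-- The universal representation `a ↦ (ψ(a))_ψ`, where `ψ` runs through all `*`-representations on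
`ℓ²(ℕ)`. Its norm is the universal `C^*`-norm `‖a‖ = sup_ψ ‖ψ(a)‖`: the algebra has finitely many
generators, so separable representations suffice, and after a countable amplification they
live on `ℓ²(ℕ)`. -/
def universalRep : SphereAlgebra q n odd →⋆ₐ[ℂ]
    BoundedFamilies (HilbertRep (SphereAlgebra q n odd) EllTwo) EllTwo where
  toFun a := ⟨fun ψ => ψ a, memℓp_infty_iff.2 (by
    obtain ⟨C, hC⟩ := exists_norm_rep_le (H := EllTwo) a
    exact ⟨C, by rintro _ ⟨ψ, rfl⟩; exact hC ψ⟩)⟩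
  map_one' := Subtype.ext (funext fun ψ => map_one ψ)
  map_mul' a b := Subtype.ext (funext fun ψ => map_mul ψ a b)
  map_zero' := Subtype.ext (funext fun ψ => map_zero ψ)
  map_add' a b := Subtype.ext (funext fun ψ => map_add ψ a b)
  commutes' c := Subtype.ext (funext fun ψ => AlgHomClass.commutes ψ c)
  map_star' a := Subtype.ext (funext fun ψ => map_star ψ a)

/-- The `C^*`-algebra of continuous functions on the quantum sphere: the universal
`C^*`-completion of the sphere algebra, that is the norm closure of its image in the universal
representation. -/
def CSphere : Type := ClosedRange (universalRep q n odd)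

instance : CStarAlgebra (CSphere q n odd) :=
  inferInstanceAs (CStarAlgebra (ClosedRange (universalRep q n odd)))

/-- `C(S_q^{2n})`. -/
abbrev CEvenSphere : Type := CSphere q n False

/-- `C(S_q^{2n-1})`. -/
abbrev COddSphere : Type := CSphere q n True

/-- The canonical map `A(S) → C(S)`. -/
def toC : SphereAlgebra q n odd →⋆ₐ[ℂ] CSphere q n odd :=
  toClosedRange (universalRep q n odd)

end Completion

/-! ### Compact operators -/

section Compact

variable (H : Type*) [NormedAddCommGroup H] [InnerProductSpace ℂ H] [CompleteSpace H]

variable {H} in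
theorem isCompactOperator_star {T : H →L[ℂ] H} (hT : IsCompactOperator T) :
    IsCompactOperator (star T : H →L[ℂ] H) := by
  rw [ContinuousLinearMap.star_eq_adjoint]
  set S := ContinuousLinearMap.adjoint T with hS
  have hTS : IsCompactOperator (T.comp S) := hT.comp_clm S
  have hcpt : IsCompact (closure (T.comp S '' Metric.closedBall 0 1)) :=
    IsCompactOperator.isCompact_closure_image_closedBall (f := (T.comp S).toLinearMap) hTS 1
  have htb : TotallyBounded (T.comp S '' Metric.closedBall 0 1) :=
    hcpt.totallyBounded.subset subset_closure
  suffices h : TotallyBounded (S '' Metric.closedBall 0 1) by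
    refine (isCompactOperator_iff_isCompact_closure_image_closedBall
      (S.toLinearMap) one_pos).2 ?_
    exact (h.closure).isCompact_of_isClosed isClosed_closure
  rw [Metric.totallyBounded_iff]
  intro ε hε
  obtain ⟨t, htsub, htfin, htcov⟩ :=
    Metric.finite_approx_of_totallyBounded htb (ε ^ 2 / 4) (by positivity)
  obtain ⟨t', ht'sub, ht'fin, rfl⟩ := (Set.exists_subset_image_finite_and
    (p := fun t0 => t0 = t)).1 ⟨t, htsub, htfin, rfl⟩
  refine ⟨S '' t', ht'fin.image _, ?_⟩
  rintro _ ⟨x, hx, rfl⟩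
  obtain ⟨_, ⟨y, hy, rfl⟩, hxy⟩ := Set.mem_iUnion₂.1 (htcov ⟨x, hx, rfl⟩)
  have hy' := ht'sub hy
  refine Set.mem_iUnion₂.2 ⟨S y, ⟨y, hy, rfl⟩, ?_⟩
  rw [mem_closedBall_zero_iff] at hx hy'
  rw [Metric.mem_ball, dist_eq_norm, ← map_sub] at hxy ⊢
  have h1 : ‖S (x - y)‖ ^ 2 ≤ ‖T (S (x - y))‖ * ‖x - y‖ := by
    have h2 : (inner ℂ (T (S (x - y))) (x - y)) = inner ℂ (S (x - y)) (S (x - y)) := by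
      rw [hS, ContinuousLinearMap.adjoint_inner_right]
    calc ‖S (x - y)‖ ^ 2 = ‖inner ℂ (T (S (x - y))) (x - y)‖ := by
          rw [h2, inner_self_eq_norm_sq_to_K]; simp
      _ ≤ _ := norm_inner_le_norm _ _
  have h3 : ‖x - y‖ ≤ 2 := (norm_sub_le _ _).trans (by linarith)
  have h4 : ‖T (S (x - y))‖ < ε ^ 2 / 4 := hxy
  refine lt_of_pow_lt_pow_left₀ 2 hε.le ?_
  nlinarith [norm_nonneg (T (S (x - y))), sq_pos_of_pos hε]

/-- The algebra of compact operators. -/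
def compactOperators : NonUnitalStarSubalgebra ℂ (H →L[ℂ] H) where
  carrier := {T | IsCompactOperator T}
  add_mem' h h' := h.add h'
  zero_mem' := isCompactOperator_zero
  mul_mem' {_ T} h _ := h.comp_clm T
  smul_mem' c _ h := h.smul c
  star_mem' h := isCompactOperator_star h

/-- `C(S^1) ⊗ 𝒦(H)`, realized in `C(S^1, B(H))` as the closed `*`-subalgebra generated by the
elementary tensors `f ⊗ T : z ↦ f(z) T` (these are closed under product and involution, so that
this is the closure of the algebraic tensor product). -/
def circleTensorCompact : NonUnitalStarSubalgebra ℂ C(Circle, H →L[ℂ] H) :=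
  (NonUnitalStarAlgebra.adjoin ℂ
    {g : C(Circle, H →L[ℂ] H) | ∃ f : C(Circle, ℂ), ∃ T ∈ compactOperators H,
      ∀ z, g z = f z • T}).topologicalClosure

end Compact

/-- `𝒦`, the compact operators on `ℓ²(ℕ)`. -/
abbrev Compacts : Type := compactOperators EllTwo

/-- `C(S^1) ⊗ 𝒦`. -/
abbrev CircleTensorCompacts : Type := circleTensorCompact EllTwo

/-- `0 → I → A → B → 0` is an exact sequence of `*`-homomorphisms. -/
structure IsExtension {I A B : Type*} [NonUnitalNonAssocSemiring I] [DistribMulAction ℂ I]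
    [Star I] [Ring A] [Algebra ℂ A] [StarRing A] [Ring B] [Algebra ℂ B] [StarRing B] (j : I →⋆ₙₐ[ℂ] A)
    (π : A →⋆ₐ[ℂ] B) : Prop where
  injective : Function.Injective j
  exact : ∀ a, π a = 0 ↔ a ∈ Set.range j
  surjective : Function.Surjective π

end QuantumSphere

end

open QuantumSphere

/-! Even and odd spheres are treated together. The bottom element `T` is `x_0` in the even case and
`x_1` in the odd case, where `x_0 = 0` turns the bracket relation of `x_1` into normality of `T`.
The remaining generators are the `Y_i`. A homomorphism factors through the quotient as soon as it
kills `T`.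

Everything rests on a computation inside an arbitrary C*-algebra. Let `y` be the last generator and
`s` the radius of the others, so that `s + y^* y = 1` and `y y^* = 1 - q^{-2} s`. Since `q^{-2} <
1`, the element `y y^*` is bounded below, so `y^* = V h` with `h = (1 - q^{-2} s)^{1/2}` and an
isometry `V` of the algebra. On `p' = 1 - V V^*` one has `y = 0`, hence `s = 1`. The relation `s V =
q^{-2} V s` then makes `s` act on `V^a p'` as `q^{-2a}` (`exists_isLadder`). That the radius is `1`
below `p'` is the original hypothesis with one generator fewer. Induction (`exists_isMatrixUnits`)
gives a vacuum projection `p₀` with `T^* T p₀ = p₀` and partial isometries `e_k`, `k ∈ ℕ^n`, on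
which the generators act by the stated formulas. Because `T V = q^{-1} V T` decays geometrically,
suitable finite sums `P = ∑ e_k e_k^*` make `T (1 - P)` arbitrarily small.

Classification: if `T ≠ 0` in an irreducible representation, then `p₀ ≠ 0` and `T` restricts to a
unitary of `p₀ H`. A subspace of `p₀ H` reducing this unitary generates a reducing subspace of `H`,
so by a Schur argument `T` is a scalar `z` of modulus one on `p₀ H`. For a unit vector `ξ` in `p₀ H`
the vectors `e_k ξ` form the required basis (`exists_standardBasis`). Conversely, telescoping
identities show that the formulas define representations. These are irreducible, and `z` is an
invariant, because the joint kernel of the lowering operators is the vacuum line.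

Exact sequences: let `π` be the map of completions. If `π a = 0`, then `a (1 - P_m) → 0` for such
sums `P_m`. Otherwise vector states along an ultrafilter give, by GNS, a cyclic representation in
which `T` kills the cyclic vector and `a` does not; as `T` commutes up to scalars with the
generators, it vanishes there, so the representation is dominated by `π`, a contradiction
(`IsVacuumQuotient.tendsto`). The representations `ψ_ω`, with `ω` in `Ω = {±1}` or `S^1`, assemble
to a homomorphism `Ψ` into `C(Ω, B(ℓ²))`. The corner at `p₀` consists of functions on `Ω`
(`IsFockFamily.star_mul_mul`), so `Ψ a = 0` forces `a e_k = 0` for all `k`, and `Ψ` is injective on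
`ker π`. Its image there consists of the uniform limits of finite matrices of functions on `Ω`,
which is `𝒦 ⊕ 𝒦` or `C(S^1) ⊗ 𝒦`. -/

namespace QuantumSphere

/-! ### The polar decomposition that splits off one generator. -/

section OneStep

variable {A : Type*} [CStarAlgebra A]

/-- The difference `z = h x - μ x` satisfies `h z = -μ z`, and a positive element has no negative
eigenvalue: `z^* h z = -μ z^* z` is both nonnegative and nonpositive. -/
theorem mul_eq_smul_of_sq [PartialOrder A] [StarOrderedRing A] {h x : A} {μ : ℝ} (hh : 0 ≤ h)
    (hμ : 0 < μ) (hx : h * (h * x) = ((μ ^ 2 : ℝ) : ℂ) • x) : h * x = (μ : ℂ) • x := by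
  set z := h * x - (μ : ℂ) • x with hz
  have h1 : h * z = -((μ : ℂ) • z) := by
    rw [hz, mul_sub, hx, mul_smul_comm, smul_sub, smul_smul]
    push_cast
    rw [pow_two]
    abel
  have h2 : 0 ≤ star z * h * z := star_left_conjugate_nonneg hh z
  rw [mul_assoc, h1, mul_neg, mul_smul_comm] at h2
  have h3 : (0 : A) ≤ (μ : ℂ) • (star z * z) := by
    rw [Complex.coe_smul]
    exact smul_nonneg hμ.le (star_mul_self_nonneg z)
  have h4 : (μ : ℂ) • (star z * z) = 0 := le_antisymm (by simpa using h2) h3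
  have h5 : star z * z = 0 :=
    (smul_eq_zero.1 h4).resolve_left (by exact_mod_cast hμ.ne')
  have h6 : z = 0 := CStarRing.star_mul_self_eq_zero_iff z |>.1 h5
  exact sub_eq_zero.1 h6

/-- `g = (1 - c s)^{-1/2}` by continuous functional calculus; the spectrum of `s` lies in `[0, 1]`
and `c < 1`, so the function is continuous there. Being a function of `s`, `g` commutes with the
commutant of `s`. -/
theorem exists_inv_sqrt [PartialOrder A] [StarOrderedRing A] {s : A} {c : ℝ} (hc0 : 0 ≤ c)
    (hc1 : c < 1) (hs0 : 0 ≤ s) (hs1 : s ≤ 1) :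
    ∃ g : A, star g = g ∧ 0 ≤ g ∧ g * g * (1 - (c : ℂ) • s) = 1 ∧
      ∀ b, Commute b s → Commute b g := by
  have hsa : IsSelfAdjoint s := .of_nonneg hs0
  have hspec : ∀ x ∈ spectrum ℝ s, 0 < 1 - c * x := by
    intro x hx
    have h0 : 0 ≤ x := spectrum_nonneg_of_nonneg hs0 hx
    have h1 : x ≤ 1 := by
      have := (le_algebraMap_iff_spectrum_le (r := (1 : ℝ)) hsa).1 (by simpa using hs1)
      exact this x hx
    nlinarith
  set f : ℝ → ℝ := fun x => (√(1 - c * x))⁻¹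
  have hf : ContinuousOn f (spectrum ℝ s) := by
    refine ContinuousOn.inv₀ (by fun_prop) fun x hx => ?_
    exact (Real.sqrt_pos.2 (hspec x hx)).ne'
  refine ⟨cfc f s, cfc_predicate f s, cfc_nonneg fun x _ => by positivity, ?_, fun b hb =>
    (hb.symm.cfc_real f).symm⟩
  have h1 : 1 - (c : ℂ) • s = cfc (fun x : ℝ => 1 - c * x) s := by
    rw [cfc_sub .., cfc_const_mul .., cfc_const_one .., cfc_id' ℝ s, Complex.coe_smul]
  rw [h1, ← cfc_mul .., ← cfc_mul .., ← cfc_const_one ℝ s]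
  refine cfc_congr fun x hx => ?_
  have := Real.sqrt_pos.2 (hspec x hx)
  simp only [f, ← mul_inv, Real.mul_self_sqrt (hspec x hx).le]
  exact inv_mul_cancel₀ (hspec x hx).ne'

/-- The isometry `V` and the projection `p' = p - V V^*` onto the kernel, obtained from the polar
decomposition of `y^*`, for operators with `s + y^* y = p` and `y y^* = p - q^{-2} s`. -/
structure IsLadder (q : ℝ) (p s y V p' : A) : Prop where
  star_mul_self : star V * V = p
  eq_sub : p' = p - V * star V
  star_ground : star p' = p'
  ground_mul_self : p' * p' = p'
  mul_ground : p * p' = p'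
  mul_iso : p * V = V
  iso_mul : V * p = V
  star_iso_mul_ground : star V * p' = 0
  radius_mul_ground : s * p' = p'
  lower_ground : y * p' = 0
  lower : ∀ a : ℕ, y * (V ^ (a + 1) * p') =
    ((√(1 - q⁻¹ ^ (2 * (a + 1))) : ℝ) : ℂ) • (V ^ a * p')
  raise : ∀ a : ℕ, star y * (V ^ a * p') =
    ((√(1 - q⁻¹ ^ (2 * (a + 1))) : ℝ) : ℂ) • (V ^ (a + 1) * p')
  comm_iso : ∀ b, b * p = p * b → b * y = (q : ℂ) • (y * b) →
    star b * y = (q : ℂ) • (y * star b) → b * V = (q : ℂ)⁻¹ • (V * b) ∧ b * p' = p' * b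

/-- Since `s ≤ 1` and `q^{-2} < 1`, `y y^*` is invertible in the corner of `p`, so the isometric
part `V = y^* (1 - q^{-2} s)^{-1/2}` of `y^*` lies in the algebra. `V` shifts the eigenvalues of `s`
by the factor `q^{-2}`, starting from `1` on `p'`. The hypothesis `hs` encodes positivity of `s`
without reference to an order on `A`. -/
theorem exists_isLadder {q : ℝ} (hq : 1 < |q|) {p s y : A} (hp : star p = p) (hpp : p * p = p)
    (hyp : y * p = y) (hpy : p * y = y) (hs : ∃ (m : ℕ) (t : Fin m → A), s = ∑ i, star (t i) * t i)
    (hsum : s + star y * y = p) (hyy : y * star y = p - ((q : ℂ) ^ 2)⁻¹ • s)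
    (hsy : s * y = (q : ℂ) ^ 2 • (y * s)) : ∃ V p', IsLadder q p s y V p' := by
  let _ := CStarAlgebra.spectralOrder A
  have := CStarAlgebra.spectralOrderedRing A
  have hq0 : (q : ℂ) ≠ 0 := by
    intro h
    have : q = 0 := by exact_mod_cast h
    simp [this] at hq
    linarith
  have hq2 : 1 < q ^ 2 := by
    rw [← sq_abs]
    nlinarith
  set c : ℝ := (q ^ 2)⁻¹ with hc
  have hcC : ((q : ℂ) ^ 2)⁻¹ = (c : ℂ) := by rw [hc]; push_cast; rfl
  have hc0 : 0 < c := by positivity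
  have hc1 : c < 1 := inv_lt_one_of_one_lt₀ hq2
  rw [hcC] at hyy
  have hs0 : 0 ≤ s := by
    obtain ⟨m, t, rfl⟩ := hs
    exact Finset.sum_nonneg fun i _ => star_mul_self_nonneg _
  have hssa : star s = s := (IsSelfAdjoint.of_nonneg hs0).star_eq
  have hp1 : p ≤ 1 := by
    have h : 0 ≤ star (1 - p) * (1 - p) := star_mul_self_nonneg _
    have h' : star (1 - p) * (1 - p) = 1 - p := by
      rw [star_sub, star_one, hp, mul_sub, sub_mul, sub_mul, hpp]
      simp
    rw [h'] at h
    exact sub_nonneg.1 h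
  have hs1 : s ≤ 1 := by
    refine le_trans ?_ hp1
    rw [← hsum]
    exact le_add_of_nonneg_right (star_mul_self_nonneg y)
  obtain ⟨g, hg, hg0, hgg, hgc⟩ := exists_inv_sqrt hc0.le hc1 hs0 hs1
  have hgs : g * s = s * g := (hgc s (Commute.refl s)).eq.symm
  have hpys : p * star y = star y := by
    have := congrArg star hyp
    rwa [star_mul, hp] at this
  have hysp : star y * p = star y := by
    have := congrArg star hpy
    rwa [star_mul, hp] at this
  have hsp' : s = p - star y * y := by rw [← hsum]; abel
  have hps : p * s = s := by
    rw [hsp', mul_sub, hpp, ← mul_assoc, hpys]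
  have hsp : s * p = s := by
    rw [hsp', sub_mul, hpp, mul_assoc, hyp]
  have hgp : g * p = p * g := (hgc p (by rw [Commute, SemiconjBy, hps, hsp])).eq.symm
  have hsys : s * star y = (c : ℂ) • (star y * s) := by
    have := congrArg star hsy
    rw [star_mul, star_smul, star_mul, hssa] at this
    rw [this, smul_smul, ← hcC]
    have h2 : star ((q : ℂ) ^ 2) = (q : ℂ) ^ 2 := by
      rw [star_pow]; congr 1; exact Complex.conj_ofReal q
    rw [h2, inv_mul_cancel₀ (pow_ne_zero 2 hq0), one_smul]
  -- the inverse `h` of `g`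
  set h : A := g * (1 - (c : ℂ) • s) with hh
  have hgs1 : g * (1 - (c : ℂ) • s) = (1 - (c : ℂ) • s) * g := by
    rw [mul_sub, sub_mul, mul_one, one_mul, mul_smul_comm, smul_mul_assoc, hgs]
  have hgh : g * h = 1 := by rw [hh, ← mul_assoc, hgg]
  have hhg : h * g = 1 := by rw [hh, mul_assoc, ← hgs1, ← mul_assoc, hgg]
  have hhh : h * h = 1 - (c : ℂ) • s := by
    calc h * h = h * (g * (1 - (c : ℂ) • s)) := by rw [← hh]
      _ = _ := by rw [← mul_assoc, hhg, one_mul]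
  have hhsa : star h = h := by
    calc star h = star h * (g * h) := by rw [hgh, mul_one]
      _ = star h * star g * h := by rw [hg, mul_assoc]
      _ = h := by rw [← star_mul g h, hgh, star_one, one_mul]
  have hh0 : 0 ≤ h := by
    have := star_left_conjugate_nonneg hg0 h
    rwa [hhsa, hhg, one_mul] at this
  set V : A := star y * g with hV
  have hVs : star V = g * y := by rw [hV, star_mul, star_star, hg]
  have hVV : star V * V = p := by
    rw [hVs, hV]
    calc g * y * (star y * g) = g * (y * star y) * g := by simp only [mul_assoc]
      -- `s p = s` lets `p` be factored out of `y y^* = p - c s`.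
      _ = g * ((1 - (c : ℂ) • s) * p) * g := by
        rw [hyy, sub_mul, one_mul, smul_mul_assoc, hsp]
      _ = g * (1 - (c : ℂ) • s) * (p * g) := by simp only [mul_assoc]
      _ = g * (g * (1 - (c : ℂ) • s)) * p := by rw [← hgp, hgs1, ← hgs1]; simp only [mul_assoc]; rw [← mul_assoc _ g p, ← hgs1, mul_assoc]
      _ = p := by rw [← mul_assoc, hgg, one_mul]
  have hpV : p * V = V := by rw [hV, ← mul_assoc, hpys]
  have hVp : V * p = V := by rw [hV, mul_assoc, hgp, ← mul_assoc, hysp]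
  have hVsp : star V * p = star V := by
    have := congrArg star hpV
    rwa [star_mul, hp] at this
  have hpVs : p * star V = star V := by
    have := congrArg star hVp
    rwa [star_mul, hp] at this
  have hVh : star y = V * h := by rw [hV, mul_assoc, hgh, mul_one]
  have hy : y = h * star V := by
    have := congrArg star hVh
    rwa [star_star, star_mul, hhsa] at this
  set p' : A := p - V * star V with hp'
  have hVp' : star V * p' = 0 := by
    rw [hp', mul_sub, hVsp, ← mul_assoc, hVV, hpVs, sub_self]
  have hpp' : p * p' = p' := by rw [hp', mul_sub, hpp, ← mul_assoc, hpV]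
  have hyp' : y * p' = 0 := by rw [hy, mul_assoc, hVp', mul_zero]
  -- On the kernel of `y` the relation `s + y^* y = p` leaves `s = p`.
  have hspp : s * p' = p' := by
    have : s * p' = p * p' - star y * (y * p') := by rw [← mul_assoc, ← sub_mul, ← hsp']
    rw [this, hyp', mul_zero, sub_zero, hpp']
  have hsV : s * V = (c : ℂ) • (V * s) := by
    rw [hV, ← mul_assoc, hsys, smul_mul_assoc, mul_assoc, mul_assoc, hgs]
  have hsVa : ∀ a : ℕ, s * (V ^ a * p') = ((c ^ a : ℝ) : ℂ) • (V ^ a * p') := by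
    intro a
    induction a with
    | zero => simp [hspp]
    | succ a ih =>
      rw [pow_succ', mul_assoc, ← mul_assoc s, hsV, smul_mul_assoc, mul_assoc, ih, mul_smul_comm,
        smul_smul]
      push_cast
      rw [pow_succ', mul_assoc]
  have hca : ∀ a : ℕ, q⁻¹ ^ (2 * (a + 1)) = c * c ^ a := by
    intro a
    rw [pow_mul, inv_pow, ← hc, pow_succ']
  have hpos : ∀ a : ℕ, 0 < 1 - c * c ^ a := by
    intro a
    have : c ^ a ≤ 1 := pow_le_one₀ hc0.le hc1.le
    nlinarith
  -- Only `h² = 1 - c s` is known on `V^a p'`; positivity of `h` selects the positive root.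
  have hhVa : ∀ a : ℕ, h * (V ^ a * p') = ((√(1 - q⁻¹ ^ (2 * (a + 1))) : ℝ) : ℂ) • (V ^ a * p') := by
    intro a
    refine mul_eq_smul_of_sq hh0 ?_ ?_
    · rw [hca]
      exact Real.sqrt_pos.2 (hpos a)
    · rw [hca, Real.sq_sqrt (hpos a).le, ← mul_assoc, hhh, sub_mul, one_mul, smul_mul_assoc, hsVa,
        smul_smul]
      push_cast
      rw [sub_smul, one_smul]
  clear_value h V p'
  refine ⟨V, p', ⟨hVV, hp', ?_, ?_, hpp', hpV, hVp, hVp', hspp, hyp', ?_, ?_, ?_⟩⟩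
  · rw [hp', star_sub, hp, star_mul, star_star]
  · nth_rewrite 1 [hp']
    rw [sub_mul, hpp', mul_assoc, hVp', mul_zero, sub_zero]
  · intro a
    have : star V * (V ^ (a + 1) * p') = V ^ a * p' := by
      rw [pow_succ', ← mul_assoc, ← mul_assoc, hVV]
      cases a with
      | zero => simp [hpp']
      | succ a => rw [pow_succ', ← mul_assoc, hpV]
    rw [hy, mul_assoc, this, hhVa]
  · intro a
    rw [hVh, mul_assoc, hhVa, mul_smul_comm, ← mul_assoc, ← pow_succ']
  · intro b hbp hby hbsy
    have hbys : b * star y = (q : ℂ)⁻¹ • (star y * b) := by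
      have := congrArg star hbsy
      rw [star_mul, star_star, star_smul, star_mul, star_star] at this
      rw [this, smul_smul]
      have h2 : star (q : ℂ) = (q : ℂ) := Complex.conj_ofReal q
      rw [h2, inv_mul_cancel₀ hq0, one_smul]
    -- Moving `b` past `y^*` costs `q^{-1}` and past `y` costs `q`, so `b` commutes with `y^* y` and
    -- with `s = p - y^* y`.
    have hbs : Commute b s := by
      rw [Commute, SemiconjBy, hsp', mul_sub, sub_mul, hbp, ← mul_assoc, hbys, smul_mul_assoc,
        mul_assoc, hby, mul_smul_comm, smul_smul, inv_mul_cancel₀ hq0, one_smul, mul_assoc]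
    have hbg := (hgc b hbs).eq
    have hbV : b * V = (q : ℂ)⁻¹ • (V * b) := by
      rw [hV, ← mul_assoc, hbys, smul_mul_assoc, mul_assoc, hbg, mul_assoc]
    have hbVs : b * star V = (q : ℂ) • (star V * b) := by
      rw [hVs, ← mul_assoc, hbg, mul_assoc, hby, mul_smul_comm, mul_assoc]
    refine ⟨hbV, ?_⟩
    rw [hp', mul_sub, sub_mul, hbp, ← mul_assoc, hbV, smul_mul_assoc, mul_assoc, hbVs,
      mul_smul_comm, smul_smul, inv_mul_cancel₀ hq0, one_smul, mul_assoc]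

end OneStep

end QuantumSphere

namespace QuantumSphere

/-! ### Tuples with a normal bottom element -/

section Core

variable {A : Type*} [Ring A] [Algebra ℂ A] [StarRing A]

/-- The relations shared by the generators `x_0, x_1, …` of the even spheres and
`x_1, x_2, …` of the odd spheres, with the exception of the sphere relation: the bottom element `T`
is normal. -/
structure IsCoreTuple (q : ℝ) {n : ℕ} (T : A) (Y : Fin n → A) : Prop where
  normal : T * star T = star T * T
  T_mul : ∀ i, T * Y i = (q : ℂ) • (Y i * T)
  star_T_mul : ∀ i, star T * Y i = (q : ℂ) • (Y i * star T)
  comm : ∀ i j, i < j → Y i * Y j = (q : ℂ) • (Y j * Y i)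
  comm_star : ∀ i j, i ≠ j → star (Y i) * Y j = (q : ℂ) • (Y j * star (Y i))
  bracket : ∀ i, Y i * star (Y i) - star (Y i) * Y i =
    (1 - ((q : ℂ) ^ 2)⁻¹) • (star T * T + ∑ j ∈ Finset.Iio i, star (Y j) * Y j)

/-- The total radius `T^* T + ∑ Y_j^* Y_j`. -/
def coreRadius {A : Type*} [Ring A] [StarRing A] {n : ℕ} (T : A) (Y : Fin n → A) : A := star T * T + ∑ j, star (Y j) * Y j

theorem coreRadius_succ {A : Type*} [Ring A] [StarRing A] {n : ℕ} (T : A) (Y : Fin (n + 1) → A) :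
    coreRadius T Y = coreRadius T (Y ∘ Fin.castSucc) + star (Y (Fin.last n)) * Y (Fin.last n) := by
  simp only [coreRadius, Fin.sum_univ_castSucc, Function.comp, add_assoc]

theorem IsCoreTuple.castSucc {q : ℝ} {n : ℕ} {T : A} {Y : Fin (n + 1) → A}
    (h : IsCoreTuple q T Y) : IsCoreTuple q T (Y ∘ Fin.castSucc) where
  normal := h.normal
  T_mul i := h.T_mul _
  star_T_mul i := h.star_T_mul _
  comm i j hij := h.comm _ _ (by simpa using hij)
  comm_star i j hij := h.comm_star _ _ (by simpa using hij)
  bracket i := by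
    have := h.bracket i.castSucc
    rw [← Fin.map_castSuccEmb_Iio, Finset.sum_map] at this
    exact this

theorem IsCoreTuple.bracket_last {q : ℝ} {n : ℕ} {T : A} {Y : Fin (n + 1) → A}
    (h : IsCoreTuple q T Y) :
    Y (Fin.last n) * star (Y (Fin.last n)) - star (Y (Fin.last n)) * Y (Fin.last n) =
      (1 - ((q : ℂ) ^ 2)⁻¹) • coreRadius T (Y ∘ Fin.castSucc) := by
  rw [h.bracket, Fin.Iio_last_eq_map, Finset.sum_map]
  rfl

/-- Each summand `Y_j^* Y_j` passes the last generator with one factor `q` from `Y_j` and one from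
`Y_j^*`. -/
theorem IsCoreTuple.coreRadius_mul_last {q : ℝ} {n : ℕ} {T : A} {Y : Fin (n + 1) → A}
    (h : IsCoreTuple q T Y) :
    coreRadius T (Y ∘ Fin.castSucc) * Y (Fin.last n) =
      (q : ℂ) ^ 2 • (Y (Fin.last n) * coreRadius T (Y ∘ Fin.castSucc)) := by
  simp only [coreRadius, add_mul, mul_add, Finset.sum_mul, Finset.mul_sum, smul_add,
    Finset.smul_sum, Function.comp]
  congr 1
  · rw [mul_assoc, h.T_mul, mul_smul_comm, ← mul_assoc, h.star_T_mul, smul_mul_assoc, smul_smul,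
      mul_assoc, pow_two]
  · refine Finset.sum_congr rfl fun j _ => ?_
    rw [mul_assoc, h.comm _ _ (Fin.castSucc_lt_last j), mul_smul_comm, ← mul_assoc,
      h.comm_star _ _ (Fin.castSucc_lt_last j).ne, smul_mul_assoc, smul_smul, mul_assoc, pow_two]

/-- Matrix units for a core tuple below the projection `p`: partial isometries `e_k`, `k ∈ ℕ^n`,
from the vacuum projection `p₀` onto the joint eigenspaces of the partial radii. -/
structure IsMatrixUnits {A : Type*} [CStarAlgebra A] (q : ℝ) {n : ℕ} (p T : A) (Y : Fin n → A)
    (p₀ : A) (e : (Fin n → ℕ) → A) : Prop where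
  star_mul : ∀ k l, star (e k) * e l = if k = l then p₀ else 0
  zero : e 0 = p₀
  mul_e : ∀ k, p * e k = e k
  T_mul : ∀ k, T * e k = ((q⁻¹ ^ ∑ j, k j : ℝ) : ℂ) • (e k * T)
  star_T_mul : ∀ k, star T * e k = ((q⁻¹ ^ ∑ j, k j : ℝ) : ℂ) • (e k * star T)
  star_T_mul_T : star T * T * p₀ = p₀
  lower : ∀ i k, Y i * e k =
    ((√(1 - q⁻¹ ^ (2 * k i)) * q⁻¹ ^ ∑ j ∈ Finset.Ioi i, k j : ℝ) : ℂ) •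
      e (Function.update k i (k i - 1))
  raise : ∀ i k, star (Y i) * e k =
    ((√(1 - q⁻¹ ^ (2 * (k i + 1))) * q⁻¹ ^ ∑ j ∈ Finset.Ioi i, k j : ℝ) : ℂ) •
      e (Function.update k i (k i + 1))
  approx : ∀ ε > 0, ∃ F : Finset (Fin n → ℕ), ‖T * (p - ∑ k ∈ F, e k * star (e k))‖ ≤ ε

end Core

/-! ### Orthogonality and completeness of one ladder, and the matrix units. -/

section Ladder

variable {A : Type*} [CStarAlgebra A] {q : ℝ} {p s y V p' : A}

theorem IsLadder.mul_pow_iso (h : IsLadder q p s y V p') {x : A} (hx : p' * x = x) (a : ℕ) :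
    p * (V ^ a * x) = V ^ a * x := by
  cases a with
  | zero => rw [pow_zero, one_mul, ← hx, ← mul_assoc, h.mul_ground]
  | succ a => rw [pow_succ', ← mul_assoc, ← mul_assoc, h.mul_iso]

/-- The Wold decomposition: `V` is isometric on `p` and `V^*` kills `p'`, so different powers of `V`
carry `p'` to orthogonal ranges. -/
theorem IsLadder.star_pow_mul_pow (h : IsLadder q p s y V p') {x x' : A} (hx : p' * x = x)
    (hx' : p' * x' = x') (a b : ℕ) :
    star (V ^ a * x) * (V ^ b * x') = if a = b then star x * x' else 0 := by
  have h0 : ∀ z, p' * z = z → star V * z = 0 := fun z hz => by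
    rw [← hz, ← mul_assoc, h.star_iso_mul_ground, zero_mul]
  have hs : ∀ c (z : A), V ^ (c + 1) * z = V * (V ^ c * z) := fun c z => by
    rw [pow_succ', mul_assoc]
  induction a generalizing b with
  | zero =>
    cases b with
    | zero => simp
    | succ b =>
      rw [hs, pow_zero, one_mul, ← mul_assoc, ← star_star V, ← star_mul, star_star V, h0 x hx]
      simp
  | succ a ih =>
    cases b with
    | zero =>
      rw [hs, pow_zero, one_mul, star_mul, mul_assoc, h0 x' hx']
      simp
    | succ b =>
      rw [hs, hs, star_mul, mul_assoc, ← mul_assoc (star V), h.star_mul_self,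
        h.mul_pow_iso hx', ih]
      simp

theorem mul_pow_eq_smul {b V : A} {c : ℂ} (h : b * V = c • (V * b)) (a : ℕ) :
    b * V ^ a = c ^ a • (V ^ a * b) := by
  induction a with
  | zero => simp
  | succ a ih =>
    rw [pow_succ, ← mul_assoc, ih, smul_mul_assoc, mul_assoc, h, mul_smul_comm, smul_smul,
      pow_succ, mul_assoc]

/-- Telescoping of `p = p' + V V^*`. The remainder does not tend to zero in norm by itself; it
becomes small only after multiplication by `T`. -/
theorem IsLadder.sum_pow (h : IsLadder q p s y V p') (M : ℕ) :
    ∑ a ∈ Finset.range M, V ^ a * p' * star (V ^ a) + V ^ M * p * star (V ^ M) = p := by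
  induction M with
  | zero => simp
  | succ M ih =>
    rw [Finset.sum_range_succ, add_assoc]
    convert ih using 2
    have : p = p' + V * star V := by rw [h.eq_sub]; abel
    rw [pow_succ, star_mul, mul_assoc (V ^ M) V p, h.iso_mul]
    nth_rewrite 1 [this]
    simp only [mul_add, add_mul, mul_assoc]

end Ladder

theorem sum_Ioi_castSucc {n : ℕ} (k : Fin (n + 1) → ℕ) (i : Fin n) :
    ∑ j ∈ Finset.Ioi i.castSucc, k j = ∑ j ∈ Finset.Ioi i, Fin.init k j + k (Fin.last n) := by
  have h : ∀ (m : ℕ) (i : Fin m) (f : Fin m → ℕ),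
      ∑ j ∈ Finset.Ioi i, f j = ∑ j, if i < j then f j else 0 := by
    intro m i f
    rw [← Finset.sum_filter]
    congr 1
    ext
    simp
  rw [h, h, Fin.sum_univ_castSucc, if_pos (Fin.castSucc_lt_last i)]
  simp [Fin.init]

/-- Induction on the number of generators. The last one gives a ladder below `p`; below its ground
projection `p'` the radius of the other generators is `1`, so the induction hypothesis applies
there. The general `p` in the statement serves this recursion. The new units are `e_k = V^{k_last}
e_{init k}`, and the scalars `q^{-k_last}` come from moving `T` and the lower generators past `V`.
-/
theorem exists_isMatrixUnits {A : Type*} [CStarAlgebra A] {q : ℝ} (hq : 1 < |q|) {n : ℕ} {p T : A}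
    {Y : Fin n → A} (h : IsCoreTuple q T Y) (hp : star p = p) (hpp : p * p = p)
    (hT : T * p = p * T) (hY : ∀ i, Y i * p = p * Y i) (hs : coreRadius T Y * p = p) :
    ∃ p₀ e, IsMatrixUnits q p T Y p₀ e := by
  induction n generalizing p with
  | zero =>
    have hs' : star T * T * p = p := by simpa [coreRadius] using hs
    have hsT : star T * p = p * star T := by
      have := congrArg star hT
      rw [star_mul, star_mul, hp] at this
      exact this.symm
    refine ⟨p, fun _ => p, ⟨fun k l => ?_, rfl, fun _ => hpp, fun k => ?_, fun k => ?_, hs',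
      fun i => i.elim0, fun i => i.elim0, fun ε hε => ⟨{0}, ?_⟩⟩⟩
    · rw [if_pos (Subsingleton.elim _ _), hp, hpp]
    · simp [hT]
    · simp [hsT]
    · simp [hp, hpp, hε.le]
  | succ n ih =>
    have hsT : star T * p = p * star T := by
      have := congrArg star hT
      rw [star_mul, star_mul, hp] at this
      exact this.symm
    have hsY : ∀ i, star (Y i) * p = p * star (Y i) := fun i => by
      have := congrArg star (hY i)
      rw [star_mul, star_mul, hp] at this
      exact this.symm
    set S := coreRadius T (Y ∘ Fin.castSucc) with hS
    set L := Y (Fin.last n) with hL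
    set y := L * p with hy
    have hSp : S * p = p * S := by
      simp only [hS, coreRadius, add_mul, mul_add, Finset.sum_mul, Finset.mul_sum, Function.comp]
      congr 1
      · rw [mul_assoc, hT, ← mul_assoc, hsT, mul_assoc]
      · exact Finset.sum_congr rfl fun j _ => by
          rw [mul_assoc, hY, ← mul_assoc, hsY, mul_assoc]
    have hys : star y = star L * p := by rw [hy, star_mul, hp, hsY]
    have hyy : star y * y = star L * L * p := by
      rw [hys, hy, mul_assoc, ← mul_assoc p, ← hY, mul_assoc L, hpp, mul_assoc]
    have hyy' : y * star y = L * star L * p := by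
      rw [hys, hy, mul_assoc, ← mul_assoc p, ← hsY, mul_assoc (star L), hpp, mul_assoc]
    have hsum : S * p + star y * y = p := by
      rw [hyy, ← add_mul, hS, hL, ← coreRadius_succ, hs]
    obtain ⟨V, p', hV⟩ : ∃ V p', IsLadder q p (S * p) y V p' := by
      -- Positivity of `S p` is witnessed by the elements `T p` and `Y_j p`, since `p` commutes with
      -- all of them.
      refine exists_isLadder hq hp hpp (by rw [hy, mul_assoc, hpp])
        (by rw [hy, ← mul_assoc, ← hY, mul_assoc, hpp])
        ⟨n + 1, Fin.cons (T * p) fun j => Y j.castSucc * p, ?_⟩ hsum ?_ ?_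
      · have hz : ∀ z, star z * p = p * star z → star (z * p) * (z * p) = star z * z * p := by
          intro z hz
          have hz' : z * p = p * z := by
            have := congrArg star hz
            rw [star_mul, star_mul, star_star, hp] at this
            exact this.symm
          rw [star_mul, hp, ← hz, mul_assoc, ← mul_assoc p, ← hz', mul_assoc z, hpp, mul_assoc]
        simp only [Fin.sum_univ_succ, Fin.cons_zero, Fin.cons_succ, hS, coreRadius, add_mul,
          Finset.sum_mul, Function.comp]
        congr 1
        · rw [hz T hsT]
        · exact Finset.sum_congr rfl fun j _ => (hz _ (hsY _)).symm
      · have := h.bracket_last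
        rw [← hS, ← hL] at this
        have h1 : S * p = p - star L * L * p := by rw [← hyy]; exact eq_sub_of_add_eq hsum
        have h2 : L * star L = star L * L + (1 - ((q : ℂ) ^ 2)⁻¹) • S := by rw [← this]; abel
        rw [hyy', h2, add_mul, smul_mul_assoc, sub_smul, one_smul]
        nth_rewrite 1 [h1]
        abel
      · have := h.coreRadius_mul_last
        rw [← hS, ← hL] at this
        rw [hy, mul_assoc, ← mul_assoc p, ← hY, mul_assoc L, hpp, ← mul_assoc, this,
          smul_mul_assoc, mul_assoc L p, ← mul_assoc p, ← hSp, mul_assoc S, hpp, mul_assoc]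
    have hq0 : (q : ℂ) ≠ 0 := by
      intro h0
      have : q = 0 := by exact_mod_cast h0
      simp [this] at hq
      linarith
    -- This is applied to `T` and to the lower generators; all of them pass `V` with `q^{-1}` and
    -- commute with `p'`.
    have hcomm : ∀ b, b * p = p * b → b * L = (q : ℂ) • (L * b) →
        star b * L = (q : ℂ) • (L * star b) →
        (b * V = (q : ℂ)⁻¹ • (V * b) ∧ b * p' = p' * b) ∧
          star b * V = (q : ℂ)⁻¹ • (V * star b) := by
      intro b hb h1 h2
      have hb' : star b * p = p * star b := by
        have := congrArg star hb
        rw [star_mul, star_mul, hp] at this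
        exact this.symm
      have h1' : b * y = (q : ℂ) • (y * b) := by
        rw [hy, ← mul_assoc, h1, smul_mul_assoc, mul_assoc, mul_assoc, hb]
      have h2' : star b * y = (q : ℂ) • (y * star b) := by
        rw [hy, ← mul_assoc, h2, smul_mul_assoc, mul_assoc, mul_assoc, hb']
      exact ⟨hV.comm_iso b hb h1' h2', (hV.comm_iso (star b) hb' h2' (by rwa [star_star])).1⟩
    obtain ⟨⟨hTV, hTp'⟩, hsTV⟩ := hcomm T hT (h.T_mul _) (h.star_T_mul _)
    have hYj := fun j : Fin n => hcomm (Y j.castSucc) (hY _) (h.comm _ _ (Fin.castSucc_lt_last j))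
      (h.comm_star _ _ (Fin.castSucc_lt_last j).ne)
    obtain ⟨p₀, e, he⟩ := ih (p := p') h.castSucc hV.star_ground hV.ground_mul_self hTp'
      (fun j => (hYj j).1.2) (by
        rw [← hS]
        conv_lhs => rw [← hV.mul_ground, ← mul_assoc, hV.radius_mul_ground])
    have hrC : ∀ a : ℕ, (q : ℂ)⁻¹ ^ a = ((q⁻¹ ^ a : ℝ) : ℂ) := fun a => by push_cast; rfl
    -- Below `p` the generator `L` agrees with its compression `y`, for which the ladder formulas
    -- hold.
    have hLV : ∀ a x, p' * x = x → L * (V ^ a * x) = y * (V ^ a * p') * x := fun a x hx => by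
      rw [hy, mul_assoc, mul_assoc (V ^ a), hx, mul_assoc, hV.mul_pow_iso hx]
    have hsLV : ∀ a x, p' * x = x → star L * (V ^ a * x) = star y * (V ^ a * p') * x :=
      fun a x hx => by
        rw [hys, mul_assoc, mul_assoc (V ^ a), hx, mul_assoc, hV.mul_pow_iso hx]
    refine ⟨p₀, fun k => V ^ k (Fin.last n) * e (Fin.init k), ⟨fun k l => ?_, ?_, fun k => ?_,
      fun k => ?_, fun k => ?_, he.star_T_mul_T, fun i k => ?_, fun i k => ?_, fun ε hε => ?_⟩⟩
    · rw [hV.star_pow_mul_pow (he.mul_e _) (he.mul_e _), he.star_mul]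
      have : k = l ↔ k (Fin.last n) = l (Fin.last n) ∧ Fin.init k = Fin.init l := by
        constructor
        · rintro rfl
          exact ⟨rfl, rfl⟩
        · rintro ⟨h1, h2⟩
          rw [← Fin.snoc_init_self k, ← Fin.snoc_init_self l, h1, h2]
      by_cases h1 : k (Fin.last n) = l (Fin.last n) <;> by_cases h2 : Fin.init k = Fin.init l <;>
        simp [this, h1, h2]
    · rw [Pi.zero_apply, pow_zero, one_mul, ← he.zero]
      rfl
    · exact hV.mul_pow_iso (he.mul_e _) _
    · rw [← mul_assoc, mul_pow_eq_smul hTV, smul_mul_assoc, mul_assoc, he.T_mul, mul_smul_comm,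
        smul_smul, hrC, Fin.sum_univ_castSucc, pow_add, mul_assoc]
      push_cast
      rw [mul_comm]
      rfl
    · rw [← mul_assoc, mul_pow_eq_smul hsTV, smul_mul_assoc, mul_assoc, he.star_T_mul,
        mul_smul_comm, smul_smul, hrC, Fin.sum_univ_castSucc, pow_add, mul_assoc]
      push_cast
      rw [mul_comm]
      rfl
    · induction i using Fin.lastCases with
      | last =>
        rw [← hL, hLV _ _ (he.mul_e _)]
        simp only [Function.update_self, Fin.init_update_last]
        rcases hk : k (Fin.last n) with _ | a
        · simp [hV.lower_ground]
        · rw [hV.lower, smul_mul_assoc, mul_assoc, he.mul_e]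
          simp [← Fin.top_eq_last]
      | cast i =>
        rw [← mul_assoc, mul_pow_eq_smul (hYj i).1.1, smul_mul_assoc, mul_assoc]
        have := he.lower i (Fin.init k)
        simp only [Function.comp] at this
        rw [this, mul_smul_comm, smul_smul, hrC, sum_Ioi_castSucc, Fin.init_update_castSucc,
          Function.update_of_ne (Fin.castSucc_lt_last i).ne', pow_add]
        congr 1
        simp only [Fin.init]
        push_cast
        ring
    · induction i using Fin.lastCases with
      | last =>
        rw [← hL, hsLV _ _ (he.mul_e _)]
        simp only [Function.update_self, Fin.init_update_last]
        rw [hV.raise, smul_mul_assoc, mul_assoc, he.mul_e]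
        simp [← Fin.top_eq_last]
      | cast i =>
        rw [← mul_assoc, mul_pow_eq_smul (hYj i).2, smul_mul_assoc, mul_assoc]
        have := he.raise i (Fin.init k)
        simp only [Function.comp] at this
        rw [this, mul_smul_comm, smul_smul, hrC, sum_Ioi_castSucc, Fin.init_update_castSucc,
          Function.update_of_ne (Fin.castSucc_lt_last i).ne', pow_add]
        congr 1
        simp only [Fin.init]
        push_cast
        ring
    · have hV1 : ∀ a, ‖V ^ a‖ ≤ 1 := by
        have hp1 : ‖p‖ ≤ 1 := IsStarProjection.norm_le p ⟨hpp, hp⟩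
        have h1 : ‖V‖ ≤ 1 := by
          have := CStarRing.norm_star_mul_self (x := V)
          rw [hV.star_mul_self] at this
          nlinarith [norm_nonneg V]
        intro a
        -- Only an inequality, as `A` may be the zero algebra.
        have h1' : ‖(1 : A)‖ ≤ 1 := IsStarProjection.norm_le 1 ⟨one_mul 1, star_one A⟩
        induction a with
        | zero => simpa using h1'
        | succ a ih =>
          rw [pow_succ]
          exact (norm_mul_le _ _).trans (mul_le_one₀ ih (norm_nonneg _) h1)
      set r : ℝ := |q|⁻¹ with hr
      have hr0 : 0 ≤ r := by positivity
      have hr1 : r < 1 := inv_lt_one_of_one_lt₀ hq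
      have hrn : ∀ a : ℕ, ‖(q : ℂ)⁻¹ ^ a‖ = r ^ a := fun a => by
        rw [norm_pow, norm_inv, Complex.norm_real, Real.norm_eq_abs]
      have hconj : ∀ (a : ℕ) (x : A), ‖(q : ℂ)⁻¹ ^ a • (V ^ a * x * star (V ^ a))‖ ≤ r ^ a * ‖x‖ := by
        intro a x
        rw [norm_smul, hrn]
        refine mul_le_mul_of_nonneg_left ?_ (pow_nonneg hr0 a)
        refine (norm_mul_le _ _).trans ?_
        rw [norm_star]
        have h2 : ‖V ^ a * x‖ ≤ ‖x‖ :=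
          (norm_mul_le _ _).trans (mul_le_of_le_one_left (norm_nonneg _) (hV1 a))
        exact (mul_le_of_le_one_right (norm_nonneg _) (hV1 a)).trans h2
      -- The tail of the ladder contributes `r^M ‖T p‖`, which is given half of `ε`. The `M` rungs
      -- before it share the other half, hence the tolerance `ε / 2 / (M + 1)` below.
      obtain ⟨M, hM⟩ : ∃ M : ℕ, r ^ M * ‖T * p‖ ≤ ε / 2 := by
        have : Filter.Tendsto (fun M : ℕ => r ^ M * ‖T * p‖) Filter.atTop (nhds (0 * ‖T * p‖)) :=
          (tendsto_pow_atTop_nhds_zero_of_lt_one hr0 hr1).mul_const _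
        rw [zero_mul] at this
        exact (this.eventually (ge_mem_nhds (half_pos hε))).exists
      obtain ⟨F, hF⟩ := he.approx (ε / 2 / (M + 1)) (by positivity)
      set C := T * (p' - ∑ k ∈ F, e k * star (e k)) with hC
      have hinj : Function.Injective fun x : (Fin n → ℕ) × ℕ =>
          (Fin.snoc x.1 x.2 : Fin (n + 1) → ℕ) := by
        intro x x' hx
        simp only [Fin.snoc_inj] at hx
        exact Prod.ext hx.1 hx.2
      refine ⟨(F ×ˢ Finset.range M).map ⟨_, hinj⟩, ?_⟩
      -- The decomposition of `p` by `sum_pow`, with `T` moved through `V^a`: each rung carries the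
      -- error `C` of the induction hypothesis, weighted by `q^{-a}`.
      have key : T * (p - ∑ k ∈ (F ×ˢ Finset.range M).map ⟨_, hinj⟩,
          V ^ k (Fin.last n) * e (Fin.init k) * star (V ^ k (Fin.last n) * e (Fin.init k))) =
          ∑ a ∈ Finset.range M, (q : ℂ)⁻¹ ^ a • (V ^ a * C * star (V ^ a)) +
            (q : ℂ)⁻¹ ^ M • (V ^ M * (T * p) * star (V ^ M)) := by
        have h1 : ∀ a, (q : ℂ)⁻¹ ^ a • (V ^ a * C * star (V ^ a)) =
            T * (V ^ a * p' * star (V ^ a)) -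
              T * ∑ k ∈ F, V ^ a * e k * star (V ^ a * e k) := by
          intro a
          rw [← smul_mul_assoc, hC, ← mul_assoc, ← smul_mul_assoc, ← mul_pow_eq_smul hTV]
          rw [mul_sub, sub_mul, Finset.mul_sum, Finset.sum_mul, Finset.mul_sum]
          simp only [star_mul, mul_assoc]
        have h2 : (q : ℂ)⁻¹ ^ M • (V ^ M * (T * p) * star (V ^ M)) =
            T * (V ^ M * p * star (V ^ M)) := by
          rw [← smul_mul_assoc, ← mul_assoc, ← smul_mul_assoc, ← mul_pow_eq_smul hTV]
          simp only [mul_assoc]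
        rw [Finset.sum_map, Finset.sum_product_right, h2]
        simp only [h1, Function.Embedding.coeFn_mk, Fin.snoc_last, Fin.init_snoc]
        rw [Finset.sum_sub_distrib, ← Finset.mul_sum, ← Finset.mul_sum]
        nth_rewrite 1 [← hV.sum_pow M]
        rw [mul_sub, mul_add]
        abel
      rw [key]
      have hsumC : ‖∑ a ∈ Finset.range M, (q : ℂ)⁻¹ ^ a • (V ^ a * C * star (V ^ a))‖ ≤
          M * (ε / 2 / (M + 1)) := by
        refine (norm_sum_le _ _).trans ((Finset.sum_le_card_nsmul _ _ (ε / 2 / (M + 1))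
          fun a _ => ?_).trans (by simp))
        exact (hconj a C).trans ((mul_le_of_le_one_left (norm_nonneg _)
          (pow_le_one₀ hr0 hr1.le)).trans hF)
      have hlast := (hconj M (T * p)).trans hM
      have hfrac : M * (ε / 2 / (M + 1)) ≤ ε / 2 := by
        rw [← mul_div_assoc, div_le_iff₀ (by positivity)]
        nlinarith
      exact (norm_add_le _ _).trans (by linarith)

end QuantumSphere

namespace QuantumSphere

open SphereAlgebra

/-! ### Sphere tuples in terms of core tuples -/

section Bridge

variable {B : Type*} [Ring B] [StarRing B]

theorem partialRadius_eq_sum {n : ℕ} (b : Fin (n + 1) → B) (i : Fin (n + 1)) :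
    partialRadius b i = b 0 ^ 2 +
      ∑ j : Fin n, if j.succ ≤ i then star (b j.succ) * b j.succ else 0 := by
  have h : ∀ f : Fin (n + 1) → B, ∑ j ∈ Finset.Ioc 0 i, f j =
      ∑ j : Fin n, if j.succ ≤ i then f j.succ else 0 := by
    intro f
    have : Finset.Ioc 0 i = Finset.univ.filter fun j => 0 < j ∧ j ≤ i := by ext; simp
    rw [this, Finset.sum_filter, Fin.sum_univ_succ]
    simp
  rw [partialRadius, h]

theorem partialRadius_castSucc {n : ℕ} (b : Fin (n + 1) → B) (i : Fin n) :
    partialRadius b i.castSucc =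
      b 0 ^ 2 + ∑ j ∈ Finset.Iio i, star (b j.succ) * b j.succ := by
  have : Finset.Iio i = Finset.univ.filter fun j : Fin n => j.succ ≤ i.castSucc := by
    ext j
    simp [Fin.succ_le_castSucc_iff]
  rw [partialRadius_eq_sum, this, Finset.sum_filter]

theorem partialRadius_last {n : ℕ} (b : Fin (n + 1) → B) :
    partialRadius b (Fin.last n) = b 0 ^ 2 + ∑ j : Fin n, star (b j.succ) * b j.succ := by
  rw [partialRadius_eq_sum]
  simp [Fin.le_last]

variable [Algebra ℂ B] [StarModule ℂ B] {q : ℝ} {n : ℕ}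

/-- Because `q` is real, the mixed relation for `(x, y)` is the adjoint of the one for `(y, x)`. -/
theorem star_mul_eq_of_star_mul_eq {x y : B} (h : star x * y = (q : ℂ) • (y * star x)) :
    star y * x = (q : ℂ) • (x * star y) := by
  have := congrArg star h
  rw [star_mul, star_star, star_smul, star_mul, star_star] at this
  rw [this]
  congr 1
  exact Complex.conj_ofReal q

theorem isSphereTuple_even_iff {b : Fin (n + 1) → B} : IsSphereTuple q False b ↔
    IsCoreTuple q (b 0) (fun i => b i.succ) ∧ star (b 0) = b 0 ∧
      coreRadius (b 0) (fun i => b i.succ) = 1 := by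
  constructor
  · intro h
    have h0 := h.selfAdjoint
    refine ⟨⟨by rw [h0], fun i => h.comm _ _ (Fin.succ_pos i),
      fun i => h.comm_star _ _ (Fin.succ_pos i).ne, fun i j hij => h.comm _ _ (by simpa),
      fun i j hij => h.comm_star _ _ (by simpa), fun i => ?_⟩, h0, ?_⟩
    · rw [h.bracket, partialRadius_castSucc, h0, pow_two (b 0)]
    · rw [← h.sphere, partialRadius_last, coreRadius, h0, pow_two (b 0)]
  · rintro ⟨h, h0, hs⟩
    refine ⟨h0, False.elim, ?_, ?_, fun i => ?_, ?_⟩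
    · intro i j hij
      induction i using Fin.cases with
      | zero =>
        obtain ⟨j, rfl⟩ := Fin.exists_succ_eq.2 hij.ne'
        exact h.T_mul j
      | succ i =>
        obtain ⟨j, rfl⟩ := Fin.exists_succ_eq.2 ((Fin.succ_pos i).trans hij).ne'
        exact h.comm i j (by simpa using hij)
    · intro i j hij
      induction i using Fin.cases with
      | zero =>
        obtain ⟨j, rfl⟩ := Fin.exists_succ_eq.2 hij.symm
        exact h.star_T_mul j
      | succ i =>
        induction j using Fin.cases with
        | zero => exact star_mul_eq_of_star_mul_eq (h.star_T_mul i)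
        | succ j => exact h.comm_star i j (by simpa using hij)
    · rw [h.bracket, partialRadius_castSucc, h0, pow_two (b 0)]
    · rw [← hs, partialRadius_last, coreRadius, h0, pow_two (b 0)]

/-- With `b 0 = 0` the partial radius below `b 1` vanishes, so the bracket relation of `b 1` says
that `b 1` is normal. Thus `b 1` takes the role that the self-adjoint `b 0` has in the even case. -/
theorem isSphereTuple_odd_iff {b : Fin (n + 2) → B} : IsSphereTuple q True b ↔
    IsCoreTuple q (b 1) (fun i : Fin n => b i.succ.succ) ∧ b 0 = 0 ∧
      coreRadius (b 1) (fun i : Fin n => b i.succ.succ) = 1 := by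
  have hb1 : b 1 = b (0 : Fin (n + 1)).succ := rfl
  have hIio : ∀ (i : Fin n) (f : Fin (n + 1) → B), ∑ j ∈ Finset.Iio i.succ, f j =
      f 0 + ∑ j ∈ Finset.Iio i, f j.succ := by
    intro i f
    have h1 : ∀ (m : ℕ) (i : Fin m), Finset.Iio i = Finset.univ.filter (· < i) := by
      intro m i; ext; simp
    rw [h1, h1, Finset.sum_filter, Finset.sum_filter, Fin.sum_univ_succ]
    simp
  constructor
  · intro h
    have h0 := h.zero trivial
    refine ⟨⟨?_, fun i => h.comm _ _ (Fin.succ_lt_succ_iff.2 (Fin.succ_pos i) : Fin.succ 0 < _),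
      fun i => h.comm_star _ _ (by simp [Fin.ext_iff]),
      fun i j hij => h.comm _ _ (by simpa),
      fun i j hij => h.comm_star _ _ (by simpa), fun i => ?_⟩, h0, ?_⟩
    · have := h.bracket 0
      rw [partialRadius_castSucc, h0] at this
      have he : Finset.Iio (0 : Fin (n + 1)) = ∅ := by ext; simp
      rw [he] at this
      simpa [sub_eq_zero] using this
    · rw [h.bracket, partialRadius_castSucc, h0, hIio]
      simp
    · rw [← h.sphere, partialRadius_last, coreRadius, h0, Fin.sum_univ_succ]
      simp
  · rintro ⟨h, h0, hs⟩
    refine ⟨by rw [h0, star_zero], fun _ => h0, ?_, ?_, fun i => ?_, ?_⟩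
    · intro i j hij
      induction i using Fin.cases with
      | zero => simp [h0]
      | succ i =>
        obtain ⟨j, rfl⟩ := Fin.exists_succ_eq.2 ((Fin.succ_pos i).trans hij).ne'
        have hij : i < j := by simpa using hij
        induction i using Fin.cases with
        | zero =>
          obtain ⟨j, rfl⟩ := Fin.exists_succ_eq.2 hij.ne'
          exact h.T_mul j
        | succ i =>
          obtain ⟨j, rfl⟩ := Fin.exists_succ_eq.2 ((Fin.succ_pos i).trans hij).ne'
          exact h.comm i j (by simpa using hij)
    · intro i j hij
      induction i using Fin.cases with
      | zero => simp [h0]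
      | succ i =>
        induction j using Fin.cases with
        | zero => simp [h0]
        | succ j =>
          induction i using Fin.cases with
          | zero =>
            obtain ⟨j, rfl⟩ := Fin.exists_succ_eq.2 (fun hj : j = 0 => hij (by rw [hj]))
            exact h.star_T_mul j
          | succ i =>
            induction j using Fin.cases with
            | zero => exact star_mul_eq_of_star_mul_eq (h.star_T_mul i)
            | succ j => exact h.comm_star i j (by simpa using hij)
    · rw [partialRadius_castSucc, h0]
      induction i using Fin.cases with
      | zero =>
        have := h.normal
        rw [hb1] at this
        have he : Finset.Iio (0 : Fin (n + 1)) = ∅ := by ext; simp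
        simp only [he, this, Finset.sum_empty]
        simp
      | succ i =>
        rw [h.bracket, hIio]
        simp
    · rw [← hs, partialRadius_last, coreRadius, h0, Fin.sum_univ_succ]
      simp

end Bridge

/-! ### Homomorphisms from sphere algebras -/

section Hom

variable {q : ℝ} {n : ℕ} {odd : Prop}

theorem SphereAlgebra.induct_gen {C : SphereAlgebra q n odd → Prop}
    (hc : ∀ c : ℂ, C (algebraMap ℂ _ c)) (hx : ∀ i, C (x i)) (hs : ∀ i, C (star (x i)))
    (hm : ∀ a b, C a → C b → C (a * b)) (ha : ∀ a b, C a → C b → C (a + b))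
    (a : SphereAlgebra q n odd) : C a := by
  obtain ⟨a, rfl⟩ := mk_surjective a
  induction a using FreeStarAlgebra.induct with
  | hc c => rw [AlgHom.commutes]; exact hc c
  | hι y =>
    cases y with
    | inl i => exact hx i
    | inr i =>
      rw [← FreeStarAlgebra.star_gen, mk_star]
      exact hs i
  | hm a b h h' => rw [map_mul]; exact hm _ _ h h'
  | ha a b h h' => rw [map_add]; exact ha _ _ h h'

theorem SphereAlgebra.hom_ext {B : Type*} [Ring B] [Algebra ℂ B] [StarRing B]
    {f g : SphereAlgebra q n odd →⋆ₐ[ℂ] B} (h : ∀ i, f (x i) = g (x i)) : f = g := by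
  ext a
  induction a using SphereAlgebra.induct_gen with
  | hc c => rw [AlgHomClass.commutes, AlgHomClass.commutes]
  | hx i => exact h i
  | hs i => rw [map_star, map_star, h]
  | hm a b h h' => rw [map_mul, map_mul, h, h']
  | ha a b h h' => rw [map_add, map_add, h, h']

theorem evenToOdd_x (i : Fin (n + 1)) : evenToOdd q n (x i) = x i := lift_x _ _ i

theorem oddToOdd_x (i : Fin (n + 2)) : oddToOdd q n (x i) = shiftGen q n i := lift_x _ _ i

variable {B : Type*} [Ring B] [Algebra ℂ B] [StarRing B] [StarModule ℂ B]

theorem exists_comp_evenToOdd (φ : EvenSphere q n →⋆ₐ[ℂ] B) (h : φ (x 0) = 0) :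
    ∃ φ' : OddSphere q n →⋆ₐ[ℂ] B, φ = φ'.comp (evenToOdd q n) := by
  have hb := isSphereTuple_x.map φ
  refine ⟨SphereAlgebra.lift (fun i => φ (x i)) { hb with zero := fun _ => h },
    SphereAlgebra.hom_ext fun i => ?_⟩
  rw [StarAlgHom.comp_apply, evenToOdd_x, lift_x]

/-- When `x_0` and `x_1` both go to zero, dropping the index `0` preserves all relations, since
`x_1` contributes nothing to the partial radii. -/
theorem exists_comp_oddToOdd (φ : OddSphere q (n + 1) →⋆ₐ[ℂ] B) (h : φ (x 1) = 0) :
    ∃ φ' : OddSphere q n →⋆ₐ[ℂ] B, φ = φ'.comp (oddToOdd q n) := by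
  have hb := isSphereTuple_x.map φ
  have h0 : φ (x 0) = 0 := hb.zero trivial
  have hIio : ∀ (i : Fin n) (f : Fin (n + 1) → B), f 0 = 0 → ∑ j ∈ Finset.Iio i.succ, f j =
      ∑ j ∈ Finset.Iio i, f j.succ := by
    intro i f hf
    have h1 : ∀ (m : ℕ) (i : Fin m), Finset.Iio i = Finset.univ.filter (· < i) := by
      intro m i; ext; simp
    rw [h1, h1, Finset.sum_filter, Finset.sum_filter, Fin.sum_univ_succ]
    simp [hf]
  have h1 : φ (x (0 : Fin (n + 1)).succ) = 0 := h
  have hb' : IsSphereTuple q True fun i : Fin (n + 1) => φ (x i.succ) := by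
    refine ⟨by simp [h], fun _ => h1, fun i j hij => hb.comm _ _ (by simpa),
      fun i j hij => hb.comm_star _ _ (by simpa), fun i => ?_, ?_⟩
    · have := hb.bracket i.succ
      rw [partialRadius_castSucc, hIio _ _ (by simp [h])] at this
      rw [this, partialRadius_castSucc]
      simp [h0, h]
    · have := hb.sphere
      rw [partialRadius_last, Fin.sum_univ_succ] at this
      rw [← this, partialRadius_last]
      simp [h0, h]
  refine ⟨SphereAlgebra.lift _ hb', SphereAlgebra.hom_ext fun i => ?_⟩
  rw [StarAlgHom.comp_apply, oddToOdd_x]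
  induction i using Fin.cases with
  | zero => rw [h0]; exact (map_zero _).symm
  | succ i => exact (lift_x _ hb' i).symm

end Hom

end QuantumSphere

namespace QuantumSphere

open SphereAlgebra

/-! ### Weighted shifts along a Hilbert basis -/

section WeightedShift

variable {ι : Type*} {H : Type*} [NormedAddCommGroup H] [InnerProductSpace ℂ H]

theorem clm_ext_of_dense_span {K : Type*} [NormedAddCommGroup K] [InnerProductSpace ℂ K]
    (b : HilbertBasis ι ℂ H) {S S' : H →L[ℂ] K} (h : ∀ k, S (b k) = S' (b k)) : S = S' := by
  refine ContinuousLinearMap.ext_on (s := Set.range b) ?_ ?_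
  · rw [Submodule.dense_iff_topologicalClosure_eq_top]
    exact b.dense_span
  · rintro _ ⟨k, rfl⟩
    exact h k

theorem exists_diagonal (c : ι → ℂ) {C : ℝ} (hc : ∀ k, ‖c k‖ ≤ C) :
    ∃ D : lp (fun _ : ι => ℂ) 2 →L[ℂ] lp (fun _ : ι => ℂ) 2, ∀ v k, D v k = c k * v k := by
  have hC : ∀ (v : lp (fun _ : ι => ℂ) 2) k, ‖c k * v k‖ ^ (2 : ℝ) ≤ C ^ 2 * ‖v k‖ ^ (2 : ℝ) := by
    intro v k
    rw [norm_mul, Real.rpow_two, Real.rpow_two, mul_pow]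
    exact mul_le_mul_of_nonneg_right (pow_le_pow_left₀ (norm_nonneg _) (hc k) 2) (sq_nonneg _)
  have hmem : ∀ v : lp (fun _ : ι => ℂ) 2, Memℓp (fun k => c k * v k) 2 := by
    intro v
    have hv := (memℓp_gen_iff (p := 2) (by norm_num)).1 (lp.memℓp v)
    refine memℓp_gen (Summable.of_nonneg_of_le (fun k => by positivity) (fun k => ?_)
      (hv.mul_left (C ^ 2)))
    simpa using hC v k
  let D : lp (fun _ : ι => ℂ) 2 →ₗ[ℂ] lp (fun _ : ι => ℂ) 2 :=
    { toFun := fun v => ⟨fun k => c k * v k, hmem v⟩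
      map_add' := fun v w => by
        ext k
        exact mul_add _ _ _
      map_smul' := fun a v => by
        ext k
        exact mul_left_comm _ _ _ }
  refine ⟨D.mkContinuous |C| fun v => ?_, fun v k => rfl⟩
  refine lp.norm_le_of_forall_sum_le (by norm_num) (by positivity) fun s => ?_
  have h2 : ∑ k ∈ s, ‖v k‖ ^ (2 : ℝ≥0∞).toReal ≤ ‖v‖ ^ (2 : ℝ≥0∞).toReal :=
    lp.sum_rpow_le_norm_rpow (by norm_num) v s
  simp only [ENNReal.toReal_ofNat] at h2 ⊢
  calc ∑ k ∈ s, ‖D v k‖ ^ (2 : ℝ) ≤ ∑ k ∈ s, C ^ 2 * ‖v k‖ ^ (2 : ℝ) :=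
        Finset.sum_le_sum fun k _ => hC v k
    _ ≤ C ^ 2 * ‖v‖ ^ (2 : ℝ) := by
        rw [← Finset.mul_sum]
        exact mul_le_mul_of_nonneg_left h2 (sq_nonneg _)
    _ = (|C| * ‖v‖) ^ (2 : ℝ) := by
        rw [Real.rpow_two, Real.rpow_two, mul_pow, sq_abs]

/-- A diagonal operator followed by the isometry that permutes basis vectors along the injection
`f`. -/
theorem exists_weightedShift [CompleteSpace H] (b : HilbertBasis ι ℂ H) {f : ι → ι}
    (hf : Function.Injective f) (c : ι → ℂ) {C : ℝ} (hc : ∀ k, ‖c k‖ ≤ C) :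
    ∃ S : H →L[ℂ] H, ∀ k, S (b k) = c k • b (f k) := by
  classical
  obtain ⟨D, hD⟩ := exists_diagonal c hc
  have ho : Orthonormal ℂ (b ∘ f) := b.orthonormal.comp f hf
  refine ⟨ho.orthogonalFamily.linearIsometry.toContinuousLinearMap ∘L D ∘L
    b.repr.toContinuousLinearEquiv.toContinuousLinearMap, fun k => ?_⟩
  have h1 : D (lp.single 2 k (1 : ℂ)) = lp.single 2 k (c k) := by
    ext j
    rw [hD]
    by_cases hj : j = k
    · subst hj; simp
    · simp [lp.single_apply, hj]
  have h2 : b.repr (b k) = lp.single 2 k (1 : ℂ) := b.repr_self k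
  simp only [ContinuousLinearMap.comp_apply, ContinuousLinearEquiv.coe_coe,
    LinearIsometryEquiv.coe_toContinuousLinearEquiv, LinearIsometry.coe_toContinuousLinearMap]
  rw [h2, h1, ho.orthogonalFamily.linearIsometry_apply_single]
  simp

theorem hilbertBasis_ext (b : HilbertBasis ι ℂ H) {v w : H}
    (h : ∀ k, inner ℂ (b k) v = inner ℂ (b k) w) : v = w := by
  refine b.repr.injective (lp.ext (funext fun k => ?_))
  rw [b.repr_apply_apply, b.repr_apply_apply, h]

theorem star_weightedShift_apply [CompleteSpace H] (b : HilbertBasis ι ℂ H) {f : ι → ι}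
    (hf : Function.Injective f) {c : ι → ℂ} {S : H →L[ℂ] H} (hS : ∀ k, S (b k) = c k • b (f k))
    (l : ι) : star S (b (f l)) = star (c l) • b l := by
  classical
  refine hilbertBasis_ext b fun k => ?_
  rw [ContinuousLinearMap.star_eq_adjoint, ContinuousLinearMap.adjoint_inner_right, hS,
    inner_smul_left, inner_smul_right, orthonormal_iff_ite.1 b.orthonormal,
    orthonormal_iff_ite.1 b.orthonormal]
  by_cases h : k = l
  · subst h; simp
  · simp [h, hf.ne h]

theorem star_weightedShift_apply_eq_zero [CompleteSpace H] (b : HilbertBasis ι ℂ H) {f : ι → ι}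
    {c : ι → ℂ} {S : H →L[ℂ] H} (hS : ∀ k, S (b k) = c k • b (f k))
    {l : ι} (hl : l ∉ Set.range f) : star S (b l) = 0 := by
  classical
  refine hilbertBasis_ext b fun k => ?_
  rw [ContinuousLinearMap.star_eq_adjoint, ContinuousLinearMap.adjoint_inner_right, hS,
    inner_smul_left, inner_zero_right, orthonormal_iff_ite.1 b.orthonormal,
    if_neg fun h => hl ⟨k, h⟩, mul_zero]

end WeightedShift

/-! ### The standard operators on a Hilbert space with basis indexed by `ℕ^n` -/

section Standard

variable {H : Type*} [NormedAddCommGroup H] [InnerProductSpace ℂ H] [CompleteSpace H] {q : ℝ}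
  {n : ℕ}

/-- The operators `D |k⟩ = q^{-|k|} |k⟩` and the lowering operators `Y_i`. -/
structure IsStandardTuple (q : ℝ) {n : ℕ} (b : HilbertBasis (Fin n → ℕ) ℂ H) (D : H →L[ℂ] H)
    (Y : Fin n → (H →L[ℂ] H)) : Prop where
  diag : ∀ k, D (b k) = ((q⁻¹ ^ ∑ j, k j : ℝ) : ℂ) • b k
  lower : ∀ i k, Y i (b k) =
    ((√(1 - q⁻¹ ^ (2 * k i)) * q⁻¹ ^ ∑ j ∈ Finset.Ioi i, k j : ℝ) : ℂ) •
      b (Function.update k i (k i - 1))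
  raise : ∀ i k, star (Y i) (b k) =
    ((√(1 - q⁻¹ ^ (2 * (k i + 1))) * q⁻¹ ^ ∑ j ∈ Finset.Ioi i, k j : ℝ) : ℂ) •
      b (Function.update k i (k i + 1))

theorem abs_inv_lt_one (hq : 1 < |q|) : |q⁻¹| < 1 := by
  rw [abs_inv]
  exact inv_lt_one_of_one_lt₀ hq

theorem inv_pow_le_one (hq : 1 < |q|) (m : ℕ) : q⁻¹ ^ (2 * m) ≤ 1 := by
  rw [pow_mul]
  refine pow_le_one₀ (sq_nonneg _) ?_
  rw [← sq_abs]
  exact pow_le_one₀ (abs_nonneg _) (abs_inv_lt_one hq).le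

theorem norm_coeff_le_one (hq : 1 < |q|) (m s : ℕ) :
    ‖((√(1 - q⁻¹ ^ (2 * m)) * q⁻¹ ^ s : ℝ) : ℂ)‖ ≤ 1 := by
  rw [Complex.norm_real, Real.norm_eq_abs, abs_mul, abs_of_nonneg (Real.sqrt_nonneg _), abs_pow]
  refine mul_le_one₀ (Real.sqrt_le_one.2 ?_) (by positivity)
    (pow_le_one₀ (abs_nonneg _) (abs_inv_lt_one hq).le)
  have : 0 ≤ q⁻¹ ^ (2 * m) := by rw [pow_mul]; positivity
  linarith

theorem raise_injective (i : Fin n) :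
    Function.Injective fun k : Fin n → ℕ => Function.update k i (k i + 1) := by
  intro k l h
  funext j
  have := congrFun h j
  by_cases hj : j = i
  · subst hj
    simpa using this
  · simpa [hj] using this

theorem exists_isStandardTuple (hq : 1 < |q|) (b : HilbertBasis (Fin n → ℕ) ℂ H) :
    ∃ D Y, IsStandardTuple q b D Y := by
  obtain ⟨D, hD⟩ := exists_weightedShift b Function.injective_id
    (fun k => ((q⁻¹ ^ ∑ j, k j : ℝ) : ℂ)) (C := 1) (fun k => by
      rw [Complex.norm_real, Real.norm_eq_abs, abs_pow]
      exact pow_le_one₀ (abs_nonneg _) (abs_inv_lt_one hq).le)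
  have hR := fun i : Fin n => exists_weightedShift b (raise_injective i)
    (fun k => ((√(1 - q⁻¹ ^ (2 * (k i + 1))) * q⁻¹ ^ ∑ j ∈ Finset.Ioi i, k j : ℝ) : ℂ)) (C := 1)
    (fun k => norm_coeff_le_one hq _ _)
  choose R hR using hR
  -- The lowering operators are defined as adjoints of the raising ones: raising an index is
  -- injective, whereas truncated lowering is not. At `k i = 0` the truncated index is harmless
  -- because the coefficient `√(1 - 1)` vanishes.
  refine ⟨D, fun i => star (R i), hD, fun i k => ?_, fun i k => ?_⟩
  · rcases hk : k i with _ | a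
    · rw [star_weightedShift_apply_eq_zero b (hR i)]
      · simp
      · rintro ⟨l, rfl⟩
        simp at hk
    · have hl : Function.update (Function.update k i a) i (Function.update k i a i + 1) = k := by
        rw [Function.update_self, Function.update_idem, ← hk, Function.update_eq_self]
      have := star_weightedShift_apply b (raise_injective i) (hR i) (Function.update k i a)
      simp only [hl] at this
      rw [this]
      have hs : ∑ j ∈ Finset.Ioi i, Function.update k i a j = ∑ j ∈ Finset.Ioi i, k j :=
        Finset.sum_congr rfl fun j hj => Function.update_of_ne (Finset.mem_Ioi.1 hj).ne' _ _
      rw [hs, Function.update_self]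
      congr 1
      exact Complex.conj_ofReal _
  · rw [star_star, hR]

/-- A telescoping sum: the `j`-th term is the difference of the squares of `r ^ ∑_{l > j} k l` and
`r ^ ∑_{l ≥ j} k l`. Evaluated on a basis vector, this is the sphere relation. -/
theorem pow_sum_sq_add_sum (r : ℝ) (k : Fin n → ℕ) :
    (r ^ ∑ j, k j) ^ 2 + ∑ j, (1 - r ^ (2 * k j)) * (r ^ ∑ l ∈ Finset.Ioi j, k l) ^ 2 = 1 := by
  induction n with
  | zero => simp
  | succ n ih =>
    have := ih (Fin.init k)
    rw [Fin.sum_univ_castSucc, Fin.sum_univ_castSucc]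
    simp only [sum_Ioi_castSucc, pow_add, mul_pow, ← mul_assoc]
    rw [← add_assoc, ← Finset.sum_mul, ← add_mul]
    simp only [Fin.init] at this ⊢
    rw [this]
    simp [← Fin.top_eq_last, pow_mul, pow_right_comm]

/-- The same telescoping stopped before `i`. It gives the eigenvalue of the partial radius that
occurs in the bracket relation of `Y_i`. -/
theorem pow_sum_sq_add_sum_Iio (r : ℝ) (k : Fin n → ℕ) (i : Fin n) :
    (r ^ ∑ j, k j) ^ 2 +
        ∑ j ∈ Finset.Iio i, (1 - r ^ (2 * k j)) * (r ^ ∑ l ∈ Finset.Ioi j, k l) ^ 2 =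
      r ^ (2 * k i) * (r ^ ∑ l ∈ Finset.Ioi i, k l) ^ 2 := by
  induction n with
  | zero => exact i.elim0
  | succ n ih =>
    rw [Fin.sum_univ_castSucc]
    induction i using Fin.lastCases with
    | last =>
      rw [Fin.Iio_last_eq_map, Finset.sum_map]
      have := pow_sum_sq_add_sum r (Fin.init k)
      simp only [Fin.coe_castSuccEmb, sum_Ioi_castSucc, pow_add, mul_pow, ← mul_assoc]
      rw [← Finset.sum_mul, ← add_mul]
      simp only [Fin.init] at this ⊢
      rw [this]
      simp [← Fin.top_eq_last, pow_mul, pow_right_comm]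
    | cast i =>
      rw [← Fin.map_castSuccEmb_Iio, Finset.sum_map]
      have := ih (Fin.init k) i
      simp only [Fin.coe_castSuccEmb, sum_Ioi_castSucc, pow_add, mul_pow, ← mul_assoc]
      rw [← Finset.sum_mul, ← add_mul]
      simp only [Fin.init] at this ⊢
      rw [this]

theorem sum_update_succ (s : Finset (Fin n)) (k : Fin n → ℕ) (i : Fin n) :
    ∑ j ∈ s, Function.update k i (k i + 1) j = ∑ j ∈ s, k j + if i ∈ s then 1 else 0 := by
  have h : ∀ j, Function.update k i (k i + 1) j = k j + if j = i then 1 else 0 := by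
    intro j
    by_cases hj : j = i
    · subst hj; simp
    · simp [hj]
  simp only [h, Finset.sum_add_distrib, Finset.sum_ite_eq']

/-- The coefficients of the raising operators. -/
noncomputable def raiseCoeff (q : ℝ) (i : Fin n) (k : Fin n → ℕ) : ℝ :=
  √(1 - q⁻¹ ^ (2 * (k i + 1))) * q⁻¹ ^ ∑ j ∈ Finset.Ioi i, k j

/-- Raising `k j` affects the coefficient of index `i` only when `j` lies above `i`, and then by one
factor `q^{-1}`; this is the source of the `q`-commutation relations. -/
theorem raiseCoeff_update {i j : Fin n} (h : i ≠ j) (k : Fin n → ℕ) :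
    raiseCoeff q i (Function.update k j (k j + 1)) =
      raiseCoeff q i k * if i < j then q⁻¹ else 1 := by
  unfold raiseCoeff
  rw [sum_update_succ, Function.update_of_ne h, pow_add, ← mul_assoc]
  simp only [Finset.mem_Ioi]
  split_ifs <;> simp

namespace IsStandardTuple

variable {b : HilbertBasis (Fin n → ℕ) ℂ H} {D : H →L[ℂ] H} {Y : Fin n → (H →L[ℂ] H)}

theorem star_diag (h : IsStandardTuple q b D Y) : star D = D := by
  refine clm_ext_of_dense_span b fun k => ?_
  have := star_weightedShift_apply b Function.injective_id (S := D)
    (c := fun k => ((q⁻¹ ^ ∑ j, k j : ℝ) : ℂ)) h.diag k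
  rw [id] at this
  rw [this, h.diag]
  congr 1
  exact Complex.conj_ofReal _

theorem raise' (h : IsStandardTuple q b D Y) (i : Fin n) (k : Fin n → ℕ) :
    star (Y i) (b k) = (raiseCoeff q i k : ℂ) • b (Function.update k i (k i + 1)) := h.raise i k

theorem lower_update (h : IsStandardTuple q b D Y) (i : Fin n) (k : Fin n → ℕ) :
    Y i (b (Function.update k i (k i + 1))) = (raiseCoeff q i k : ℂ) • b k := by
  have := star_weightedShift_apply b (raise_injective i) (h.raise' i) k
  rw [star_star] at this
  rw [this]
  congr 1
  exact Complex.conj_ofReal _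

theorem lower_eq_zero (h : IsStandardTuple q b D Y) (i : Fin n) {k : Fin n → ℕ} (hk : k i = 0) :
    Y i (b k) = 0 := by
  rw [h.lower, hk]
  simp

theorem exists_update_eq {i : Fin n} {k : Fin n → ℕ} (hk : k i ≠ 0) :
    ∃ l : Fin n → ℕ, k = Function.update l i (l i + 1) := by
  refine ⟨Function.update k i (k i - 1), ?_⟩
  rw [Function.update_self, Function.update_idem, Nat.sub_add_cancel (Nat.one_le_iff_ne_zero.2 hk),
    Function.update_eq_self]

theorem star_mul_lower (hq : 1 < |q|) (h : IsStandardTuple q b D Y) (i : Fin n) (k : Fin n → ℕ) :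
    star (Y i) (Y i (b k)) =
      (((1 - q⁻¹ ^ (2 * k i)) * (q⁻¹ ^ ∑ l ∈ Finset.Ioi i, k l) ^ 2 : ℝ) : ℂ) • b k := by
  by_cases hk : k i = 0
  · rw [h.lower_eq_zero i hk, hk]
    simp
  · obtain ⟨l, rfl⟩ := exists_update_eq hk
    rw [h.lower_update, map_smul, h.raise', smul_smul, sum_update_succ, Function.update_self]
    congr 1
    rw [← Complex.ofReal_mul, raiseCoeff, mul_mul_mul_comm,
      Real.mul_self_sqrt (sub_nonneg.2 (inv_pow_le_one hq _))]
    simp [pow_two]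

theorem lower_mul_star (hq : 1 < |q|) (h : IsStandardTuple q b D Y) (i : Fin n) (k : Fin n → ℕ) :
    Y i (star (Y i) (b k)) =
      (((1 - q⁻¹ ^ (2 * (k i + 1))) * (q⁻¹ ^ ∑ l ∈ Finset.Ioi i, k l) ^ 2 : ℝ) : ℂ) • b k := by
  rw [h.raise', map_smul, h.lower_update, smul_smul]
  congr 1
  rw [← Complex.ofReal_mul, raiseCoeff, mul_mul_mul_comm,
    Real.mul_self_sqrt (sub_nonneg.2 (inv_pow_le_one hq _)), pow_two (q⁻¹ ^ _)]

theorem star_smul_mul (h : IsStandardTuple q b D Y) {z : ℂ} (hz : star z * z = 1) :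
    star (z • D) * (z • D) = D * D := by
  rw [star_smul, h.star_diag, smul_mul_smul_comm, hz, one_smul]

/-- Every relation is checked on basis vectors. Those among `D` and the lowering operators are
proved for the raising operators, where no index is truncated, and then transferred by taking
adjoints. -/
theorem isCoreTuple (hq : 1 < |q|) (h : IsStandardTuple q b D Y) {z : ℂ} (hz : star z * z = 1) :
    IsCoreTuple q (z • D) Y := by
  have hq0 : q ≠ 0 := by
    rintro rfl
    simp at hq
    linarith
  have hDY : ∀ i, star (Y i) * D = (q : ℂ) • (D * star (Y i)) := by
    intro i
    refine clm_ext_of_dense_span b fun k => ?_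
    simp only [mul_apply_eq_comp, smul_apply, h.diag, h.raise',
      map_smul, smul_smul]
    rw [sum_update_succ, if_pos (Finset.mem_univ _), pow_succ]
    congr 1
    push_cast
    have : (q : ℂ) ≠ 0 := by exact_mod_cast hq0
    field_simp
  have hYD : ∀ i, D * Y i = (q : ℂ) • (Y i * D) := by
    intro i
    have := star_mul_eq_of_star_mul_eq (hDY i)
    rwa [h.star_diag] at this
  refine ⟨?_, fun i => ?_, fun i => ?_, fun i j hij => ?_, fun i j hij => ?_, fun i => ?_⟩
  · rw [star_smul, h.star_diag, smul_mul_smul_comm, smul_mul_smul_comm, mul_comm]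
  · rw [smul_mul_assoc, hYD, mul_smul_comm, smul_comm]
  · rw [star_smul, h.star_diag, smul_mul_assoc, hYD, mul_smul_comm, smul_comm]
  · have : star (Y j) * star (Y i) = (q : ℂ) • (star (Y i) * star (Y j)) := by
      refine clm_ext_of_dense_span b fun k => ?_
      simp only [mul_apply_eq_comp, smul_apply, h.raise',
        map_smul, smul_smul]
      rw [raiseCoeff_update hij.ne, raiseCoeff_update hij.ne', if_pos hij, if_neg hij.not_gt,
        Function.update_of_ne hij.ne', Function.update_of_ne hij.ne, Function.update_comm hij.ne']
      congr 1
      push_cast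
      have : (q : ℂ) ≠ 0 := by exact_mod_cast hq0
      field_simp
    have := congrArg star this
    rw [star_smul, star_mul, star_mul, star_star, star_star] at this
    rw [this]
    congr 1
    exact Complex.conj_ofReal q
  · refine clm_ext_of_dense_span b fun k => ?_
    simp only [mul_apply_eq_comp, smul_apply]
    -- On a vector annihilated by `Y_j` both sides vanish; any other basis vector is a raised one,
    -- so that the coefficients of `raiseCoeff_update` apply.
    by_cases hk : k j = 0
    · rw [h.lower_eq_zero j hk, h.raise', map_smul, h.lower_eq_zero j
        (by rw [Function.update_of_ne hij.symm, hk])]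
      simp
    · obtain ⟨l, rfl⟩ := exists_update_eq hk
      rw [h.lower_update, map_smul, h.raise', h.raise', map_smul, Function.update_of_ne hij,
        Function.update_comm hij.symm]
      have := h.lower_update j (Function.update l i (l i + 1))
      rw [Function.update_of_ne hij.symm] at this
      rw [this, smul_smul, smul_smul, smul_smul, raiseCoeff_update hij, raiseCoeff_update hij.symm]
      congr 1
      have hqC : (q : ℂ) ≠ 0 := by exact_mod_cast hq0
      rcases lt_or_gt_of_ne hij with hlt | hlt
      · rw [if_pos hlt, if_neg hlt.not_gt]
        push_cast
        field_simp
      · rw [if_neg hlt.not_gt, if_pos hlt]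
        push_cast
        field_simp
  · refine clm_ext_of_dense_span b fun k => ?_
    rw [h.star_smul_mul hz]
    simp only [mul_apply_eq_comp, smul_apply,
      sub_apply, add_apply, sum_apply,
      h.star_mul_lower hq, h.lower_mul_star hq, h.diag, map_smul, smul_smul, ← Finset.sum_smul,
      ← add_smul, ← sub_smul]
    congr 1
    have h1 := pow_sum_sq_add_sum_Iio q⁻¹ k i
    rw [pow_two] at h1
    rw [← Complex.ofReal_mul, ← Complex.ofReal_sum, ← Complex.ofReal_add, h1]
    push_cast
    ring

theorem coreRadius_eq_one (hq : 1 < |q|) (h : IsStandardTuple q b D Y) {z : ℂ}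
    (hz : star z * z = 1) : coreRadius (z • D) Y = 1 := by
  refine clm_ext_of_dense_span b fun k => ?_
  rw [coreRadius, h.star_smul_mul hz]
  simp only [mul_apply_eq_comp, add_apply,
    sum_apply, h.star_mul_lower hq, h.diag, map_smul, smul_smul,
    ← Finset.sum_smul, ← add_smul]
  have h1 := pow_sum_sq_add_sum q⁻¹ k
  rw [pow_two] at h1
  rw [← Complex.ofReal_mul, ← Complex.ofReal_sum, ← Complex.ofReal_add, h1]
  simp

end IsStandardTuple

end Standard

end QuantumSphere

namespace QuantumSphere

open SphereAlgebra

/-! ### Irreducibility of the standard representations -/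

section Irreducible

variable {H : Type*} [NormedAddCommGroup H] [InnerProductSpace ℂ H] [CompleteSpace H] {q : ℝ}
  {n : ℕ} {b : HilbertBasis (Fin n → ℕ) ℂ H} {D : H →L[ℂ] H} {Y : Fin n → (H →L[ℂ] H)}

theorem raiseCoeff_ne_zero (hq : 1 < |q|) (i : Fin n) (k : Fin n → ℕ) : raiseCoeff q i k ≠ 0 := by
  have h0 : q ≠ 0 := by
    rintro rfl
    simp at hq
    linarith
  have h1 : q⁻¹ ^ (2 * (k i + 1)) < 1 := by
    rw [pow_mul]
    refine pow_lt_one₀ (sq_nonneg _) ?_ (Nat.succ_ne_zero _)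
    rw [← sq_abs]
    exact pow_lt_one₀ (abs_nonneg _) (abs_inv_lt_one hq) two_ne_zero
  exact mul_ne_zero (Real.sqrt_pos.2 (sub_pos.2 h1)).ne' (pow_ne_zero _ (inv_ne_zero h0))

/-- An induction principle along the raising operators. -/
theorem raise_induction {C : (Fin n → ℕ) → Prop} (h0 : C 0)
    (hs : ∀ k i, C k → C (Function.update k i (k i + 1))) (k : Fin n → ℕ) : C k := by
  induction hm : ∑ j, k j generalizing k with
  | zero =>
    have : k = 0 := funext fun j => Finset.sum_eq_zero_iff.1 hm j (Finset.mem_univ j)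
    rwa [this]
  | succ m ih =>
    obtain ⟨i, hi⟩ : ∃ i, k i ≠ 0 := by
      by_contra! h
      simp [h] at hm
    obtain ⟨l, rfl⟩ := IsStandardTuple.exists_update_eq hi
    refine hs l i (ih l ?_)
    rw [sum_update_succ, if_pos (Finset.mem_univ _)] at hm
    exact Nat.succ_injective hm

namespace IsStandardTuple

/-- A basis vector other than `b 0` is a nonzero multiple of some `Y_i^* b_l`, hence orthogonal to
the joint kernel of the `Y_i`. -/
theorem eq_smul_of_lower_eq_zero (hq : 1 < |q|) (h : IsStandardTuple q b D Y) {w : H}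
    (hw : ∀ i, Y i w = 0) : w = inner ℂ (b 0) w • b 0 := by
  classical
  refine hilbertBasis_ext b fun k => ?_
  rw [inner_smul_right, orthonormal_iff_ite.1 b.orthonormal]
  by_cases hk : k = 0
  · simp [hk]
  · obtain ⟨i, hi⟩ : ∃ i, k i ≠ 0 := by
      by_contra! h
      exact hk (funext h)
    obtain ⟨l, rfl⟩ := exists_update_eq hi
    have h1 : inner ℂ (star (Y i) (b l)) w = 0 := by
      rw [ContinuousLinearMap.star_eq_adjoint, ContinuousLinearMap.adjoint_inner_left, hw,
        inner_zero_right]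
    rw [h.raise', inner_smul_left, mul_eq_zero] at h1
    rw [if_neg hk, mul_zero]
    refine h1.resolve_left ?_
    rw [Complex.conj_ofReal]
    exact_mod_cast raiseCoeff_ne_zero hq i l

theorem eq_top_of_mem (hq : 1 < |q|) (h : IsStandardTuple q b D Y) {W : Submodule ℂ H}
    (hW : IsClosed (W : Set H)) (hinv : ∀ i, ∀ w ∈ W, star (Y i) w ∈ W) (h0 : b 0 ∈ W) :
    W = ⊤ := by
  have hb : ∀ k, b k ∈ W := by
    refine raise_induction h0 fun k i hk => ?_
    have h1 := hinv i _ hk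
    rw [h.raise'] at h1
    have h2 : (raiseCoeff q i k : ℂ) ≠ 0 := by exact_mod_cast raiseCoeff_ne_zero hq i k
    exact (W.smul_mem_iff h2).1 h1
  rw [eq_top_iff, ← b.dense_span]
  exact Submodule.topologicalClosure_minimal _
    (Submodule.span_le.2 (by rintro _ ⟨k, rfl⟩; exact hb k)) hW

/-- Split the vacuum as `w + w'` along `W` and its orthogonal complement. Then `Y_i w = -Y_i w'`
lies in both subspaces, so it is zero and `w` is a multiple of the vacuum. Hence one of the two
subspaces contains the vacuum and is everything. The lowering generators and their adjoints suffice
for this. -/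
theorem isIrreducibleRep {A : Type*} [Ring A] [Algebra ℂ A] [StarRing A] (hq : 1 < |q|)
    (h : IsStandardTuple q b D Y) (φ : HilbertRep A H) {y : Fin n → A} (hy : ∀ i, φ (y i) = Y i) :
    IsIrreducibleRep φ := by
  have hb0 : b 0 ≠ 0 := b.orthonormal.ne_zero 0
  refine ⟨⟨b 0, 0, hb0⟩, fun W hW hinv => ?_⟩
  have hlow : ∀ i, ∀ w ∈ W, Y i w ∈ W := fun i w hw => by
    rw [← hy]
    exact hinv _ w hw
  have hraise : ∀ i, ∀ w ∈ W, star (Y i) w ∈ W := fun i w hw => by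
    rw [← hy, ← map_star]
    exact hinv _ w hw
  have hlow' : ∀ i, ∀ w ∈ Wᗮ, Y i w ∈ Wᗮ := fun i w hw => by
    rw [Submodule.mem_orthogonal]
    intro u hu
    rw [← ContinuousLinearMap.adjoint_inner_left, ← ContinuousLinearMap.star_eq_adjoint]
    exact (Submodule.mem_orthogonal _ _).1 hw _ (hraise i u hu)
  have hraise' : ∀ i, ∀ w ∈ Wᗮ, star (Y i) w ∈ Wᗮ := fun i w hw => by
    rw [Submodule.mem_orthogonal]
    intro u hu
    rw [ContinuousLinearMap.star_eq_adjoint, ContinuousLinearMap.adjoint_inner_right]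
    exact (Submodule.mem_orthogonal _ _).1 hw _ (hlow i u hu)
  have : CompleteSpace W := hW.completeSpace_coe
  obtain ⟨w, hw, w', hw', hsum⟩ := W.exists_add_mem_mem_orthogonal (b 0)
  have hvac : ∀ i, Y i w = 0 := by
    intro i
    have h1 : Y i w + Y i w' = 0 := by
      rw [← map_add, ← hsum, h.lower_eq_zero i rfl]
    have h2 : Y i w ∈ Wᗮ := by
      rw [eq_neg_of_add_eq_zero_left h1]
      exact Wᗮ.neg_mem (hlow' i w' hw')
    have h3 : inner ℂ (Y i w) (Y i w) = 0 := (Submodule.mem_orthogonal _ _).1 h2 _ (hlow i w hw)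
    exact inner_self_eq_zero.1 h3
  have hw0 := h.eq_smul_of_lower_eq_zero hq hvac
  by_cases hc : inner ℂ (b 0) w = 0
  · left
    rw [hc, zero_smul] at hw0
    rw [hw0, zero_add] at hsum
    have htop : Wᗮ = ⊤ := h.eq_top_of_mem hq W.isClosed_orthogonal hraise' (hsum ▸ hw')
    rw [← Submodule.orthogonal_orthogonal W, htop, Submodule.top_orthogonal_eq_bot]
  · right
    refine h.eq_top_of_mem hq hW hraise ?_
    rw [hw0] at hw
    exact (W.smul_mem_iff hc).1 hw

theorem diag_zero (h : IsStandardTuple q b D Y) : D (b 0) = b 0 := by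
  rw [h.diag]
  simp

/-- A unitary equivalence preserves the joint kernel of the lowering operators, that is the vacuum
line, and the scalar is the eigenvalue of `t` there. -/
theorem eq_of_unitarilyEquivalent {K : Type*} [NormedAddCommGroup K] [InnerProductSpace ℂ K]
    [CompleteSpace K] {b' : HilbertBasis (Fin n → ℕ) ℂ K} {D' : K →L[ℂ] K}
    {Y' : Fin n → (K →L[ℂ] K)} {A : Type*} [Ring A] [Algebra ℂ A] [StarRing A] (hq : 1 < |q|)
    (h : IsStandardTuple q b D Y) (h' : IsStandardTuple q b' D' Y') {φ : HilbertRep A H}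
    {φ' : HilbertRep A K} {t : A} {y : Fin n → A} {z z' : ℂ} (hy : ∀ i, φ (y i) = Y i)
    (hy' : ∀ i, φ' (y i) = Y' i) (ht : φ t = z • D) (ht' : φ' t = z' • D')
    (hU : UnitarilyEquivalent φ φ') : z = z' := by
  obtain ⟨U, hU⟩ := hU
  have hvac : ∀ i, Y' i (U (b 0)) = 0 := fun i => by
    rw [← hy', ← hU, hy, h.lower_eq_zero i rfl, map_zero]
  have h0 := h'.eq_smul_of_lower_eq_zero hq hvac
  have hne : U (b 0) ≠ 0 := by
    simpa using b.orthonormal.ne_zero 0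
  have h1 := hU t (b 0)
  rw [ht, ht', smul_apply, smul_apply, h.diag_zero, map_smul] at h1
  have h2 : D' (U (b 0)) = U (b 0) := by
    rw [h0, map_smul, h'.diag_zero]
  rw [h2] at h1
  exact smul_left_injective ℂ hne h1

end IsStandardTuple

end Irreducible

/-! ### The representations on Fock space -/

section Fock

/-- The basis `|k⟩` as a Hilbert basis. -/
noncomputable def fockBasis (n : ℕ) : HilbertBasis (Fin n → ℕ) ℂ (Fock n) :=
  HilbertBasis.ofRepr (LinearIsometryEquiv.refl ℂ _)

theorem fockBasis_apply {n : ℕ} (k : Fin n → ℕ) : fockBasis n k = ket k := by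
  rw [← (fockBasis n).repr_symm_single, ket]
  rfl

variable {H : Type*} [NormedAddCommGroup H] [InnerProductSpace ℂ H] [CompleteSpace H] {q : ℝ}
  {n : ℕ} {b : HilbertBasis (Fin n → ℕ) ℂ H} {D : H →L[ℂ] H} {Y : Fin n → (H →L[ℂ] H)}

theorem star_units_mul (ε : ℤˣ) : star ((ε : ℤ) : ℂ) * ((ε : ℤ) : ℂ) = 1 := by
  rcases Int.units_eq_one_or ε with rfl | rfl <;> simp

theorem star_circle_mul (z : Circle) : star (z : ℂ) * (z : ℂ) = 1 := by
  have := Circle.normSq_coe z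
  rw [mul_comm]
  exact (Complex.mul_conj _).trans (by rw [this]; simp)

theorem exists_evenRep (hq : 1 < |q|) (h : IsStandardTuple q b D Y) (ε : ℤˣ) :
    ∃ ψ : HilbertRep (EvenSphere q n) H, ψ (x 0) = ((ε : ℤ) : ℂ) • D ∧
      ∀ i : Fin n, ψ (x i.succ) = Y i := by
  have hb : IsSphereTuple q False (Fin.cons (((ε : ℤ) : ℂ) • D) Y : Fin (n + 1) → (H →L[ℂ] H)) := by
    rw [isSphereTuple_even_iff]
    simp only [Fin.cons_zero, Fin.cons_succ]
    refine ⟨h.isCoreTuple hq (star_units_mul ε), ?_, h.coreRadius_eq_one hq (star_units_mul ε)⟩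
    rw [star_smul, h.star_diag]
    simp
  refine ⟨SphereAlgebra.lift _ hb, ?_, fun i => ?_⟩ <;> rw [lift_x] <;> rfl

theorem exists_oddRep (hq : 1 < |q|) (h : IsStandardTuple q b D Y) (z : Circle) :
    ∃ ψ : HilbertRep (OddSphere q (n + 1)) H, ψ (x 1) = (z : ℂ) • D ∧
      ∀ i : Fin n, ψ (x i.succ.succ) = Y i := by
  have hb : IsSphereTuple q True
      (Fin.cons 0 (Fin.cons ((z : ℂ) • D) Y) : Fin (n + 2) → (H →L[ℂ] H)) := by
    rw [isSphereTuple_odd_iff]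
    exact ⟨h.isCoreTuple hq (star_circle_mul z), rfl, h.coreRadius_eq_one hq (star_circle_mul z)⟩
  refine ⟨SphereAlgebra.lift _ hb, ?_, fun i => ?_⟩ <;> rw [lift_x] <;> rfl

theorem isEvenPsi_of_standard {D : Fock n →L[ℂ] Fock n} {Y : Fin n → (Fock n →L[ℂ] Fock n)}
    (h : IsStandardTuple q (fockBasis n) D Y) {ε : ℤˣ} {ψ : HilbertRep (EvenSphere q n) (Fock n)}
    (h0 : ψ (x 0) = ((ε : ℤ) : ℂ) • D) (hs : ∀ i : Fin n, ψ (x i.succ) = Y i) :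
    IsEvenPsi q n ε ψ where
  x_zero k := by
    rw [h0, smul_apply, ← fockBasis_apply, h.diag, smul_smul]
  x_succ i k := by
    rw [hs, ← fockBasis_apply, ← fockBasis_apply, h.lower]
  star_x_succ i k := by
    rw [map_star, hs, ← fockBasis_apply, ← fockBasis_apply, h.raise]

theorem isOddPsi_of_standard {D : Fock n →L[ℂ] Fock n} {Y : Fin n → (Fock n →L[ℂ] Fock n)}
    (h : IsStandardTuple q (fockBasis n) D Y) {z : Circle}
    {ψ : HilbertRep (OddSphere q (n + 1)) (Fock n)}
    (h0 : ψ (x 1) = (z : ℂ) • D) (hs : ∀ i : Fin n, ψ (x i.succ.succ) = Y i) :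
    IsOddPsi q n z ψ where
  x_one k := by
    rw [h0, smul_apply, ← fockBasis_apply, h.diag, smul_smul]
  star_x_one k := by
    rw [map_star, h0, star_smul, h.star_diag, smul_apply, ← fockBasis_apply, h.diag, smul_smul]
    rfl
  x_succ i k := by
    rw [hs, ← fockBasis_apply, ← fockBasis_apply, h.lower]
  star_x_succ i k := by
    rw [map_star, hs, ← fockBasis_apply, ← fockBasis_apply, h.raise]

/-- A representation through the quotient kills `x 0`, but `z • D` is nonzero on the vacuum. -/
theorem not_factorsThrough_evenToOdd (h : IsStandardTuple q b D Y) {z : ℂ} (hz : z ≠ 0)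
    {ψ : HilbertRep (EvenSphere q n) H} (h0 : ψ (x 0) = z • D) :
    ¬ FactorsThrough ψ (evenToOdd q n) := by
  rintro ⟨φ', rfl⟩
  have h1 : (x 0 : OddSphere q n) = 0 := isSphereTuple_x.zero trivial
  rw [StarAlgHom.comp_apply, evenToOdd_x, h1, map_zero] at h0
  have h2 := congrArg (fun S : H →L[ℂ] H => S (b 0)) h0
  simp only [smul_apply, h.diag_zero, zero_apply] at h2
  exact smul_ne_zero hz (b.orthonormal.ne_zero 0) h2.symm

theorem not_factorsThrough_oddToOdd (h : IsStandardTuple q b D Y) {z : ℂ} (hz : z ≠ 0)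
    {ψ : HilbertRep (OddSphere q (n + 1)) H} (h0 : ψ (x 1) = z • D) :
    ¬ FactorsThrough ψ (oddToOdd q n) := by
  rintro ⟨φ', rfl⟩
  have h1 : (x 0 : OddSphere q n) = 0 := isSphereTuple_x.zero trivial
  have h3 : shiftGen q n 1 = x 0 := rfl
  rw [StarAlgHom.comp_apply, oddToOdd_x, h3, h1, map_zero] at h0
  have h2 := congrArg (fun S : H →L[ℂ] H => S (b 0)) h0
  simp only [smul_apply, h.diag_zero, zero_apply] at h2
  exact smul_ne_zero hz (b.orthonormal.ne_zero 0) h2.symm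

end Fock

end QuantumSphere

namespace QuantumSphere

open SphereAlgebra

/-! ### Classification of the irreducible representations -/

section Classification

/-- Schur's lemma for a normal operator. Kernels of functions of `U` reduce `U`, so every `cfc f U`
is zero or injective. Two distinct points of the spectrum would give two nonzero functions of `U`
with product zero, so the spectrum is a single point. -/
theorem exists_eq_smul_one_of_irreducible {K : Type*} [NormedAddCommGroup K]
    [InnerProductSpace ℂ K] [CompleteSpace K] [Nontrivial K] {U : K →L[ℂ] K}
    (hU : star U * U = U * star U)
    (h : ∀ L : Submodule ℂ K, IsClosed (L : Set K) → (∀ v ∈ L, U v ∈ L) →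
      (∀ v ∈ L, star U v ∈ L) → L = ⊥ ∨ L = ⊤) : ∃ z : ℂ, U = z • 1 := by
  have hn : IsStarNormal U := ⟨hU⟩
  have hker : ∀ f : ℂ → ℂ, cfc f U = 0 ∨ ∀ v, cfc f U v = 0 → v = 0 := by
    intro f
    have hc : Commute (cfc f U) U := (Commute.refl U).cfc hU f
    have hc' : Commute (cfc f U) (star U) :=
      Commute.cfc (by exact hU.symm) (Commute.refl _) f
    have hinv : ∀ S : K →L[ℂ] K, Commute (cfc f U) S → ∀ v, cfc f U v = 0 → cfc f U (S v) = 0 := by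
      intro S hS v hv
      have := congrArg (fun S : K →L[ℂ] K => S v) hS.eq
      simp only [mul_apply_eq_comp] at this
      rw [this, hv, map_zero]
    rcases h (LinearMap.ker (cfc f U).toLinearMap) (cfc f U).isClosed_ker (hinv U hc)
      (hinv (star U) hc') with h1 | h1
    · right
      intro v hv
      have : v ∈ LinearMap.ker (cfc f U).toLinearMap := hv
      rwa [h1, Submodule.mem_bot] at this
    · left
      ext v
      have : v ∈ LinearMap.ker (cfc f U).toLinearMap := by rw [h1]; trivial
      exact this
  obtain ⟨z, hz⟩ := spectrum.nonempty U
  refine ⟨z, ?_⟩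
  have hspec : ∀ w ∈ spectrum ℂ U, w = z := by
    intro w hw
    by_contra hwz
    -- With half the distance as radius, the bumps around `w` and `z` have disjoint supports.
    set r := dist w z / 2 with hr
    have hr0 : 0 < r := half_pos (dist_pos.2 hwz)
    let f : ℂ → ℂ → ℂ := fun a u => ((max 0 (r - dist u a) : ℝ) : ℂ)
    have hf : ∀ a, Continuous (f a) := fun a => by fun_prop
    have hne : ∀ a ∈ spectrum ℂ U, cfc (f a) U ≠ 0 := by
      intro a ha h0
      have h1 : f a a ∈ spectrum ℂ (cfc (f a) U) := by
        rw [cfc_map_spectrum (f a) U hn (hf a).continuousOn]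
        exact ⟨a, ha, rfl⟩
      rw [h0, spectrum.zero_eq, Set.mem_singleton_iff] at h1
      simp only [f, dist_self, sub_zero, Complex.ofReal_eq_zero] at h1
      rw [max_eq_right hr0.le] at h1
      exact hr0.ne' h1
    have hprod : cfc (f w) U * cfc (f z) U = 0 := by
      rw [← cfc_mul (f w) (f z) U (hf w).continuousOn (hf z).continuousOn]
      have : (fun u => f w u * f z u) = fun _ => (0 : ℂ) := by
        funext u
        simp only [f, ← Complex.ofReal_mul, Complex.ofReal_eq_zero, mul_eq_zero]
        by_contra! hcon
        have h1 : dist u w < r := by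
          by_contra! h
          exact hcon.1 (max_eq_left (by linarith))
        have h2 : dist u z < r := by
          by_contra! h
          exact hcon.2 (max_eq_left (by linarith))
        have := dist_triangle_left w z u
        rw [hr] at h1 h2
        linarith
      rw [this, cfc_const_zero]
    rcases hker (f w) with h1 | h1
    · exact hne w hw h1
    · refine hne z hz (ContinuousLinearMap.ext fun v => h1 _ ?_)
      exact congrArg (fun S : K →L[ℂ] K => S v) hprod
  calc U = cfc (id : ℂ → ℂ) U := (cfc_id ℂ U).symm
    _ = cfc (fun _ => z) U := cfc_congr fun w hw => hspec w hw
    _ = z • 1 := by rw [cfc_const z U, Algebra.algebraMap_eq_smul_one]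

variable {H : Type*} [NormedAddCommGroup H] [InnerProductSpace ℂ H] [CompleteSpace H] {q : ℝ}
  {n : ℕ}

/-- An irreducible family of operators: the only closed subspaces invariant under `T`, `T^*`,
`Y_i`, `Y_i^*` are trivial. -/
def IsIrreducibleTuple (T : H →L[ℂ] H) (Y : Fin n → (H →L[ℂ] H)) : Prop :=
  ∀ W : Submodule ℂ H, IsClosed (W : Set H) → (∀ w ∈ W, T w ∈ W) → (∀ w ∈ W, star T w ∈ W) →
    (∀ i, ∀ w ∈ W, Y i w ∈ W) → (∀ i, ∀ w ∈ W, star (Y i) w ∈ W) → W = ⊥ ∨ W = ⊤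

namespace IsMatrixUnits

variable {p₀ T : H →L[ℂ] H} {Y : Fin n → (H →L[ℂ] H)} {e : (Fin n → ℕ) → (H →L[ℂ] H)}

/-- The relations of the matrix units show that the span of the `e_k L` is invariant under the
generators and their adjoints, so irreducibility makes its closure trivial. It contains `L` because
`e_0 = p₀` fixes `L`. -/
theorem eq_bot_or_closure_eq_top (h : IsMatrixUnits q 1 T Y p₀ e) (hirr : IsIrreducibleTuple T Y)
    {L : Submodule ℂ H} (hp₀ : ∀ v ∈ L, p₀ v = v) (hT : ∀ v ∈ L, T v ∈ L)
    (hT' : ∀ v ∈ L, star T v ∈ L) :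
    L = ⊥ ∨ (Submodule.span ℂ {w | ∃ k, ∃ v ∈ L, e k v = w}).topologicalClosure = ⊤ := by
  set W := Submodule.span ℂ {w | ∃ k, ∃ v ∈ L, e k v = w} with hW
  have hinv : ∀ S : H →L[ℂ] H, (∀ k, ∀ v ∈ L, S (e k v) ∈ W) →
      ∀ w ∈ W.topologicalClosure, S w ∈ W.topologicalClosure := by
    intro S hS w hw
    have hle : W ≤ W.comap S.toLinearMap :=
      Submodule.span_le.2 (by rintro _ ⟨k, v, hv, rfl⟩; exact hS k v hv)
    exact map_mem_closure S.continuous hw fun u hu => hle hu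
  have hmem : ∀ k, ∀ v ∈ L, e k v ∈ W := fun k v hv => Submodule.subset_span ⟨k, v, hv, rfl⟩
  have happ : ∀ {S S' : H →L[ℂ] H} (v : H), S = S' → S v = S' v := fun v hv => by rw [hv]
  rcases hirr W.topologicalClosure W.isClosed_topologicalClosure
    (hinv T fun k v hv => by
      have := happ v (h.T_mul k)
      simp only [mul_apply_eq_comp, smul_apply] at this
      rw [this]
      exact W.smul_mem _ (hmem _ _ (hT v hv)))
    (hinv (star T) fun k v hv => by
      have := happ v (h.star_T_mul k)
      simp only [mul_apply_eq_comp, smul_apply] at this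
      rw [this]
      exact W.smul_mem _ (hmem _ _ (hT' v hv)))
    (fun i => hinv (Y i) fun k v hv => by
      have := happ v (h.lower i k)
      simp only [mul_apply_eq_comp, smul_apply] at this
      rw [this]
      exact W.smul_mem _ (hmem _ _ hv))
    (fun i => hinv (star (Y i)) fun k v hv => by
      have := happ v (h.raise i k)
      simp only [mul_apply_eq_comp, smul_apply] at this
      rw [this]
      exact W.smul_mem _ (hmem _ _ hv)) with h1 | h1
  · left
    rw [eq_bot_iff]
    intro v hv
    have h2 : v ∈ W.topologicalClosure := by
      apply W.le_topologicalClosure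
      have := hmem 0 v hv
      rwa [h.zero, hp₀ v hv] at this
    rwa [h1] at h2
  · exact Or.inr h1

theorem ground_mul (h : IsMatrixUnits q 1 T Y p₀ e) (k : Fin n → ℕ) :
    p₀ * e k = if k = 0 then p₀ else 0 := by
  have h0 : star p₀ = p₀ := by
    have := h.star_mul 0 0
    rw [if_pos rfl, h.zero] at this
    rw [← this, StarMul.star_mul, star_star]
  have := h.star_mul 0 k
  rw [h.zero, h0] at this
  rw [this]
  simp [eq_comm]

/-- Without a vacuum all `e_k` vanish, and `approx` then bounds `‖T‖` by every `ε`. -/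
theorem T_eq_zero (h : IsMatrixUnits q 1 T Y p₀ e) (h0 : p₀ = 0) : T = 0 := by
  have he : ∀ k, e k = 0 := fun k => by
    have := h.star_mul k k
    rw [if_pos rfl, h0] at this
    exact (CStarRing.star_mul_self_eq_zero_iff _).1 this
  have hT : ‖T‖ ≤ 0 := le_of_forall_pos_le_add fun ε hε => by
    obtain ⟨F, hF⟩ := h.approx ε hε
    simpa [he] using hF
  exact norm_le_zero_iff.1 hT

/-- `T` restricts to a normal operator of `p₀ H` with no proper reducing closed subspace, so it is
scalar there by the Schur argument. The scalar has modulus one because `T^* T p₀ = p₀`. -/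
theorem exists_eigenvector (h : IsMatrixUnits q 1 T Y p₀ e) (hn : T * star T = star T * T)
    (hirr : IsIrreducibleTuple T Y) (h0 : p₀ ≠ 0) :
    ∃ (ξ : H) (z : ℂ), ‖ξ‖ = 1 ∧ p₀ ξ = ξ ∧ T ξ = z • ξ ∧ star T ξ = star z • ξ ∧
      star z * z = 1 := by
  have happ : ∀ {S S' : H →L[ℂ] H} (v : H), S = S' → S v = S' v := fun v hv => by rw [hv]
  have hpp : p₀ * p₀ = p₀ := by
    have := h.ground_mul 0
    rwa [h.zero, if_pos rfl] at this
  have hTp : T * p₀ = p₀ * T := by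
    have := h.T_mul 0
    rw [h.zero] at this
    simpa using this
  have hTp' : star T * p₀ = p₀ * star T := by
    have := h.star_T_mul 0
    rw [h.zero] at this
    simpa using this
  set K : Submodule ℂ H := LinearMap.ker (p₀ - 1).toLinearMap with hK
  have hmem : ∀ v, v ∈ K ↔ p₀ v = v := fun v => by
    have : v ∈ K ↔ p₀ v - v = 0 := Iff.rfl
    rw [this, sub_eq_zero]
  have hKc : IsClosed (K : Set H) := (p₀ - 1).isClosed_ker
  have : CompleteSpace K := hKc.completeSpace_coe
  have hTK : ∀ v ∈ K, T v ∈ K := fun v hv => by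
    have := happ v hTp
    simp only [mul_apply_eq_comp] at this
    rw [hmem] at hv ⊢
    rw [← this, hv]
  have hTK' : ∀ v ∈ K, star T v ∈ K := fun v hv => by
    have := happ v hTp'
    simp only [mul_apply_eq_comp] at this
    rw [hmem] at hv ⊢
    rw [← this, hv]
  obtain ⟨u, hu⟩ : ∃ u, p₀ u ≠ 0 := by
    by_contra! hcon
    exact h0 (ContinuousLinearMap.ext hcon)
  have huK : p₀ u ∈ K := by
    rw [hmem]
    exact happ u hpp
  have : Nontrivial K := ⟨⟨p₀ u, huK⟩, 0, fun hcon => hu (congrArg Subtype.val hcon)⟩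
  let U : K →L[ℂ] K := (T ∘L K.subtypeL).codRestrict K fun v => hTK v v.2
  let U' : K →L[ℂ] K := (star T ∘L K.subtypeL).codRestrict K fun v => hTK' v v.2
  have hUU' : star U = U' := by
    rw [ContinuousLinearMap.star_eq_adjoint]
    refine ((ContinuousLinearMap.eq_adjoint_iff _ _).2 fun v w => ?_).symm
    change inner ℂ (star T (v : H)) (w : H) = inner ℂ (v : H) (T (w : H))
    rw [ContinuousLinearMap.star_eq_adjoint, ContinuousLinearMap.adjoint_inner_left]
  have hUn : star U * U = U * star U := by
    rw [hUU']
    ext v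
    exact DFunLike.congr_fun hn.symm (v : H)
  obtain ⟨z, hz⟩ := exists_eq_smul_one_of_irreducible hUn fun L hL hUL hUL' => by
    rw [hUU'] at hUL'
    rcases h.eq_bot_or_closure_eq_top hirr (L := L.map K.subtype)
      (by rintro _ ⟨v, hv, rfl⟩; exact (hmem _).1 v.2)
      (by rintro _ ⟨v, hv, rfl⟩; exact ⟨U v, hUL v hv, rfl⟩)
      (by rintro _ ⟨v, hv, rfl⟩; exact ⟨U' v, hUL' v hv, rfl⟩) with h1 | h1
    · left
      rw [eq_bot_iff]
      intro v hv
      have : (v : H) ∈ L.map K.subtype := ⟨v, hv, rfl⟩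
      rw [h1, Submodule.mem_bot] at this
      exact Subtype.ext this
    · right
      have hLc : IsClosed ((L.map K.subtype : Submodule ℂ H) : Set H) := by
        have := hKc.isClosedEmbedding_subtypeVal.isClosedMap _ hL
        exact this
      -- If the `e_k L` span a dense subspace, applying `p₀` recovers `L`: it kills `e_k L` for `k ≠
      -- 0` and fixes `e_0 L`. Hence `p₀ H` is contained in the closed subspace `L`.
      have hall : ∀ w, p₀ w ∈ L.map K.subtype := by
        intro w
        have hw : w ∈ (Submodule.span ℂ
            {w | ∃ k, ∃ v ∈ L.map K.subtype, e k v = w}).topologicalClosure := by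
          rw [h1]
          trivial
        have hcl : IsClosed (((L.map K.subtype).comap p₀.toLinearMap : Submodule ℂ H) : Set H) :=
          hLc.preimage p₀.continuous
        refine Submodule.topologicalClosure_minimal _ (Submodule.span_le.2 ?_) hcl hw
        rintro _ ⟨k, v, hv, rfl⟩
        change p₀ (e k v) ∈ L.map K.subtype
        have h2 := happ v (h.ground_mul k)
        simp only [mul_apply_eq_comp] at h2
        rw [h2]
        split_ifs
        · obtain ⟨v', hv', rfl⟩ := hv
          have : p₀ (v' : H) = v' := (hmem _).1 v'.2
          exact ⟨v', hv', this.symm⟩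
        · exact Submodule.zero_mem _
      rw [eq_top_iff]
      intro v _
      obtain ⟨v', hv', hvv⟩ := hall v
      rw [(hmem _).1 v.2] at hvv
      have : v' = v := Subtype.ext hvv
      rwa [← this]
  have hξ : ∀ v ∈ K, T v = z • v := fun v hv =>
    congrArg Subtype.val (DFunLike.congr_fun hz (⟨v, hv⟩ : K))
  have hξ' : ∀ v ∈ K, star T v = star z • v := fun v hv => by
    have h1 : U' = star z • 1 := by
      rw [← hUU', hz, star_smul]
      exact congrArg _ (star_one (K →L[ℂ] K))
    exact congrArg Subtype.val (DFunLike.congr_fun h1 (⟨v, hv⟩ : K))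
  refine ⟨(‖p₀ u‖⁻¹ : ℂ) • p₀ u, z, norm_smul_inv_norm hu, ?_, hξ _ (K.smul_mem _ huK),
    hξ' _ (K.smul_mem _ huK), ?_⟩
  · exact (hmem _).1 (K.smul_mem _ huK)
  · have h1 := happ u h.star_T_mul_T
    simp only [mul_apply_eq_comp] at h1
    rw [hξ _ huK, map_smul, hξ' _ huK, smul_smul] at h1
    rw [mul_comm]
    exact smul_left_injective ℂ hu (by simpa using h1)

end IsMatrixUnits

end Classification

end QuantumSphere

namespace QuantumSphere

open SphereAlgebra

/-! ### Standard bases of irreducible representations, and intertwining unitaries. -/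

section UnitaryEquivalence

variable {H : Type*} [NormedAddCommGroup H] [InnerProductSpace ℂ H] [CompleteSpace H]
  {K : Type*} [NormedAddCommGroup K] [InnerProductSpace ℂ K] [CompleteSpace K] {q : ℝ} {n : ℕ}

/-- The dichotomy behind the classification. A nonzero vacuum has a unit eigenvector `ξ`; the `e_k
ξ` are orthonormal by the matrix unit relations, and complete because the line through `ξ` generates
a dense subspace. -/
theorem exists_standardBasis [Nontrivial H] (hq : 1 < |q|) {T : H →L[ℂ] H}
    {Y : Fin n → (H →L[ℂ] H)} (h : IsCoreTuple q T Y) (hs : coreRadius T Y = 1)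
    (hirr : IsIrreducibleTuple T Y) : T = 0 ∨
      ∃ (b : HilbertBasis (Fin n → ℕ) ℂ H) (D : H →L[ℂ] H) (z : ℂ), star z * z = 1 ∧
        IsStandardTuple q b D Y ∧ T = z • D := by
  have happ : ∀ {S S' : H →L[ℂ] H} (v : H), S = S' → S v = S' v := fun v hv => by rw [hv]
  obtain ⟨p₀, e, he⟩ := exists_isMatrixUnits hq h (star_one _) (one_mul 1) (by simp) (by simp)
    (by rw [hs, one_mul])
  by_cases h0 : p₀ = 0
  · exact Or.inl (he.T_eq_zero h0)
  right
  obtain ⟨ξ, z, hξ, hpξ, hT, hT', hz⟩ := he.exists_eigenvector h.normal hirr h0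
  have hξ0 : ξ ≠ 0 := by
    intro h
    simp [h] at hξ
  have ho : Orthonormal ℂ fun k => e k ξ := by
    classical
    rw [orthonormal_iff_ite]
    intro k l
    have h1 := happ ξ (he.star_mul k l)
    rw [mul_apply_eq_comp, ContinuousLinearMap.star_eq_adjoint] at h1
    rw [← ContinuousLinearMap.adjoint_inner_right, h1]
    by_cases hkl : k = l
    · simp [hkl, hpξ, inner_self_eq_norm_sq_to_K, hξ]
    · simp [hkl]
  have hspan : ∀ v ∈ Submodule.span ℂ {ξ}, ∃ a : ℂ, a • ξ = v := fun v hv =>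
    Submodule.mem_span_singleton.1 hv
  have htop := he.eq_bot_or_closure_eq_top hirr (L := Submodule.span ℂ {ξ})
    (fun v hv => by
      obtain ⟨a, rfl⟩ := hspan v hv
      rw [map_smul, hpξ])
    (fun v hv => by
      obtain ⟨a, rfl⟩ := hspan v hv
      rw [map_smul, hT]
      exact Submodule.smul_mem _ _ (Submodule.smul_mem _ _ (Submodule.mem_span_singleton_self ξ)))
    (fun v hv => by
      obtain ⟨a, rfl⟩ := hspan v hv
      rw [map_smul, hT']
      exact Submodule.smul_mem _ _ (Submodule.smul_mem _ _ (Submodule.mem_span_singleton_self ξ)))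
  have hd : ⊤ ≤ (Submodule.span ℂ (Set.range fun k => e k ξ)).topologicalClosure := by
    rw [← htop.resolve_left (by simpa using hξ0)]
    refine Submodule.topologicalClosure_mono (Submodule.span_le.2 ?_)
    rintro _ ⟨k, v, hv, rfl⟩
    obtain ⟨a, rfl⟩ := hspan v hv
    rw [map_smul]
    exact Submodule.smul_mem _ _ (Submodule.subset_span ⟨k, rfl⟩)
  set b := HilbertBasis.mk ho hd with hb
  have hbk : ∀ k, b k = e k ξ := fun k => by rw [hb, HilbertBasis.coe_mk]
  -- `D` is obtained from `T` by dividing out the phase, `z⁻¹ = star z`.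
  refine ⟨b, star z • T, z, hz, ⟨fun k => ?_, fun i k => ?_, fun i k => ?_⟩, ?_⟩
  · have h1 := happ ξ (he.T_mul k)
    simp only [mul_apply_eq_comp, smul_apply] at h1
    rw [hbk, smul_apply, h1, hT, map_smul, smul_smul, smul_smul, mul_right_comm, hz, one_mul]
  · have h1 := happ ξ (he.lower i k)
    simp only [mul_apply_eq_comp, smul_apply] at h1
    rw [hbk, hbk, h1]
  · have h1 := happ ξ (he.raise i k)
    simp only [mul_apply_eq_comp, smul_apply] at h1
    rw [hbk, hbk, h1]
  · rw [smul_smul, mul_comm, hz, one_smul]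

omit [CompleteSpace H] [CompleteSpace K] in
theorem intertwines_of_basis {ι : Type*} (b : HilbertBasis ι ℂ H) (b' : HilbertBasis ι ℂ K)
    {f : ι → ι} {c : ι → ℂ} {S : H →L[ℂ] H} {S' : K →L[ℂ] K} (hS : ∀ k, S (b k) = c k • b (f k))
    (hS' : ∀ k, S' (b' k) = c k • b' (f k)) (v : H) :
    b.repr.trans b'.repr.symm (S v) = S' (b.repr.trans b'.repr.symm v) := by
  classical
  set U := b.repr.trans b'.repr.symm with hU
  have hUb : ∀ k, U (b k) = b' k := fun k => by
    rw [hU, LinearIsometryEquiv.trans_apply, b.repr_self, b'.repr_symm_single]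
  have : U.toContinuousLinearEquiv.toContinuousLinearMap ∘L S =
      S' ∘L U.toContinuousLinearEquiv.toContinuousLinearMap := by
    refine clm_ext_of_dense_span b fun k => ?_
    change U (S (b k)) = S' (U (b k))
    rw [hS, map_smul, hUb, hUb, hS']
  exact DFunLike.congr_fun this v

theorem IsStandardTuple.intertwines {b : HilbertBasis (Fin n → ℕ) ℂ H}
    {b' : HilbertBasis (Fin n → ℕ) ℂ K} {D : H →L[ℂ] H} {D' : K →L[ℂ] K}
    {Y : Fin n → (H →L[ℂ] H)} {Y' : Fin n → (K →L[ℂ] K)} (h : IsStandardTuple q b D Y)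
    (h' : IsStandardTuple q b' D' Y') :
    (∀ v, b.repr.trans b'.repr.symm (D v) = D' (b.repr.trans b'.repr.symm v)) ∧
    (∀ i v, b.repr.trans b'.repr.symm (Y i v) = Y' i (b.repr.trans b'.repr.symm v)) ∧
    (∀ i v, b.repr.trans b'.repr.symm (star (Y i) v) =
      star (Y' i) (b.repr.trans b'.repr.symm v)) :=
  ⟨intertwines_of_basis (f := id) b b' h.diag h'.diag,
    fun i => intertwines_of_basis b b' (h.lower i) (h'.lower i),
    fun i => intertwines_of_basis b b' (h.raise i) (h'.raise i)⟩

theorem unitarilyEquivalent_of_gen {odd : Prop} {φ : HilbertRep (SphereAlgebra q n odd) H}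
    {ψ : HilbertRep (SphereAlgebra q n odd) K} (U : H ≃ₗᵢ[ℂ] K)
    (h : ∀ i v, U (φ (x i) v) = ψ (x i) (U v))
    (h' : ∀ i v, U (star (φ (x i)) v) = star (ψ (x i)) (U v)) : UnitarilyEquivalent φ ψ := by
  refine ⟨U, fun a => ?_⟩
  induction a using SphereAlgebra.induct_gen with
  | hc c =>
    intro v
    rw [AlgHomClass.commutes, AlgHomClass.commutes]
    simp [Algebra.algebraMap_eq_smul_one]
  | hx i => exact h i
  | hs i => rw [map_star, map_star]; exact h' i
  | hm a b ha hb =>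
    intro v
    rw [map_mul, map_mul, mul_apply_eq_comp, mul_apply_eq_comp, ha, hb]
  | ha a b ha hb =>
    intro v
    rw [map_add, map_add, add_apply, add_apply, map_add, ha, hb]

theorem forall_mem_of_gen {odd : Prop} {φ : HilbertRep (SphereAlgebra q n odd) H}
    {W : Submodule ℂ H} (h : ∀ i, ∀ w ∈ W, φ (x i) w ∈ W)
    (h' : ∀ i, ∀ w ∈ W, star (φ (x i)) w ∈ W) (a : SphereAlgebra q n odd) :
    ∀ w ∈ W, φ a w ∈ W := by
  induction a using SphereAlgebra.induct_gen with
  | hc c =>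
    intro w hw
    rw [AlgHomClass.commutes]
    simpa [Algebra.algebraMap_eq_smul_one] using W.smul_mem c hw
  | hx i => exact h i
  | hs i => rw [map_star]; exact h' i
  | hm a b ha hb =>
    intro w hw
    rw [map_mul, mul_apply_eq_comp]
    exact ha _ (hb _ hw)
  | ha a b ha hb =>
    intro w hw
    rw [map_add, add_apply]
    exact W.add_mem (ha _ hw) (hb _ hw)

theorem even_classification (hq : 1 < |q|) {b' : HilbertBasis (Fin n → ℕ) ℂ K}
    {D' : K →L[ℂ] K} {Y' : Fin n → (K →L[ℂ] K)} (h' : IsStandardTuple q b' D' Y')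
    {ψ : ℤˣ → HilbertRep (EvenSphere q n) K} (hψ0 : ∀ ε, ψ ε (x 0) = ((ε : ℤ) : ℂ) • D')
    (hψ : ∀ ε (i : Fin n), ψ ε (x i.succ) = Y' i) {φ : HilbertRep (EvenSphere q n) H}
    (hφ : IsIrreducibleRep φ) :
    FactorsThrough φ (evenToOdd q n) ∨ ∃ ε, UnitarilyEquivalent φ (ψ ε) := by
  have hnt := hφ.1
  obtain ⟨hc, hsa, hr⟩ := isSphereTuple_even_iff.1 (isSphereTuple_x.map φ)
  rcases exists_standardBasis hq hc hr (fun W hW h1 h2 h3 h4 => hφ.2 W hW (forall_mem_of_gen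
    (fun i => by
      induction i using Fin.cases with
      | zero => exact h1
      | succ i => exact h3 i)
    (fun i => by
      induction i using Fin.cases with
      | zero => exact h2
      | succ i => exact h4 i))) with h0 | ⟨b, D, z, hz, hst, hT⟩
  · exact Or.inl (exists_comp_evenToOdd φ h0)
  · right
    -- Self-adjointness of `x 0` makes the phase real, hence `±1`.
    have hz' : star z = z := by
      rw [hT, star_smul, hst.star_diag] at hsa
      have := congrArg (fun S : H →L[ℂ] H => S (b 0)) hsa
      simp only [smul_apply, hst.diag_zero] at this
      exact smul_left_injective ℂ (b.orthonormal.ne_zero 0) this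
    obtain ⟨ε, hε⟩ : ∃ ε : ℤˣ, z = ((ε : ℤ) : ℂ) := by
      rw [hz'] at hz
      rcases mul_self_eq_one_iff.1 hz with h1 | h1
      · exact ⟨1, by simp [h1]⟩
      · exact ⟨-1, by simp [h1]⟩
    obtain ⟨hD, hY, hY'⟩ := hst.intertwines h'
    refine ⟨ε, unitarilyEquivalent_of_gen (b.repr.trans b'.repr.symm) (fun i v => ?_)
      fun i v => ?_⟩
    · induction i using Fin.cases with
      | zero => rw [hT, hψ0, ← hε, smul_apply, smul_apply, map_smul, hD]
      | succ i => rw [hψ]; exact hY i v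
    · induction i using Fin.cases with
      | zero =>
        rw [hT, hψ0, ← hε, star_smul, star_smul, hst.star_diag, h'.star_diag, smul_apply,
          smul_apply, map_smul, hD]
      | succ i => rw [hψ]; exact hY' i v

theorem odd_classification (hq : 1 < |q|) {b' : HilbertBasis (Fin n → ℕ) ℂ K}
    {D' : K →L[ℂ] K} {Y' : Fin n → (K →L[ℂ] K)} (h' : IsStandardTuple q b' D' Y')
    {ψ : Circle → HilbertRep (OddSphere q (n + 1)) K} (hψ0 : ∀ z, ψ z (x 1) = (z : ℂ) • D')
    (hψ : ∀ z (i : Fin n), ψ z (x i.succ.succ) = Y' i) {φ : HilbertRep (OddSphere q (n + 1)) H}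
    (hφ : IsIrreducibleRep φ) :
    (1 ≤ n ∧ FactorsThrough φ (oddToOdd q n)) ∨ ∃ z, UnitarilyEquivalent φ (ψ z) := by
  have hnt := hφ.1
  obtain ⟨hc, hzero, hr⟩ := isSphereTuple_odd_iff.1 (isSphereTuple_x.map φ)
  have hψz : ∀ z, ψ z (x 0) = 0 := fun z => (isSphereTuple_x.map (ψ z)).zero trivial
  rcases exists_standardBasis hq hc hr (fun W hW h1 h2 h3 h4 => hφ.2 W hW (forall_mem_of_gen
    (fun i w hw => by
      induction i using Fin.cases with
      | zero => rw [hzero]; exact W.zero_mem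
      | succ i =>
        induction i using Fin.cases with
        | zero => exact h1 w hw
        | succ i => exact h3 i w hw)
    (fun i w hw => by
      induction i using Fin.cases with
      | zero => rw [hzero, star_zero]; exact W.zero_mem
      | succ i =>
        induction i using Fin.cases with
        | zero => exact h2 w hw
        | succ i => exact h4 i w hw))) with h0 | ⟨b, D, z, hz, hst, hT⟩
  · left
    refine ⟨Nat.one_le_iff_ne_zero.2 ?_, exists_comp_oddToOdd φ h0⟩
    rintro rfl
    -- For `n = 0` the sphere relation reads `T^* T = 1`, so `T = 0` is impossible.
    simp [coreRadius, h0] at hr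
  · right
    have hzn : ‖z‖ = 1 := by
      have h1 := congrArg norm hz
      rw [norm_mul, norm_star, norm_one] at h1
      nlinarith [norm_nonneg z]
    obtain ⟨ζ, rfl⟩ : ∃ ζ : Circle, (ζ : ℂ) = z := ⟨⟨z, mem_sphere_zero_iff_norm.2 hzn⟩, rfl⟩
    have hT' : φ (x (0 : Fin (n + 1)).succ) = (ζ : ℂ) • D := hT
    have hψ0' : ∀ w, ψ w (x (0 : Fin (n + 1)).succ) = (w : ℂ) • D' := hψ0
    obtain ⟨hD, hY, hY'⟩ := hst.intertwines h'
    refine ⟨ζ, unitarilyEquivalent_of_gen (b.repr.trans b'.repr.symm) (fun i v => ?_) fun i v => ?_⟩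
    · induction i using Fin.cases with
      | zero => rw [hzero, hψz]; simp
      | succ i =>
        induction i using Fin.cases with
        | zero => rw [hT', hψ0', smul_apply, smul_apply, map_smul, hD]
        | succ i => rw [hψ]; exact hY i v
    · induction i using Fin.cases with
      | zero => rw [hzero, hψz]; simp
      | succ i =>
        induction i using Fin.cases with
        | zero =>
          rw [hT', hψ0', star_smul, star_smul, hst.star_diag, h'.star_diag, smul_apply,
            smul_apply, map_smul, hD]
        | succ i => rw [hψ]; exact hY' i v

end UnitaryEquivalence

end QuantumSphere

namespace QuantumSphere

open SphereAlgebra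

/-! ### The irreducible representations -/

theorem exists_even_irreducibles {q : ℝ} (hq : 1 < |q|) (n : ℕ) :
    ∃ ψ : ℤˣ → HilbertRep (EvenSphere q n) (Fock n),
      (∀ ε, IsEvenPsi q n ε (ψ ε) ∧ IsIrreducibleRep (ψ ε) ∧
        ¬ FactorsThrough (ψ ε) (evenToOdd q n)) ∧
      (∀ ε ε', UnitarilyEquivalent (ψ ε) (ψ ε') → ε = ε') ∧
      ∀ (H : Type u) [NormedAddCommGroup H] [InnerProductSpace ℂ H] [CompleteSpace H]
        (φ : HilbertRep (EvenSphere q n) H), IsIrreducibleRep φ →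
          FactorsThrough φ (evenToOdd q n) ∨ ∃ ε, UnitarilyEquivalent φ (ψ ε) := by
  obtain ⟨D, Y, h⟩ := exists_isStandardTuple hq (fockBasis n)
  choose ψ hψ0 hψ using exists_evenRep hq h
  refine ⟨ψ, fun ε => ⟨isEvenPsi_of_standard h (hψ0 ε) (hψ ε), h.isIrreducibleRep hq (ψ ε) (hψ ε),
    not_factorsThrough_evenToOdd h (right_ne_zero_of_mul_eq_one (star_units_mul ε)) (hψ0 ε)⟩,
    fun ε ε' hU => ?_, fun H _ _ _ φ hφ => even_classification hq h hψ0 hψ hφ⟩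
  have := h.eq_of_unitarilyEquivalent hq h (hψ ε) (hψ ε') (hψ0 ε) (hψ0 ε') hU
  exact Units.ext (by exact_mod_cast this)

theorem exists_odd_irreducibles {q : ℝ} (hq : 1 < |q|) (n : ℕ) :
    ∃ ψ : Circle → HilbertRep (OddSphere q (n + 1)) (Fock n),
      (∀ z, IsOddPsi q n z (ψ z) ∧ IsIrreducibleRep (ψ z) ∧
        ¬ FactorsThrough (ψ z) (oddToOdd q n)) ∧
      (∀ z z', UnitarilyEquivalent (ψ z) (ψ z') → z = z') ∧
      ∀ (H : Type u) [NormedAddCommGroup H] [InnerProductSpace ℂ H] [CompleteSpace H]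
        (φ : HilbertRep (OddSphere q (n + 1)) H), IsIrreducibleRep φ →
          (1 ≤ n ∧ FactorsThrough φ (oddToOdd q n)) ∨ ∃ z, UnitarilyEquivalent φ (ψ z) := by
  obtain ⟨D, Y, h⟩ := exists_isStandardTuple hq (fockBasis n)
  choose ψ hψ0 hψ using exists_oddRep hq h
  refine ⟨ψ, fun z => ⟨isOddPsi_of_standard h (hψ0 z) (hψ z), h.isIrreducibleRep hq (ψ z) (hψ z),
    not_factorsThrough_oddToOdd h (right_ne_zero_of_mul_eq_one (star_circle_mul z)) (hψ0 z)⟩,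
    fun z z' hU => ?_, fun H _ _ _ φ hφ => odd_classification hq h hψ0 hψ hφ⟩
  exact Circle.ext (h.eq_of_unitarilyEquivalent hq h (hψ z) (hψ z') (hψ0 z) (hψ0 z') hU)

end QuantumSphere

namespace QuantumSphere

open Filter Topology
open scoped ComplexOrder

/-! ### General facts on `*`-homomorphisms of `C^*`-algebras -/

section General

variable {A B : Type*} [CStarAlgebra A] [CStarAlgebra B]

/-- A `*`-homomorphism that is dominated by a `*`-homomorphism with dense range extends. -/
theorem exists_starAlgHom_extension {S : Type*} [Ring S] [Algebra ℂ S] [StarRing S]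
    {ι : S →⋆ₐ[ℂ] A} (hι : DenseRange ι) {φ : S →⋆ₐ[ℂ] B} (h : ∀ a, ‖φ a‖ ≤ ‖ι a‖) :
    ∃ Φ : A →⋆ₐ[ℂ] B, ∀ a, Φ (ι a) = φ a := by
  let ιl : S →ₗ[ℂ] A := ι.toAlgHom.toLinearMap
  let φl : S →ₗ[ℂ] B := φ.toAlgHom.toLinearMap
  have hd : DenseRange ιl := hι
  have hE : ∀ a, φl.extendOfNorm ιl (ι a) = φ a :=
    LinearMap.extendOfNorm_eq (f := φl) hd ⟨1, fun a => (one_mul ‖ι a‖).symm ▸ h a⟩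
  set E := φl.extendOfNorm ιl
  refine ⟨⟨⟨⟨⟨⟨E, ?_⟩, ?_⟩, map_zero E, map_add E⟩, ?_⟩, ?_⟩, hE⟩
  · change E 1 = 1
    rw [← map_one ι, hE, map_one]
  · intro x y
    change E (x * y) = E x * E y
    refine hι.induction_on₂ (p := fun x y => E (x * y) = E x * E y)
      (isClosed_eq (by fun_prop) (by fun_prop)) (fun a b => ?_) x y
    rw [← map_mul, hE, hE, hE, map_mul]
  · intro c
    change E (algebraMap ℂ A c) = algebraMap ℂ B c
    have h1 : ι (algebraMap ℂ S c) = algebraMap ℂ A c := AlgHomClass.commutes ι c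
    have h2 : φ (algebraMap ℂ S c) = algebraMap ℂ B c := AlgHomClass.commutes φ c
    rw [← h1, hE, h2]
  · intro x
    change E (star x) = star (E x)
    refine hι.induction_on (p := fun x => E (star x) = star (E x)) x
      (isClosed_eq (by fun_prop) (by fun_prop)) fun a => ?_
    rw [← map_star, hE, hE, map_star]

theorem continuous_starAlgHom (f : A →⋆ₐ[ℂ] B) : Continuous f :=
  AddMonoidHomClass.continuous_of_bound f 1 fun x => by
    rw [one_mul]; exact NonUnitalStarAlgHom.norm_apply_le f x

/-- Clamp `x` to `[-‖f x‖, ‖f x‖]` by functional calculus. The spectrum of `f x` already lies in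
this interval, so the image is unchanged. -/
theorem exists_preimage_norm_le_of_isSelfAdjoint (f : A →⋆ₐ[ℂ] B) {x : A} (hx : IsSelfAdjoint x) :
    ∃ y, f y = f x ∧ ‖y‖ ≤ ‖f x‖ := by
  have hfx : IsSelfAdjoint (f x) := hx.map f
  let g : ℝ → ℝ := fun t => max (-‖f x‖) (min ‖f x‖ t)
  have hg : Continuous g := by fun_prop
  refine ⟨cfc g x, ?_, ?_⟩
  · have hfc : Continuous f := continuous_starAlgHom f
    rw [StarAlgHomClass.map_cfc f g x (by fun_prop) hfc hx hfx]
    conv_rhs => rw [← cfc_id ℝ (f x)]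
    refine cfc_congr fun t ht => ?_
    have := abs_le.1 (IsometricContinuousFunctionalCalculus.norm_spectrum_le (𝕜 := ℝ) (f x) ht hfx)
    simp only [g, id]
    rw [min_eq_right this.2, max_eq_right this.1]
  · refine norm_cfc_le (norm_nonneg _) fun t _ => ?_
    rw [Real.norm_eq_abs, abs_le]
    exact ⟨le_max_left _ _, max_le (by linarith [norm_nonneg (f x)]) (min_le_left _ _)⟩

/-- Lifting real and imaginary parts with norm control gives each `f x` a preimage of norm at most
`2 ‖f x‖`. By completeness of `A` this bound passes to the closure of the range. -/
theorem surjective_of_denseRange {f : A →⋆ₐ[ℂ] B} (hf : DenseRange f) : Function.Surjective f := by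
  let F : NormedAddGroupHom A B := (f : A →+ B).mkNormedAddGroupHom 1
    fun x => by rw [one_mul]; exact NonUnitalStarAlgHom.norm_apply_le f x
  have hF : ∀ x, F x = f x := fun _ => rfl
  have h1 : F.SurjectiveOnWith (f : A →+ B).range 2 := by
    rintro _ ⟨x, rfl⟩
    have hfx : ((f : A →+ B) x : B) = f x := rfl
    obtain ⟨y, hy, hyn⟩ := exists_preimage_norm_le_of_isSelfAdjoint f (realPart x).2
    obtain ⟨z, hz, hzn⟩ := exists_preimage_norm_le_of_isSelfAdjoint f (imaginaryPart x).2
    have hr : ‖f (realPart x : A)‖ ≤ ‖f x‖ := by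
      have : f (realPart x : A) = (realPart (f x) : B) := by
        rw [realPart_apply_coe, realPart_apply_coe, ← Complex.coe_smul, map_smul, map_add,
          map_star, Complex.coe_smul]
      rw [this]
      exact realPart.norm_le (f x)
    have hi : ‖f (imaginaryPart x : A)‖ ≤ ‖f x‖ := by
      have : f (imaginaryPart x : A) = (imaginaryPart (f x) : B) := by
        rw [imaginaryPart_apply_coe, imaginaryPart_apply_coe, ← Complex.coe_smul, map_smul,
          map_smul, map_sub, map_star, Complex.coe_smul]
      rw [this]
      exact imaginaryPart.norm_le (f x)
    refine ⟨y + Complex.I • z, ?_, ?_⟩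
    · rw [hF, hfx, map_add, map_smul, hy, hz, ← map_smul, ← map_add,
        realPart_add_I_smul_imaginaryPart]
    · rw [hfx]
      refine (norm_add_le _ _).trans ?_
      rw [norm_smul, Complex.norm_I, one_mul]
      linarith
  intro b
  obtain ⟨a, ha, -⟩ := controlled_closure_of_complete two_pos one_pos h1 b (hf b)
  exact ⟨a, ha⟩

/-- A unital `*`-homomorphism obtained from vector states along an ultrafilter, by the
Gelfand-Naimark-Segal construction. -/
theorem exists_gns_of_ultrafilter {A : Type u} [CStarAlgebra A] {H : Type*} [NormedAddCommGroup H]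
    [InnerProductSpace ℂ H] [CompleteSpace H] [Nontrivial H] {ι : Type*} (U : Ultrafilter ι)
    (R : ι → A →⋆ₐ[ℂ] (H →L[ℂ] H)) (w : ι → H) {C : ℝ} (hw : ∀ i, ‖w i‖ ≤ C) :
    ∃ (K : Type u) (_ : NormedAddCommGroup K) (_ : InnerProductSpace ℂ K) (_ : CompleteSpace K)
      (ρ : A →⋆ₐ[ℂ] (K →L[ℂ] K)) (ξ : K), (DenseRange fun a => ρ a ξ) ∧
      ∀ a, Tendsto (fun i => ‖R i a (w i)‖ ^ 2) U (𝓝 (‖ρ a ξ‖ ^ 2)) := by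
  let _ := CStarAlgebra.spectralOrder A
  have := CStarAlgebra.spectralOrderedRing A
  have hlim : ∀ a, ∃ z : ℂ, Tendsto (fun i => inner ℂ (w i) (R i a (w i))) U (𝓝 z) := by
    intro a
    -- The vector functionals at `a` stay in a fixed compact disc, so they converge along the
    -- ultrafilter.
    obtain ⟨z, -, hz⟩ := isCompact_iff_ultrafilter_le_nhds'.1
      (isCompact_closedBall (0 : ℂ) (C * (‖a‖ * C)))
      (U.map fun i => inner ℂ (w i) (R i a (w i))) (by
        refine Ultrafilter.mem_map.2 (Filter.univ_mem' fun i => ?_)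
        refine mem_closedBall_zero_iff.2 ((norm_inner_le_norm _ _).trans ?_)
        have h1 : ‖R i a (w i)‖ ≤ ‖a‖ * C := ((R i a).le_opNorm _).trans
          (mul_le_mul (NonUnitalStarAlgHom.norm_apply_le (R i) a) (hw i) (norm_nonneg _)
            (norm_nonneg _))
        exact mul_le_mul (hw i) h1 (norm_nonneg _) ((norm_nonneg _).trans (hw i)))
    exact ⟨z, hz⟩
  choose f hf using hlim
  let fl : A →ₗ[ℂ] ℂ :=
    { toFun := f
      map_add' := fun a b => tendsto_nhds_unique (hf (a + b)) (by
        simpa [inner_add_right] using (hf a).add (hf b))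
      map_smul' := fun c a => tendsto_nhds_unique (hf (c • a)) (by
        simpa [inner_smul_right] using (hf a).const_mul c) }
  have hsq : ∀ i a, inner ℂ (w i) (R i (star a * a) (w i)) = ((‖R i a (w i)‖ ^ 2 : ℝ) : ℂ) := by
    intro i a
    rw [map_mul, map_star, mul_apply_eq_comp, ContinuousLinearMap.star_eq_adjoint,
      ContinuousLinearMap.adjoint_inner_right, inner_self_eq_norm_sq_to_K]
    simp
  have hpos : ∀ a, 0 ≤ a → 0 ≤ fl a := by
    intro a ha
    obtain ⟨b, rfl⟩ := CStarAlgebra.nonneg_iff_eq_star_mul_self.1 ha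
    refine ge_of_tendsto' (hf (star b * b)) fun i => ?_
    rw [hsq]
    exact Complex.zero_le_real.2 (sq_nonneg _)
  let F : A →ₚ[ℂ] ℂ := PositiveLinearMap.mk₀ fl hpos
  have hF : ∀ a, F a = f a := fun _ => rfl
  have hcoe : ∀ a, F.gnsStarAlgHom a ((F.toPreGNS 1 : F.PreGNS) : F.GNS) =
      ((F.toPreGNS a : F.PreGNS) : F.GNS) := fun a => by
    change F.gnsNonUnitalStarAlgHom a _ = _
    rw [PositiveLinearMap.gnsNonUnitalStarAlgHom_apply_coe]
    change ((F.toPreGNS (a * 1) : F.PreGNS) : F.GNS) = _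
    rw [mul_one]
  refine ⟨F.GNS, inferInstance, inferInstance, inferInstance, F.gnsStarAlgHom,
    ((F.toPreGNS 1 : F.PreGNS) : F.GNS), ?_, fun a => ?_⟩
  · simp only [hcoe]
    exact (UniformSpace.Completion.denseRange_coe (α := F.PreGNS)).comp
      F.toPreGNS.surjective.denseRange (UniformSpace.Completion.continuous_coe _)
  · rw [hcoe, UniformSpace.Completion.norm_coe]
    have h1 : (((‖F.toPreGNS a‖ ^ 2 : ℝ)) : ℂ) = f (star a * a) := by
      push_cast
      exact F.preGNS_norm_sq _
    have h2 := (Complex.continuous_re.tendsto _).comp (hf (star a * a))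
    rw [← h1] at h2
    simpa only [Function.comp_def, hsq, Complex.ofReal_re] using h2

/-- If `a c_m` does not tend to zero, while `T c_m` does, then some cyclic representation kills
the cyclic vector by `T`, but not by `a`. -/
theorem exists_cyclic_of_not_tendsto {A : Type u} [CStarAlgebra A] {H : Type*}
    [NormedAddCommGroup H] [InnerProductSpace ℂ H] [CompleteSpace H] [Nontrivial H] {I : Type*}
    {R : I → A →⋆ₐ[ℂ] (H →L[ℂ] H)} (hR : ∀ a, ∀ C < ‖a‖, ∃ i, C < ‖R i a‖) {T a : A} {c : ℕ → A}
    (hc : ∀ m, ‖c m‖ ≤ 1) (hT : Tendsto (fun m => ‖T * c m‖) atTop (𝓝 0))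
    (ha : ¬ Tendsto (fun m => ‖a * c m‖) atTop (𝓝 0)) :
    ∃ (K : Type u) (_ : NormedAddCommGroup K) (_ : InnerProductSpace ℂ K) (_ : CompleteSpace K)
      (ρ : A →⋆ₐ[ℂ] (K →L[ℂ] K)) (ξ : K), (DenseRange fun a => ρ a ξ) ∧ ρ T ξ = 0 ∧
      ρ a ξ ≠ 0 := by
  obtain ⟨ε, hε, hfreq⟩ : ∃ ε > 0, ∃ᶠ m in atTop, ε < ‖a * c m‖ := by
    by_contra! h
    refine ha (tendsto_order.2 ⟨fun x hx => Eventually.of_forall fun m => hx.trans_le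
      (norm_nonneg _), fun x hx => ?_⟩)
    have := h (x / 2) (half_pos hx)
    filter_upwards [this] with m hm
    linarith
  -- Whenever `‖a c_m‖ > ε`, some representation and some vector `v` of the unit ball detect it. The
  -- vectors `R(c_m) v` are the ones fed into GNS.
  have hex : ∀ m, ∃ (i : I) (v : H), ‖v‖ ≤ 1 ∧ (ε < ‖a * c m‖ → ε < ‖R i (a * c m) v‖) := by
    intro m
    by_cases h : ε < ‖a * c m‖
    · obtain ⟨i, hi⟩ := hR _ _ h
      obtain ⟨v, hv, hv'⟩ := (R i (a * c m)).exists_lt_apply_of_lt_opNorm hi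
      exact ⟨i, v, hv.le, fun _ => hv'⟩
    · obtain ⟨i, -⟩ := hR (1 : A) (-1) (by linarith [norm_nonneg (1 : A)])
      exact ⟨i, 0, by simp, fun h' => (h h').elim⟩
  choose i v hv hav using hex
  have hRn : ∀ m b, ‖R (i m) b‖ ≤ ‖b‖ := fun m b => NonUnitalStarAlgHom.norm_apply_le (R (i m)) b
  have : (atTop ⊓ 𝓟 {m | ε < ‖a * c m‖} : Filter ℕ).NeBot := frequently_mem_iff_neBot.1 hfreq
  -- The ultrafilter tends to infinity, which sends `T c_m` to zero, and lives on the indices where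
  -- `a c_m` stays above `ε`.
  let U := Ultrafilter.of (atTop ⊓ 𝓟 {m | ε < ‖a * c m‖})
  have hU : (U : Filter ℕ) ≤ atTop ⊓ 𝓟 {m | ε < ‖a * c m‖} := Ultrafilter.of_le _
  obtain ⟨K, _, _, _, ρ, ξ, hd, hρ⟩ := exists_gns_of_ultrafilter U (fun m => R (i m))
    (fun m => R (i m) (c m) (v m)) (C := 1) fun m => ((R (i m) (c m)).le_opNorm _).trans
      (mul_le_one₀ ((hRn m _).trans (hc m)) (norm_nonneg _) (hv m))
  refine ⟨K, _, _, _, ρ, ξ, hd, ?_, fun h0 => ?_⟩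
  · have h1 : Tendsto (fun m => ‖R (i m) T (R (i m) (c m) (v m))‖ ^ 2) U (𝓝 0) := by
      have h2 : Tendsto (fun m => ‖T * c m‖ ^ 2) U (𝓝 0) := by
        simpa using (hT.mono_left (hU.trans inf_le_left)).pow 2
      refine squeeze_zero (fun m => sq_nonneg _) (fun m => ?_) h2
      refine pow_le_pow_left₀ (norm_nonneg _) ?_ 2
      rw [← mul_apply_eq_comp, ← map_mul]
      calc _ ≤ ‖R (i m) (T * c m)‖ * ‖v m‖ := (R (i m) (T * c m)).le_opNorm _
        _ ≤ ‖T * c m‖ * 1 := mul_le_mul (hRn m _) (hv m) (norm_nonneg _) (norm_nonneg _)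
        _ = _ := mul_one _
    have := tendsto_nhds_unique (hρ T) h1
    simpa using this
  · have h1 := hρ a
    rw [h0, norm_zero, zero_pow two_ne_zero] at h1
    have h2 : ∀ᶠ m in (U : Filter ℕ), ε ^ 2 ≤ ‖R (i m) a (R (i m) (c m) (v m))‖ ^ 2 := by
      have : ∀ᶠ m in (U : Filter ℕ), ε < ‖a * c m‖ :=
        hU.trans inf_le_right (mem_principal_self _)
      filter_upwards [this] with m hm
      refine pow_le_pow_left₀ hε.le ?_ 2
      rw [← mul_apply_eq_comp, ← map_mul]
      exact (hav m hm).le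
    exact absurd (ge_of_tendsto h1 h2) (not_le.2 (by positivity))

end General

end QuantumSphere

namespace QuantumSphere

open SphereAlgebra TopologicalSpace

/-! ### Separable representations and the universal norm -/

section Separable

/-- Orthonormal vectors lie at distance `√2`, so balls of radius `1/2` around them are disjoint. -/
theorem countable_of_orthonormal {K ι : Type*} [NormedAddCommGroup K] [InnerProductSpace ℂ K]
    [SeparableSpace K] {v : ι → K} (hv : Orthonormal ℂ v) : Countable ι := by
  refine Pairwise.countable_of_isOpen_disjoint (s := fun i => Metric.ball (v i) 2⁻¹) ?_
    (fun i => Metric.isOpen_ball) fun i => ⟨v i, Metric.mem_ball_self (by norm_num)⟩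
  intro i j hij
  refine Metric.ball_disjoint_ball ?_
  have h1 : ‖v i - v j‖ ^ 2 = 2 := by
    rw [@norm_sub_sq ℂ, hv.1, hv.1, hv.2 hij]
    norm_num
  rw [dist_eq_norm]
  nlinarith [norm_nonneg (v i - v j)]

theorem exists_linearIsometry_ellTwo (K : Type*) [NormedAddCommGroup K] [InnerProductSpace ℂ K]
    [CompleteSpace K] [SeparableSpace K] : Nonempty (K →ₗᵢ[ℂ] EllTwo) := by
  obtain ⟨w, b, -⟩ := exists_hilbertBasis ℂ K
  have := countable_of_orthonormal b.orthonormal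
  obtain ⟨f, hf⟩ := exists_injective_nat w
  let b' : HilbertBasis ℕ ℂ EllTwo := HilbertBasis.ofRepr (LinearIsometryEquiv.refl ℂ _)
  exact ⟨(b'.orthonormal.comp f hf).orthogonalFamily.linearIsometry.comp b.repr.toLinearIsometry⟩

variable {q : ℝ} {n : ℕ} {odd : Prop}

/-- The words in the finitely many letters span. -/
theorem SphereAlgebra.exists_countable_span :
    ∃ s : Set (SphereAlgebra q n odd), s.Countable ∧ Submodule.span ℂ s = ⊤ := by
  let b := FreeAlgebra.basisFreeMonoid ℂ (Fin (n + 1) ⊕ Fin (n + 1))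
  let f : FreeAlgebra ℂ (Fin (n + 1) ⊕ Fin (n + 1)) →ₗ[ℂ] SphereAlgebra q n odd :=
    (mk (q := q) (odd := odd)).toLinearMap
  have : Countable (FreeMonoid (Fin (n + 1) ⊕ Fin (n + 1))) :=
    inferInstanceAs (Countable (List _))
  refine ⟨f '' Set.range b, (Set.countable_range b).image f, ?_⟩
  rw [Submodule.span_image, b.span_eq, Submodule.map_top]
  exact LinearMap.range_eq_top.2 mk_surjective

variable {K : Type*} [NormedAddCommGroup K] [InnerProductSpace ℂ K] [CompleteSpace K]

theorem separableSpace_of_cyclic (φ : HilbertRep (SphereAlgebra q n odd) K) {ξ : K}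
    (h : DenseRange fun a => φ a ξ) : SeparableSpace K := by
  obtain ⟨s, hs, hs'⟩ := SphereAlgebra.exists_countable_span (q := q) (n := n) (odd := odd)
  let f : SphereAlgebra q n odd →ₗ[ℂ] K :=
    { toFun := fun a => φ a ξ
      map_add' := fun a b => by rw [map_add, add_apply]
      map_smul' := fun c a => by rw [map_smul, smul_apply]; rfl }
  have h1 : (Set.range fun a => φ a ξ) = (Submodule.span ℂ (f '' s) : Set K) := by
    rw [Submodule.span_image, hs', Submodule.map_top]
    rfl
  have h2 : IsSeparable (Set.range fun a => φ a ξ) := by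
    rw [h1]
    exact (hs.image f).isSeparable.span
  rw [← isSeparable_univ_iff, ← h.closure_range]
  exact h2.closure

/-- The character of `A(S_q^{2n-1})` at the point `x_n = 1`, `x_i = 0` for `i < n`. -/
theorem exists_character (hn : 1 ≤ n) : Nonempty (OddSphere q n →⋆ₐ[ℂ] ℂ) := by
  have h0 : (0 : Fin (n + 1)) ≠ Fin.last n := by
    rw [Ne, Fin.ext_iff]
    simp
    omega
  have hne : ∀ i : Fin n, i.castSucc ≠ Fin.last n := fun i => (Fin.castSucc_lt_last i).ne
  have hp : ∀ (i : Fin (n + 1)), partialRadius (Pi.single (Fin.last n) (1 : ℂ)) i =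
      if i = Fin.last n then 1 else 0 := by
    intro i
    rw [partialRadius, Pi.single_eq_of_ne h0]
    split_ifs with h
    · subst h
      rw [Finset.sum_eq_single (Fin.last n)]
      · simp
      · intro j _ hj
        simp [hj]
      · intro h
        exact (h (Finset.mem_Ioc.2 ⟨lt_of_le_of_ne (Fin.zero_le _) h0, le_rfl⟩)).elim
    · rw [Finset.sum_eq_zero]
      · simp
      · intro j hj
        have : j ≠ Fin.last n := fun hj' => h (Fin.last_le_iff.1 (hj' ▸ (Finset.mem_Ioc.1 hj).2))
        simp [this]
  have hor : ∀ i j : Fin (n + 1), i ≠ j → i ≠ Fin.last n ∨ j ≠ Fin.last n := by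
    intro i j hij
    by_contra! h
    exact hij (h.1.trans h.2.symm)
  refine ⟨SphereAlgebra.lift (Pi.single (Fin.last n) 1) ⟨?_, fun _ => ?_, ?_, ?_, ?_, ?_⟩⟩
  · rw [Pi.single_eq_of_ne h0, star_zero]
  · rw [Pi.single_eq_of_ne h0]
  · intro i j hij
    rcases hor i j hij.ne with h | h <;> simp [h]
  · intro i j hij
    rcases hor i j hij with h | h <;> simp [h]
  · intro i
    rw [hp, if_neg (hne i), mul_comm, sub_self, smul_zero]
  · rw [hp, if_pos rfl]

/-- A separable representation of `A(S_q^{2n-1})` is a direct summand of one on `ℓ²(ℕ)`. -/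
theorem exists_ellTwoRep_norm_ge [SeparableSpace K] (hn : 1 ≤ n) (ρ : HilbertRep (OddSphere q n) K) :
    ∃ σ : HilbertRep (OddSphere q n) EllTwo, ∀ a, ‖ρ a‖ ≤ ‖σ a‖ := by
  obtain ⟨V₀⟩ := exists_linearIsometry_ellTwo K
  obtain ⟨χ⟩ := exists_character (q := q) hn
  let V : K →L[ℂ] EllTwo := V₀.toContinuousLinearMap
  let W : EllTwo →L[ℂ] K := ContinuousLinearMap.adjoint V
  have hVW : W ∘L V = 1 := by
    refine ContinuousLinearMap.ext fun v => ext_inner_right ℂ fun w => ?_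
    rw [ContinuousLinearMap.comp_apply, ContinuousLinearMap.adjoint_inner_left]
    exact V₀.inner_map_map v w
  have hWV : ∀ v, W (V v) = v := fun v => congrArg (fun S : K →L[ℂ] K => S v) hVW
  let p : EllTwo →L[ℂ] EllTwo := 1 - V ∘L W
  have hpV : ∀ v, p (V v) = 0 := fun v => by
    simp only [p, sub_apply, ContinuousLinearMap.comp_apply, hWV, one_apply_eq_self, sub_self]
  have hWp : ∀ v, W (p v) = 0 := fun v => by
    simp only [p, sub_apply, ContinuousLinearMap.comp_apply, one_apply_eq_self, map_sub, hWV,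
      sub_self]
  have hpp : ∀ v, p (p v) = p v := fun v => by
    conv_lhs => rw [show p (p v) = p v - V (W (p v)) from rfl]
    rw [hWp, map_zero, sub_zero]
  have hps : star p = p := by
    simp only [p, star_sub, star_one, ContinuousLinearMap.star_eq_adjoint,
      ContinuousLinearMap.adjoint_comp, W, ContinuousLinearMap.adjoint_adjoint]
  -- On the complement of the embedded copy of `K` the algebra acts by the character, which keeps
  -- the representation unital.
  let s : OddSphere q n → (EllTwo →L[ℂ] EllTwo) := fun a => V ∘L ρ a ∘L W + χ a • p
  have hs : ∀ a v, s a v = V (ρ a (W v)) + χ a • p v := fun a v => rfl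
  refine ⟨⟨⟨⟨⟨⟨s, ?_⟩, ?_⟩, ?_, ?_⟩, ?_⟩, ?_⟩, fun a => ?_⟩
  · ext1 v
    rw [hs, map_one, map_one, one_smul]
    simp [p]
  · intro a b
    ext1 v
    change s (a * b) v = s a (s b v)
    simp only [hs, map_mul, map_add, map_smul, hWV, hpV, hWp, hpp, smul_zero, mul_apply_eq_comp,
      add_zero, zero_add, mul_smul]
  · ext1 v
    change s 0 v = 0
    rw [hs, map_zero, map_zero, zero_apply, map_zero, zero_smul, add_zero]
  · intro a b
    ext1 v
    change s (a + b) v = s a v + s b v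
    simp only [hs, map_add, add_apply, add_smul]
    abel
  · intro c
    ext1 v
    change s (algebraMap ℂ _ c) v = algebraMap ℂ (EllTwo →L[ℂ] EllTwo) c v
    rw [hs, AlgHomClass.commutes, AlgHomClass.commutes, Algebra.algebraMap_eq_smul_one,
      Algebra.algebraMap_eq_smul_one, Algebra.algebraMap_eq_smul_one]
    simp [p, smul_sub]
  · intro a
    change s (star a) = star (s a)
    simp only [s, map_star, star_add, star_smul, hps, ContinuousLinearMap.star_eq_adjoint,
      ContinuousLinearMap.adjoint_comp, W, ContinuousLinearMap.adjoint_adjoint]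
    rfl
  · change ‖ρ a‖ ≤ ‖s a‖
    refine ContinuousLinearMap.opNorm_le_bound _ (norm_nonneg _) fun v => ?_
    calc ‖ρ a v‖ = ‖s a (V v)‖ := by
          rw [hs, hWV, hpV, smul_zero, add_zero]
          exact (V₀.norm_map _).symm
      _ ≤ ‖s a‖ * ‖V v‖ := (s a).le_opNorm _
      _ = ‖s a‖ * ‖v‖ := congrArg _ (V₀.norm_map v)

end Separable

section UniversalNorm

variable {q : ℝ} {n : ℕ} {odd : Prop}

theorem denseRange_toC : DenseRange (toC q n odd) := by
  intro x
  have h1 : (Subtype.val '' Set.range (toC q n odd)) = Set.range (universalRep q n odd) := by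
    ext y
    exact ⟨fun ⟨_, ⟨a, ha⟩, hy⟩ => ⟨a, by rw [← hy, ← ha]; rfl⟩, fun ⟨a, ha⟩ => ⟨_, ⟨a, rfl⟩, ha⟩⟩
  have h2 : (x.1 : BoundedFamilies _ _) ∈ closure (Subtype.val '' Set.range (toC q n odd)) := by
    rw [h1]
    exact x.2
  exact closure_subtype.2 h2

theorem norm_toC_le {a : SphereAlgebra q n odd} {C : ℝ} (hC : 0 ≤ C)
    (h : ∀ ψ : HilbertRep (SphereAlgebra q n odd) EllTwo, ‖ψ a‖ ≤ C) : ‖toC q n odd a‖ ≤ C :=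
  lp.norm_le_of_forall_le hC h

/-- Evaluation of elements of the completion in a representation. -/
theorem exists_evalRep [Nonempty (HilbertRep (SphereAlgebra q n odd) EllTwo)] :
    ∃ R : HilbertRep (SphereAlgebra q n odd) EllTwo → HilbertRep (CSphere q n odd) EllTwo,
      (∀ ψ a, R ψ (toC q n odd a) = ψ a) ∧ ∀ a, ∀ C < ‖a‖, ∃ ψ, C < ‖R ψ a‖ := by
  let ev : HilbertRep (SphereAlgebra q n odd) EllTwo → CSphere q n odd →
    (EllTwo →L[ℂ] EllTwo) := fun ψ a => a.1.1 ψ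
  refine ⟨fun ψ => ⟨⟨⟨⟨⟨ev ψ, rfl⟩, fun _ _ => rfl⟩, rfl, fun _ _ => rfl⟩, fun _ => rfl⟩,
    fun _ => rfl⟩, fun _ _ => rfl, fun a C hC => ?_⟩
  exact exists_lt_of_lt_ciSup hC

theorem norm_rep_le_toC (ψ : HilbertRep (SphereAlgebra q n odd) EllTwo)
    (a : SphereAlgebra q n odd) : ‖ψ a‖ ≤ ‖toC q n odd a‖ :=
  lp.norm_apply_le_norm ENNReal.top_ne_zero (universalRep q n odd a) ψ

theorem norm_rep_le_of_separable {K : Type*} [NormedAddCommGroup K] [InnerProductSpace ℂ K]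
    [CompleteSpace K] [SeparableSpace K] (hn : 1 ≤ n) (ρ : HilbertRep (OddSphere q n) K)
    (a : OddSphere q n) : ‖ρ a‖ ≤ ‖toC q n True a‖ := by
  obtain ⟨σ, hσ⟩ := exists_ellTwoRep_norm_ge hn ρ
  exact (hσ a).trans (norm_rep_le_toC σ a)

end UniversalNorm

end QuantumSphere

namespace QuantumSphere

open SphereAlgebra Filter Topology

/-! ### The quotient maps of the completions -/

section Quotient

variable {q : ℝ} {N n : ℕ} {odd : Prop}

/-- The quotient by the ideal generated by the element `t`, which commutes up to scalars with
all generators and their adjoints. -/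
structure IsVacuumQuotient (t : SphereAlgebra q N odd) (Q : SphereAlgebra q N odd →⋆ₐ[ℂ] OddSphere q n) :
    Prop where
  surjective : Function.Surjective Q
  map_eq_zero : Q t = 0
  factors : ∀ (K : Type) [NormedAddCommGroup K] [InnerProductSpace ℂ K] [CompleteSpace K]
    (φ : HilbertRep (SphereAlgebra q N odd) K), φ t = 0 → FactorsThrough φ Q
  mul_x : ∀ i, ∃ c : ℂ, t * x i = c • (x i * t)
  mul_star_x : ∀ i, ∃ c : ℂ, t * star (x i) = c • (star (x i) * t)

theorem surjective_of_forall_x {Q : SphereAlgebra q N odd →⋆ₐ[ℂ] OddSphere q n}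
    (h : ∀ i, ∃ a, Q a = x i) : Function.Surjective Q := by
  intro b
  induction b using SphereAlgebra.induct_gen with
  | hc c => exact ⟨algebraMap ℂ _ c, AlgHomClass.commutes Q c⟩
  | hx i => exact h i
  | hs i =>
    obtain ⟨a, ha⟩ := h i
    exact ⟨star a, by rw [map_star, ha]⟩
  | hm a b ha hb =>
    obtain ⟨a, rfl⟩ := ha
    obtain ⟨b, rfl⟩ := hb
    exact ⟨a * b, map_mul Q a b⟩
  | ha a b ha hb =>
    obtain ⟨a, rfl⟩ := ha
    obtain ⟨b, rfl⟩ := hb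
    exact ⟨a + b, map_add Q a b⟩

theorem IsCoreTuple.mul_star {A : Type*} [Ring A] [Algebra ℂ A] [StarRing A] [StarModule ℂ A]
    {q : ℝ} (hq : q ≠ 0) {T : A} {Y : Fin n → A} (h : IsCoreTuple q T Y) (i : Fin n) :
    T * star (Y i) = (q⁻¹ : ℂ) • (star (Y i) * T) := by
  have h1 := congrArg star (h.star_T_mul i)
  simp only [star_smul, star_mul, star_star, Complex.star_def, Complex.conj_ofReal] at h1
  rw [h1, smul_smul, inv_mul_cancel₀ (by exact_mod_cast hq), one_smul]

theorem isVacuumQuotient_even (hq : 1 < |q|) :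
    IsVacuumQuotient (x 0 : EvenSphere q n) (evenToOdd q n) := by
  have hq0 : q ≠ 0 := by rintro rfl; simp at hq; linarith
  obtain ⟨hc, hsa, -⟩ := isSphereTuple_even_iff.1 (isSphereTuple_x (q := q) (n := n) (odd := False))
  refine ⟨surjective_of_forall_x fun i => ⟨x i, evenToOdd_x i⟩, ?_,
    fun K _ _ _ φ h => exists_comp_evenToOdd φ h, fun i => ?_, fun i => ?_⟩
  · rw [evenToOdd_x]
    exact isSphereTuple_x.zero trivial
  · induction i using Fin.cases with
    | zero => exact ⟨1, by rw [one_smul]⟩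
    | succ i => exact ⟨q, hc.T_mul i⟩
  · induction i using Fin.cases with
    | zero => exact ⟨1, by rw [one_smul, hsa]⟩
    | succ i => exact ⟨_, hc.mul_star hq0 i⟩

theorem isVacuumQuotient_odd (hq : 1 < |q|) :
    IsVacuumQuotient (x 1 : OddSphere q (n + 1)) (oddToOdd q n) := by
  have hq0 : q ≠ 0 := by rintro rfl; simp at hq; linarith
  obtain ⟨hc, h0, -⟩ := isSphereTuple_odd_iff.1
    (isSphereTuple_x (q := q) (n := n + 1) (odd := True))
  have hx : (x 0 : OddSphere q n) = 0 := isSphereTuple_x.zero trivial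
  refine ⟨surjective_of_forall_x fun i => ⟨x i.succ, oddToOdd_x i.succ⟩, ?_,
    fun K _ _ _ φ h => exists_comp_oddToOdd φ h, fun i => ?_, fun i => ?_⟩
  · rw [oddToOdd_x]
    exact hx
  · induction i using Fin.cases with
    | zero => exact ⟨1, by rw [h0]; simp⟩
    | succ i =>
      induction i using Fin.cases with
      | zero => exact ⟨1, by rw [one_smul]; rfl⟩
      | succ i => exact ⟨q, hc.T_mul i⟩
  · induction i using Fin.cases with
    | zero => exact ⟨1, by rw [h0]; simp⟩
    | succ i =>
      induction i using Fin.cases with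
      | zero => exact ⟨1, by rw [one_smul]; exact hc.normal⟩
      | succ i => exact ⟨_, hc.mul_star hq0 i⟩

/-- The extension of the quotient map to the completions. -/
theorem exists_quotientMap {Q : SphereAlgebra q N odd →⋆ₐ[ℂ] OddSphere q n}
    (hQ : Function.Surjective Q) : ∃ π : CSphere q N odd →⋆ₐ[ℂ] COddSphere q n,
      (∀ a, π (toC q N odd a) = toC q n True (Q a)) ∧ Function.Surjective π := by
  obtain ⟨π, hπ⟩ := exists_starAlgHom_extension (denseRange_toC (q := q) (n := N) (odd := odd))
    (φ := (toC q n True).comp Q)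
    fun a => norm_toC_le (norm_nonneg _) fun ψ => norm_rep_le_toC (ψ.comp Q) a
  refine ⟨π, hπ, surjective_of_denseRange ?_⟩
  refine (denseRange_toC (q := q) (n := n) (odd := True)).mono ?_
  rintro _ ⟨b, rfl⟩
  obtain ⟨a, rfl⟩ := hQ b
  exact ⟨_, hπ a⟩

/-- Elements of the kernel of the quotient map are compact relative to any approximate unit
for `t`. -/
theorem IsVacuumQuotient.tendsto (hn : 1 ≤ n) {t : SphereAlgebra q N odd}
    {Q : SphereAlgebra q N odd →⋆ₐ[ℂ] OddSphere q n} (h : IsVacuumQuotient t Q)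
    [Nonempty (HilbertRep (SphereAlgebra q N odd) EllTwo)]
    {π : CSphere q N odd →⋆ₐ[ℂ] COddSphere q n}
    (hπ : ∀ a, π (toC q N odd a) = toC q n True (Q a)) {c : ℕ → CSphere q N odd}
    (hc : ∀ m, ‖c m‖ ≤ 1) (ht : Tendsto (fun m => ‖toC q N odd t * c m‖) atTop (𝓝 0))
    {a : CSphere q N odd} (ha : π a = 0) : Tendsto (fun m => ‖a * c m‖) atTop (𝓝 0) := by
  by_contra hcon
  obtain ⟨R, -, hR⟩ := exists_evalRep (q := q) (n := N) (odd := odd)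
  obtain ⟨K, _, _, _, ρ, ξ, hd, hρt, hρa⟩ := exists_cyclic_of_not_tendsto hR hc ht hcon
  have hρc : Continuous ρ := continuous_starAlgHom ρ
  let φ : HilbertRep (SphereAlgebra q N odd) K := ρ.comp (toC q N odd)
  have hdφ : DenseRange fun a => φ a ξ := by
    have h1 := hd.comp (denseRange_toC (q := q) (n := N) (odd := odd))
      (hρc.clm_apply continuous_const)
    exact h1
  -- The kernel of `φ t` contains the cyclic vector and is invariant, because `t` commutes with the
  -- generators and their adjoints up to scalars.
  have hφt : φ t = 0 := by
    let W : Submodule ℂ K := LinearMap.ker (φ t).toLinearMap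
    have hW : ∀ w, w ∈ W ↔ φ t w = 0 := fun w => Iff.rfl
    have key : ∀ b, (∃ c : ℂ, t * b = c • (b * t)) → ∀ w ∈ W, φ b w ∈ W := by
      rintro b ⟨c, hb⟩ w hw
      rw [hW] at hw ⊢
      rw [← mul_apply_eq_comp, ← map_mul, hb, map_smul, map_mul, smul_apply, mul_apply_eq_comp, hw,
        map_zero, smul_zero]
    have h1 : ∀ b, φ b ξ ∈ W := fun b => forall_mem_of_gen (φ := φ)
      (fun i => key _ (h.mul_x i)) (fun i => by rw [← map_star]; exact key _ (h.mul_star_x i))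
      b ξ hρt
    refine ContinuousLinearMap.ext fun v => ?_
    refine hdφ.induction_on (p := fun v => φ t v = 0) v
      (isClosed_eq (φ t).continuous continuous_const) h1
  obtain ⟨φ', hφ'⟩ := h.factors K φ hφt
  have hdφ' : DenseRange fun b => φ' b ξ := by
    refine hdφ.mono ?_
    rintro _ ⟨b, rfl⟩
    exact ⟨Q b, by rw [hφ']; rfl⟩
  have := separableSpace_of_cyclic φ' hdφ'
  -- The representation factors through the quotient algebra and is separable, so the universal norm
  -- of the quotient dominates it. As `π a = 0`, this contradicts `ρ a ξ ≠ 0`.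
  have hle : ∀ b, ‖ρ b‖ ≤ ‖π b‖ := fun b => by
    refine (denseRange_toC (q := q) (n := N) (odd := odd)).induction_on
      (p := fun b => ‖ρ b‖ ≤ ‖π b‖) b
      (isClosed_le hρc.norm (continuous_starAlgHom π).norm) fun b => ?_
    have h1 : ρ (toC q N odd b) = φ' (Q b) := congrArg (fun f => f b) hφ'
    rw [h1, hπ]
    exact norm_rep_le_of_separable hn φ' (Q b)
  have h1 := hle a
  rw [ha, norm_zero, norm_le_zero_iff] at h1
  exact hρa (by rw [h1, zero_apply])

end Quotient

end QuantumSphere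

namespace QuantumSphere

/-! ### The corner of the vacuum projection -/

section Corner

variable {A : Type*} [CStarAlgebra A] {q : ℝ} {n : ℕ} {T : A} {Y : Fin n → A} {p₀ : A}
  {e : (Fin n → ℕ) → A}

namespace IsMatrixUnits

theorem star_p₀ (h : IsMatrixUnits q 1 T Y p₀ e) : star p₀ = p₀ := by
  have := h.star_mul 0 0
  rw [if_pos rfl, h.zero] at this
  rw [← this, StarMul.star_mul, star_star]

theorem p₀_mul_p₀ (h : IsMatrixUnits q 1 T Y p₀ e) : p₀ * p₀ = p₀ := by
  have := h.star_mul 0 0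
  rwa [if_pos rfl, h.zero, h.star_p₀] at this

theorem mul_p₀ (h : IsMatrixUnits q 1 T Y p₀ e) (k : Fin n → ℕ) : e k * p₀ = e k := by
  have h1 : star (e k * p₀ - e k) * (e k * p₀ - e k) = 0 := by
    have h2 := h.star_mul k k
    rw [if_pos rfl] at h2
    rw [star_sub, StarMul.star_mul, h.star_p₀, sub_mul, mul_sub, mul_sub, h2, mul_assoc,
      ← mul_assoc (star (e k)), h2, mul_assoc, h2]
    simp only [h.p₀_mul_p₀, sub_self]
  exact sub_eq_zero.1 ((CStarRing.star_mul_self_eq_zero_iff _).1 h1)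

theorem T_mul_p₀ (h : IsMatrixUnits q 1 T Y p₀ e) : T * p₀ = p₀ * T := by
  have := h.T_mul 0
  simpa [h.zero] using this

theorem star_T_mul_p₀ (h : IsMatrixUnits q 1 T Y p₀ e) : star T * p₀ = p₀ * star T := by
  have := h.star_T_mul 0
  simpa [h.zero] using this

theorem map {B : Type*} [CStarAlgebra B] (h : IsMatrixUnits q 1 T Y p₀ e) (f : A →⋆ₐ[ℂ] B) :
    IsMatrixUnits q 1 (f T) (fun i => f (Y i)) (f p₀) (fun k => f (e k)) where
  star_mul k l := by
    rw [← map_star, ← map_mul, h.star_mul]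
    split_ifs <;> simp
  zero := by rw [h.zero]
  mul_e k := one_mul _
  T_mul k := by rw [← map_mul, h.T_mul, map_smul, map_mul]
  star_T_mul k := by rw [← map_star, ← map_mul, h.star_T_mul, map_smul, map_mul]
  star_T_mul_T := by rw [← map_star, ← map_mul, ← map_mul, h.star_T_mul_T]
  lower i k := by rw [← map_mul, h.lower, map_smul]
  raise i k := by rw [← map_star, ← map_mul, h.raise, map_smul]
  approx ε hε := by
    obtain ⟨F, hF⟩ := h.approx ε hε
    refine ⟨F, le_trans (le_of_eq_of_le ?_ (NonUnitalStarAlgHom.norm_apply_le f _)) hF⟩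
    simp only [map_mul, map_sub, map_one, map_sum, map_star]

/-- The unitary that extends the restriction of `T` to the vacuum projection. -/
theorem unitary_mem (h : IsMatrixUnits q 1 T Y p₀ e) (hn : T * star T = star T * T) :
    T * p₀ + (1 - p₀) ∈ unitary A := by
  have h1 : star (T * p₀ + (1 - p₀)) = p₀ * star T + (1 - p₀) := by
    rw [star_add, StarMul.star_mul, h.star_p₀, star_sub, star_one, h.star_p₀]
  have h2 : p₀ * star T * (T * p₀) = p₀ := by
    rw [mul_assoc, ← mul_assoc (star T), h.star_T_mul_T, h.p₀_mul_p₀]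
  have h3 : T * p₀ * (p₀ * star T) = p₀ := by
    rw [mul_assoc, ← mul_assoc p₀, h.p₀_mul_p₀, ← h.star_T_mul_p₀, ← mul_assoc, hn,
      h.star_T_mul_T]
  have h4 : p₀ * (1 - p₀) = 0 := by rw [mul_sub, mul_one, h.p₀_mul_p₀, sub_self]
  have h5 : (1 - p₀) * p₀ = 0 := by rw [sub_mul, one_mul, h.p₀_mul_p₀, sub_self]
  have h6 : (1 - p₀) * (1 - p₀) = 1 - p₀ := by rw [mul_sub, h5, mul_one, sub_zero]
  have h7 : p₀ * star T * (1 - p₀) = 0 := by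
    rw [← h.star_T_mul_p₀, mul_assoc, h4, mul_zero]
  have h8 : (1 - p₀) * (T * p₀) = 0 := by
    rw [h.T_mul_p₀, ← mul_assoc, h5, zero_mul]
  have h9 : T * p₀ * (1 - p₀) = 0 := by rw [mul_assoc, h4, mul_zero]
  have h10 : (1 - p₀) * (p₀ * star T) = 0 := by rw [← mul_assoc, h5, zero_mul]
  rw [Unitary.mem_iff, h1]
  constructor
  · rw [add_mul, mul_add, mul_add, h2, h7, h8, h6]
    abel
  · rw [add_mul, mul_add, mul_add, h3, h9, h10, h6]
    abel

end IsMatrixUnits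

/-- `χ` embeds the compact space `Ω` in the plane, so functions on `Ω` pull back along `χ⁻¹` to
functions on the spectrum of `W`. -/
theorem exists_functionalCalculus {Ω : Type*} [TopologicalSpace Ω] [CompactSpace Ω]
    {χ : C(Ω, ℂ)} (hχ : Function.Injective χ) {W : A} (hW : IsStarNormal W)
    (hs : spectrum ℂ W ⊆ Set.range χ) : ∃ γ : C(Ω, ℂ) →⋆ₐ[ℂ] A, γ χ = W := by
  have hemb : Topology.IsClosedEmbedding χ := χ.continuous.isClosedEmbedding hχ
  let τ : C(spectrum ℂ W, Ω) := ⟨fun z => hemb.isEmbedding.toHomeomorph.symm ⟨z, hs z.2⟩,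
    hemb.isEmbedding.toHomeomorph.symm.continuous.comp
      (continuous_subtype_val.subtype_mk _)⟩
  refine ⟨(cfcHom hW).comp (ContinuousMap.compStarAlgHom' ℂ ℂ τ), ?_⟩
  rw [StarAlgHom.comp_apply]
  have h1 : ContinuousMap.compStarAlgHom' ℂ ℂ τ χ =
      (ContinuousMap.id ℂ).restrict (spectrum ℂ W) := by
    ext z
    exact congrArg Subtype.val (hemb.isEmbedding.toHomeomorph.apply_symm_apply ⟨z, hs z.2⟩)
  rw [h1]
  exact cfcHom_id hW

end Corner

/-! ### Action of the abstract matrix units and of the corner on the vacuum vector. -/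

section Evaluate

variable {H : Type*} [NormedAddCommGroup H] [InnerProductSpace ℂ H] [CompleteSpace H] {q : ℝ}
  {n : ℕ} {b : HilbertBasis (Fin n → ℕ) ℂ H} {D : H →L[ℂ] H} {Y : Fin n → (H →L[ℂ] H)}
  {p₀ T : H →L[ℂ] H} {e : (Fin n → ℕ) → (H →L[ℂ] H)}

/-- The abstract `p₀` is supported where `D² = 1`, which is the line of `b 0`, and it is not zero
since `T ≠ 0`. So `p₀` fixes `b 0`, and the abstract and concrete raising formulas have the same
nonzero coefficients. -/
theorem IsStandardTuple.matrixUnit_apply (hq : 1 < |q|) (hD : IsStandardTuple q b D Y) {z : ℂ}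
    (hz : star z * z = 1) (h : IsMatrixUnits q 1 (z • D) Y p₀ e) (k : Fin n → ℕ) :
    e k (b 0) = b k := by
  have happ : ∀ {S S' : H →L[ℂ] H} (v : H), S = S' → S v = S' v := fun v hv => by rw [hv]
  have hTT : star (z • D) * (z • D) = D * D := by
    rw [star_smul, hD.star_diag, smul_mul_smul_comm, hz, one_smul]
  have hDp : D * D * p₀ = p₀ := by rw [← hTT]; exact h.star_T_mul_T
  have hpD : p₀ * (D * D) = p₀ := by
    have := congrArg star hDp
    rwa [star_mul, star_mul, hD.star_diag, h.star_p₀] at this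
  have hne : ∀ k : Fin n → ℕ, k ≠ 0 → p₀ (b k) = 0 := by
    intro k hk
    have h1 := happ (b k) hpD
    rw [mul_apply_eq_comp, mul_apply_eq_comp, hD.diag, map_smul, hD.diag, map_smul, map_smul,
      smul_smul] at h1
    have h2 : ((q⁻¹ ^ ∑ j, k j : ℝ) : ℂ) * ((q⁻¹ ^ ∑ j, k j : ℝ) : ℂ) ≠ 1 := by
      intro h3
      have h4 : (q⁻¹ ^ ∑ j, k j) * (q⁻¹ ^ ∑ j, k j) = 1 := by exact_mod_cast h3
      have h5 : |q⁻¹| ^ (∑ j, k j) < 1 := by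
        refine pow_lt_one₀ (abs_nonneg _) (abs_inv_lt_one hq) fun h6 => hk ?_
        funext j
        exact (Finset.sum_eq_zero_iff.1 h6) j (Finset.mem_univ j)
      rw [← abs_pow] at h5
      nlinarith [abs_mul_abs_self (q⁻¹ ^ ∑ j, k j), abs_nonneg (q⁻¹ ^ ∑ j, k j)]
    have h3 : (((q⁻¹ ^ ∑ j, k j : ℝ) : ℂ) * ((q⁻¹ ^ ∑ j, k j : ℝ) : ℂ) - 1) • p₀ (b k) = 0 := by
      rw [sub_smul, one_smul, h1, sub_self]
    exact (smul_eq_zero.1 h3).resolve_left (sub_ne_zero.2 h2)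
  have hp0 : p₀ (b 0) = b 0 := by
    obtain ⟨c, hc⟩ : ∃ c : ℂ, p₀ (b 0) = c • b 0 := by
      refine ⟨inner ℂ (b 0) (p₀ (b 0)), hilbertBasis_ext b fun k => ?_⟩
      rw [inner_smul_right]
      rcases eq_or_ne k 0 with rfl | hk
      · rw [inner_self_eq_norm_sq_to_K, b.orthonormal.1]
        simp
      · have h1 : inner ℂ (b k) (p₀ (b 0)) = inner ℂ (p₀ (b k)) (b 0) := by
          conv_rhs => rw [← h.star_p₀]
          rw [ContinuousLinearMap.star_eq_adjoint, ContinuousLinearMap.adjoint_inner_left]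
        rw [h1, hne k hk, inner_zero_left, b.orthonormal.2 hk, mul_zero]
    have hcc : c * c = c := by
      have h1 := happ (b 0) h.p₀_mul_p₀
      rw [mul_apply_eq_comp, hc, map_smul, hc, smul_smul] at h1
      exact smul_left_injective ℂ (b.orthonormal.ne_zero 0) h1
    have hcc' : c * (c - 1) = 0 := by rw [mul_sub, hcc, mul_one, sub_self]
    rcases mul_eq_zero.1 hcc' with h1 | h1
    · exfalso
      have h2 : p₀ = 0 := clm_ext_of_dense_span b fun k => by
        rcases eq_or_ne k 0 with rfl | hk
        · rw [hc, h1, zero_smul, zero_apply]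
        · rw [hne k hk, zero_apply]
      have h3 := happ (b 0) (h.T_eq_zero h2)
      rw [smul_apply, hD.diag_zero, zero_apply] at h3
      have hz0 : z ≠ 0 := right_ne_zero_of_mul_eq_one hz
      exact smul_ne_zero hz0 (b.orthonormal.ne_zero 0) h3
    · rw [hc, sub_eq_zero.1 h1, one_smul]
  refine raise_induction (C := fun k => e k (b 0) = b k) ?_ (fun k i hk => ?_) k
  · rw [h.zero, hp0]
  · have h1 := happ (b 0) (h.raise i k)
    rw [mul_apply_eq_comp, hk, hD.raise, smul_apply] at h1
    exact (smul_right_injective H (by exact_mod_cast raiseCoeff_ne_zero hq i k) h1).symm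

/-- A unital homomorphism of `C(Ω)` acts on an eigenvector of a generator by evaluation. -/
theorem apply_eq_eval_smul {Ω : Type*} [TopologicalSpace Ω] [CompactSpace Ω] {χ : C(Ω, ℂ)}
    (hχ : Function.Injective χ) (γ : C(Ω, ℂ) →⋆ₐ[ℂ] (H →L[ℂ] H)) {ω : Ω} {v : H}
    (hv : γ χ v = χ ω • v) (hv' : star (γ χ) v = star (χ ω) • v) (f : C(Ω, ℂ)) :
    γ f v = f ω • v := by
  let S : StarSubalgebra ℂ C(Ω, ℂ) :=
    { carrier := {f | γ f v = f ω • v ∧ γ (star f) v = star (f ω) • v}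
      mul_mem' := fun {f g} hf hg => by
        refine ⟨?_, ?_⟩
        · rw [map_mul, mul_apply_eq_comp, hg.1, map_smul, hf.1, smul_smul, mul_comm]
          rfl
        · rw [star_mul', map_mul, mul_apply_eq_comp, hg.2, map_smul, hf.2, smul_smul, mul_comm,
            ← star_mul']
          rfl
      add_mem' := fun {f g} hf hg => by
        refine ⟨?_, ?_⟩
        · rw [map_add, add_apply, hf.1, hg.1, ← add_smul]
          rfl
        · rw [star_add, map_add, add_apply, hf.2, hg.2, ← add_smul, ← star_add]
          rfl
      algebraMap_mem' := fun c => by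
        refine ⟨?_, ?_⟩
        · rw [AlgHomClass.commutes]
          simp [Algebra.algebraMap_eq_smul_one]
        · rw [← algebraMap_star_comm, AlgHomClass.commutes]
          simp [Algebra.algebraMap_eq_smul_one]
      star_mem' := fun {f} hf => ⟨hf.2, by
        rw [star_star, hf.1]
        exact congrArg (· • v) (star_star (f ω)).symm⟩ }
  have hS : IsClosed (S : Set C(Ω, ℂ)) := by
    have hγ : Continuous γ := continuous_starAlgHom γ
    have hω : Continuous fun f : C(Ω, ℂ) => f ω := continuous_eval_const ω
    exact (isClosed_eq (hγ.clm_apply continuous_const) (hω.smul continuous_const)).inter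
      (isClosed_eq ((hγ.comp continuous_star).clm_apply continuous_const)
        (hω.star.smul continuous_const))
  have hχS : χ ∈ S := ⟨hv, by rw [map_star, hv']⟩
  have hsep : S.SeparatesPoints := fun a b hab => ⟨χ, ⟨χ, hχS, rfl⟩, hχ.ne hab⟩
  have htop := ContinuousMap.starSubalgebra_topologicalClosure_eq_top_of_separatesPoints S hsep
  have hf : f ∈ S.topologicalClosure := htop ▸ StarSubalgebra.mem_top
  have hf' : f ∈ closure (S : Set C(Ω, ℂ)) := hf
  rw [hS.closure_eq] at hf'
  exact hf'.1

end Evaluate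

end QuantumSphere

namespace QuantumSphere

/-! ### The kernel of the symbol map -/

section Symbol

/-- Evaluation at a point. -/
noncomputable def evalHom {Ω : Type*} [TopologicalSpace Ω] {B : Type*}
    [CStarAlgebra B] (ω : Ω) : C(Ω, B) →⋆ₐ[ℂ] B where
  toFun f := f ω
  map_one' := rfl
  map_mul' _ _ := rfl
  map_zero' := rfl
  map_add' _ _ := rfl
  commutes' _ := rfl
  map_star' _ := rfl

variable {A : Type*} [CStarAlgebra A] {H : Type*} [NormedAddCommGroup H] [InnerProductSpace ℂ H]
  [CompleteSpace H] {Ω : Type*} [TopologicalSpace Ω] [CompactSpace Ω]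

/-- A `C^*`-algebra generated by a core tuple, with matrix units `e_k` and a family of standard
representations `Ψ` indexed by `Ω`, such that the functional calculus `γ` of the vacuum corner
is defined on `C(Ω)`. -/
structure IsFockFamily (q : ℝ) {n : ℕ} (χ : C(Ω, ℂ)) (T : A) (Y : Fin n → A) (p₀ : A)
    (e : (Fin n → ℕ) → A) (γ : C(Ω, ℂ) →⋆ₐ[ℂ] A) (b : HilbertBasis (Fin n → ℕ) ℂ H)
    (D : H →L[ℂ] H) (Z : Fin n → (H →L[ℂ] H)) (Ψ : A →⋆ₐ[ℂ] C(Ω, H →L[ℂ] H)) : Prop where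
  one_lt : 1 < |q|
  units : IsMatrixUnits q 1 T Y p₀ e
  γ_χ : γ χ = T * p₀ + (1 - p₀)
  star_mul_χ : ∀ ω, star (χ ω) * χ ω = 1
  injective : Function.Injective χ
  standard : IsStandardTuple q b D Z
  Ψ_T : ∀ ω, Ψ T ω = χ ω • D
  Ψ_Y : ∀ i ω, Ψ (Y i) ω = Z i
  generate : ∀ S : Subalgebra ℂ A, IsClosed (S : Set A) → T ∈ S → star T ∈ S → (∀ i, Y i ∈ S) →
    (∀ i, star (Y i) ∈ S) → ∀ a, a ∈ S

namespace IsFockFamily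

variable {q : ℝ} {n : ℕ} {χ : C(Ω, ℂ)} {T : A} {Y : Fin n → A} {p₀ : A} {e : (Fin n → ℕ) → A}
  {γ : C(Ω, ℂ) →⋆ₐ[ℂ] A} {b : HilbertBasis (Fin n → ℕ) ℂ H} {D : H →L[ℂ] H}
  {Z : Fin n → (H →L[ℂ] H)} {Ψ : A →⋆ₐ[ℂ] C(Ω, H →L[ℂ] H)}

theorem Ψ_e (h : IsFockFamily q χ T Y p₀ e γ b D Z Ψ) (k : Fin n → ℕ) (ω : Ω) :
    Ψ (e k) ω (b 0) = b k := by
  let R : A →⋆ₐ[ℂ] (H →L[ℂ] H) := (evalHom ω).comp Ψ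
  have h1 := h.units.map R
  have hT : R T = χ ω • D := h.Ψ_T ω
  have hY : (fun i => R (Y i)) = Z := funext fun i => h.Ψ_Y i ω
  rw [hT, hY] at h1
  exact h.standard.matrixUnit_apply h.one_lt (h.star_mul_χ ω) h1 k

theorem Ψ_p₀ (h : IsFockFamily q χ T Y p₀ e γ b D Z Ψ) (ω : Ω) : Ψ p₀ ω (b 0) = b 0 := by
  rw [← h.units.zero]
  exact h.Ψ_e 0 ω

/-- The vacuum is an eigenvector of the unitary `Ψ (γ χ) ω` with eigenvalue `χ ω`, so all functions
of that unitary act by evaluation. -/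
theorem Ψ_γ (h : IsFockFamily q χ T Y p₀ e γ b D Z Ψ) (f : C(Ω, ℂ)) (ω : Ω) :
    Ψ (γ f) ω (b 0) = f ω • b 0 := by
  let R : A →⋆ₐ[ℂ] (H →L[ℂ] H) := (evalHom ω).comp Ψ
  have h1 : R (γ χ) (b 0) = χ ω • b 0 := by
    have hT : R T = χ ω • D := h.Ψ_T ω
    have hp : R p₀ (b 0) = b 0 := h.Ψ_p₀ ω
    rw [h.γ_χ, map_add, map_mul, map_sub, map_one, add_apply, mul_apply_eq_comp, sub_apply, hp,
      one_apply_eq_self, sub_self, add_zero, hT, smul_apply, h.standard.diag_zero]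
  have h2 : star (R (γ χ)) * R (γ χ) = 1 := by
    have h3 : star χ * χ = 1 := ContinuousMap.ext h.star_mul_χ
    rw [← map_star, ← map_star, ← map_mul, ← map_mul, h3, map_one, map_one]
  have h4 : star (R (γ χ)) (b 0) = star (χ ω) • b 0 := by
    have h5 := congrArg (fun S : H →L[ℂ] H => S (b 0)) h2
    simp only [mul_apply_eq_comp, h1, map_smul, one_apply_eq_self] at h5
    conv_rhs => rw [← h5]
    rw [smul_smul, h.star_mul_χ, one_smul]
  exact apply_eq_eval_smul h.injective (R.comp γ) h1 h4 f

variable (b Ψ) in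
/-- The vacuum expectation. -/
noncomputable def vacuum : A →L[ℂ] C(Ω, ℂ) :=
  (ContinuousLinearMap.compLeftContinuous ℂ Ω
    ((innerSL ℂ (b 0)).comp (ContinuousLinearMap.apply ℂ H (b 0)))).comp
    ⟨Ψ.toAlgHom.toLinearMap, continuous_starAlgHom Ψ⟩

theorem vacuum_apply (a : A) (ω : Ω) : vacuum b Ψ a ω = inner ℂ (b 0) (Ψ a ω (b 0)) := rfl

theorem vacuum_p₀_mul_γ (h : IsFockFamily q χ T Y p₀ e γ b D Z Ψ) (f : C(Ω, ℂ)) :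
    vacuum b Ψ (p₀ * γ f) = f := by
  ext ω
  rw [vacuum_apply, map_mul, ContinuousMap.mul_apply, mul_apply_eq_comp, h.Ψ_γ, map_smul, h.Ψ_p₀,
    inner_smul_right, inner_self_eq_norm_sq_to_K, b.orthonormal.1]
  simp

/-- Matrix coefficients of `A` lie in `p₀ γ(C(Ω))`, and the vacuum expectation recovers the
function. The elements `x` with all `e_l^* x` of this form are a closed set `M` that contains every
`e_k`. Multiplication by a generator or its adjoint preserves `M`, hence so does all of `A`. -/
theorem star_mul_mul (h : IsFockFamily q χ T Y p₀ e γ b D Z Ψ) (a : A) (k l : Fin n → ℕ) :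
    star (e l) * a * e k = p₀ * γ (vacuum b Ψ (star (e l) * a * e k)) := by
  let C : A → Prop := fun y => y = p₀ * γ (vacuum b Ψ y)
  have hC : ∀ f, C (p₀ * γ f) := fun f => by
    change p₀ * γ f = p₀ * γ (vacuum b Ψ (p₀ * γ f))
    rw [h.vacuum_p₀_mul_γ]
  have hCc : IsClosed {y | C y} := isClosed_eq continuous_id
    (continuous_const.mul ((continuous_starAlgHom γ).comp (vacuum b Ψ).continuous))
  have hadd : ∀ {x y}, C x → C y → C (x + y) := fun {x y} hx hy => by
    change x + y = p₀ * γ (vacuum b Ψ (x + y))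
    rw [map_add, map_add, mul_add, ← hx, ← hy]
  have hsmul : ∀ (c : ℂ) {x}, C x → C (c • x) := fun c x hx => by
    change c • x = p₀ * γ (vacuum b Ψ (c • x))
    rw [map_smul, map_smul, mul_smul_comm, ← hx]
  have hT : ∀ y, C y → C (T * y) := fun y hy => by
    have h1 : T * p₀ = p₀ * γ χ := by
      rw [h.γ_χ, mul_add, mul_sub, mul_one, h.units.p₀_mul_p₀, sub_self, add_zero,
        h.units.T_mul_p₀, ← mul_assoc, h.units.p₀_mul_p₀]
    rw [hy, ← mul_assoc, h1, mul_assoc, ← map_mul]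
    exact hC _
  have hT' : ∀ y, C y → C (star T * y) := fun y hy => by
    have h1 : star T * p₀ = p₀ * γ (star χ) := by
      rw [map_star, h.γ_χ, star_add, star_mul, star_sub, star_one, h.units.star_p₀, mul_add, mul_sub,
        mul_one, ← mul_assoc, h.units.p₀_mul_p₀, sub_self, add_zero, h.units.star_T_mul_p₀]
    rw [hy, ← mul_assoc, h1, mul_assoc, ← map_mul]
    exact hC _
  let M : Set A := {x | ∀ l, C (star (e l) * x)}
  have hM : IsClosed M := by
    have : M = ⋂ l, (fun x => star (e l) * x) ⁻¹' {y | C y} := by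
      ext
      simp [M]
    rw [this]
    exact isClosed_iInter fun l => hCc.preimage (by fun_prop)
  let S : Subalgebra ℂ A :=
    { carrier := {a | ∀ x ∈ M, a * x ∈ M}
      mul_mem' := fun {a a'} ha ha' x hx => by
        rw [mul_assoc]
        exact ha _ (ha' _ hx)
      add_mem' := fun {a a'} ha ha' x hx l => by
        rw [add_mul, mul_add]
        exact hadd (ha x hx l) (ha' x hx l)
      algebraMap_mem' := fun c x hx l => by
        rw [Algebra.algebraMap_eq_smul_one, smul_mul_assoc, one_mul, mul_smul_comm]
        exact hsmul c (hx l) }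
  have hS : IsClosed (S : Set A) := by
    have : (S : Set A) = ⋂ x ∈ M, (fun a => a * x) ⁻¹' M := by
      ext a
      simp [S]
    rw [this]
    exact isClosed_biInter fun x _ => hM.preimage (by fun_prop)
  have haux : ∀ (u : A) {y : A} {c : ℝ} l, star u * e l = (c : ℂ) • y → ∀ x : A,
      star (e l) * (u * x) = (c : ℂ) • (star y * x) := fun u y c l hu x => by
    have := congrArg star hu
    rw [star_mul, star_star, star_smul, Complex.star_def, Complex.conj_ofReal] at this
    rw [← mul_assoc, this, smul_mul_assoc]
  have hmem := h.generate S hS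
    (fun x hx l => by
      rw [haux T l (h.units.star_T_mul l), star_mul, star_star, mul_assoc]
      exact hsmul _ (hT _ (hx l)))
    (fun x hx l => by
      rw [haux (star T) l (by rw [star_star]; exact h.units.T_mul l), star_mul, mul_assoc]
      exact hsmul _ (hT' _ (hx l)))
    (fun i x hx l => by
      rw [haux (Y i) l (h.units.raise i l)]
      exact hsmul _ (hx _))
    (fun i x hx l => by
      rw [haux (star (Y i)) l (by rw [star_star]; exact h.units.lower i l)]
      exact hsmul _ (hx _)) a
  have hek : e k ∈ M := fun l => by
    rw [h.units.star_mul]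
    split_ifs
    · have := hC 1
      rwa [map_one, mul_one] at this
    · have := hC 0
      rwa [map_zero, mul_zero] at this
  have := hmem (e k) hek l
  rw [← mul_assoc] at this
  exact this

/-- `e_k^* a^* a e_k` is determined by its vacuum expectation, which is computed from `Ψ a = 0`. -/
theorem mul_e_eq_zero (h : IsFockFamily q χ T Y p₀ e γ b D Z Ψ) {a : A} (ha : Ψ a = 0)
    (k : Fin n → ℕ) : a * e k = 0 := by
  have h1 := h.star_mul_mul (star a * a) k k
  have h2 : vacuum b Ψ (star (e k) * (star a * a) * e k) = 0 := by
    ext ω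
    rw [vacuum_apply]
    simp [ha]
  rw [h2, map_zero, mul_zero] at h1
  rw [← CStarRing.star_mul_self_eq_zero_iff, star_mul, ← h1]
  simp only [mul_assoc]

end IsFockFamily

end Symbol

end QuantumSphere

namespace QuantumSphere

open Filter Topology InnerProductSpace

/-! ### Finite-dimensional compressions -/

section Compression

variable {H : Type*} [NormedAddCommGroup H] [InnerProductSpace ℂ H] {ι : Type*}
  (b : HilbertBasis ι ℂ H)

/-- The projection onto the span of finitely many basis vectors. -/
noncomputable def basisProj (F : Finset ι) : H →L[ℂ] H := ∑ k ∈ F, rankOne ℂ (b k) (b k)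

theorem basisProj_apply (F : Finset ι) (v : H) :
    basisProj b F v = ∑ k ∈ F, inner ℂ (b k) v • b k := by
  simp [basisProj, sum_apply]

theorem basisProj_mul_mul_basisProj (F : Finset ι) (S : H →L[ℂ] H) :
    basisProj b F * S * basisProj b F =
      ∑ l ∈ F, ∑ k ∈ F, (inner ℂ (b l) (S (b k)) : ℂ) • (rankOne ℂ (b l) (b k) : H →L[ℂ] H) := by
  rw [basisProj, Finset.sum_mul, Finset.sum_mul]
  refine Finset.sum_congr rfl fun l _ => ?_
  rw [Finset.mul_sum]
  refine Finset.sum_congr rfl fun k _ => ContinuousLinearMap.ext fun v => ?_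
  simp only [mul_apply_eq_comp, smul_apply, rankOne_apply, map_smul, smul_smul]
  rw [mul_comm]

theorem isCompactOperator_sum {ι' : Type*} (s : Finset ι') (f : ι' → (H →L[ℂ] H))
    (hf : ∀ i ∈ s, IsCompactOperator (f i)) : IsCompactOperator (∑ i ∈ s, f i : H →L[ℂ] H) :=
  Finset.sum_induction f (fun S => IsCompactOperator (S : H →L[ℂ] H)) (fun _ _ h h' => h.add h')
    isCompactOperator_zero hf

variable [CompleteSpace H]

open Classical in
theorem basisProj_basis (F : Finset ι) (k : ι) :
    basisProj b F (b k) = if k ∈ F then b k else 0 := by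
  rw [basisProj_apply]
  simp [orthonormal_iff_ite.1 b.orthonormal, ite_smul]

theorem star_rankOne (v w : H) : star (rankOne ℂ v w : H →L[ℂ] H) = rankOne ℂ w v := by
  refine ContinuousLinearMap.ext fun x => ext_inner_left ℂ fun y => ?_
  rw [ContinuousLinearMap.star_eq_adjoint, ContinuousLinearMap.adjoint_inner_right,
    rankOne_apply, rankOne_apply, inner_smul_left, inner_smul_right, inner_conj_symm, mul_comm]

theorem isStarProjection_basisProj (F : Finset ι) : IsStarProjection (basisProj b F) where
  isIdempotentElem := clm_ext_of_dense_span b fun k => by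
    rw [mul_apply_eq_comp, basisProj_basis]
    split_ifs with h
    · rw [basisProj_basis, if_pos h]
    · exact map_zero _
  isSelfAdjoint := by
    rw [isSelfAdjoint_iff, basisProj, star_sum]
    exact Finset.sum_congr rfl fun k _ => star_rankOne _ _

theorem eventually_norm_sub_basisProj_lt (v : H) {ε : ℝ} (hε : 0 < ε) :
    ∀ᶠ F in atTop, ‖v - basisProj b F v‖ < ε := by
  have h := (Metric.tendsto_nhds.1 (b.hasSum_repr v)) ε hε
  filter_upwards [h] with F hF
  rw [dist_comm, dist_eq_norm] at hF
  rw [basisProj_apply]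
  simpa only [b.repr_apply_apply] using hF

/-- The projections converge strongly to the identity, hence uniformly on the totally bounded image
of the unit ball; a finite `ε/3`-net suffices. -/
theorem eventually_norm_sub_basisProj_mul_le {S : H →L[ℂ] H} (hS : IsCompactOperator S) {ε : ℝ}
    (hε : 0 < ε) : ∀ᶠ F in atTop, ‖S - basisProj b F * S‖ ≤ ε := by
  have hcpt : IsCompact (closure (S '' Metric.closedBall 0 1)) :=
    IsCompactOperator.isCompact_closure_image_closedBall (f := S.toLinearMap) hS 1
  have htb : TotallyBounded (S '' Metric.closedBall 0 1) :=
    hcpt.totallyBounded.subset subset_closure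
  obtain ⟨t, ht, hcov⟩ := Metric.totallyBounded_iff.1 htb (ε / 3) (by positivity)
  have hev : ∀ᶠ F in atTop, ∀ y ∈ t, ‖y - basisProj b F y‖ < ε / 3 :=
    (eventually_all_finite ht).2 fun y _ => eventually_norm_sub_basisProj_lt b y (by positivity)
  filter_upwards [hev] with F hF
  have hP : ‖basisProj b F‖ ≤ 1 := (isStarProjection_basisProj b F).norm_le
  have hunit : ∀ x : H, ‖x‖ ≤ 1 → ‖(S - basisProj b F * S) x‖ ≤ ε := by
    intro x hx
    obtain ⟨y, hy, hxy⟩ := Set.mem_iUnion₂.1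
      (hcov ⟨x, mem_closedBall_zero_iff.2 hx, rfl⟩)
    have h1 : ‖S x - y‖ < ε / 3 := by rwa [Metric.mem_ball, dist_eq_norm] at hxy
    have h2 : (S - basisProj b F * S) x =
        (S x - y) - basisProj b F (S x - y) + (y - basisProj b F y) := by
      rw [sub_apply, mul_apply_eq_comp, map_sub]
      abel
    have h3 : ‖basisProj b F (S x - y)‖ ≤ ‖S x - y‖ :=
      ((basisProj b F).le_opNorm _).trans (mul_le_of_le_one_left (norm_nonneg _) hP)
    rw [h2]
    linarith [norm_add_le ((S x - y) - basisProj b F (S x - y)) (y - basisProj b F y),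
      norm_sub_le (S x - y) (basisProj b F (S x - y)), hF y hy]
  refine ContinuousLinearMap.opNorm_le_of_unit_norm hε.le fun x hx => hunit x hx.le

theorem exists_norm_sub_compression_le {S : H →L[ℂ] H} (hS : IsCompactOperator S) {ε : ℝ}
    (hε : 0 < ε) : ∃ F, ‖S - basisProj b F * S * basisProj b F‖ ≤ ε := by
  obtain ⟨F, h1, h2⟩ := ((eventually_norm_sub_basisProj_mul_le b hS (half_pos hε)).and
    (eventually_norm_sub_basisProj_mul_le b (isCompactOperator_star hS) (half_pos hε))).exists
  refine ⟨F, ?_⟩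
  have hP : ‖basisProj b F‖ ≤ 1 := (isStarProjection_basisProj b F).norm_le
  have hPs : star (basisProj b F) = basisProj b F := (isStarProjection_basisProj b F).isSelfAdjoint
  have h3 : ‖S - S * basisProj b F‖ ≤ ε / 2 := by
    rw [← norm_star, star_sub, star_mul, hPs]
    exact h2
  have h4 : S - basisProj b F * S * basisProj b F =
      (S - basisProj b F * S) + basisProj b F * (S - S * basisProj b F) := by
    rw [mul_sub, mul_assoc]
    abel
  rw [h4]
  have h5 : ‖basisProj b F * (S - S * basisProj b F)‖ ≤ ‖S - S * basisProj b F‖ :=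
    (norm_mul_le _ _).trans (mul_le_of_le_one_left (norm_nonneg _) hP)
  linarith [norm_add_le (S - basisProj b F * S) (basisProj b F * (S - S * basisProj b F))]

theorem isCompactOperator_rankOne (v w : H) : IsCompactOperator (rankOne ℂ v w : H →L[ℂ] H) := by
  have h1 : IsCompactOperator (innerSL ℂ w : H →L[ℂ] ℂ) :=
    isCompactOperator_of_locallyCompactSpace_dom (T := innerSL ℂ w)
  exact h1.clm_comp (ContinuousLinearMap.toSpanSingleton ℂ v)

theorem isCompactOperator_of_compression {S : H →L[ℂ] H}
    (h : ∀ ε > 0, ∃ F, ‖S - basisProj b F * S * basisProj b F‖ ≤ ε) : IsCompactOperator S := by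
  have hcl := isClosed_setOfPred_isCompactOperator (σ₁₂ := RingHom.id ℂ) (M₁ := H) (M₂ := H)
  refine hcl.closure_subset (Metric.mem_closure_iff.2 fun ε hε => ?_)
  obtain ⟨F, hF⟩ := h (ε / 2) (half_pos hε)
  refine ⟨basisProj b F * S * basisProj b F, ?_, by rw [dist_eq_norm]; linarith⟩
  rw [basisProj_mul_mul_basisProj]
  exact isCompactOperator_sum _ _ fun l _ => isCompactOperator_sum _ _ fun k _ =>
    (isCompactOperator_rankOne _ _).smul _

end Compression

end QuantumSphere

namespace QuantumSphere

open Filter Topology InnerProductSpace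

/-! ### The extension -/

section Extension

variable {A B : Type*} [CStarAlgebra A] [CStarAlgebra B] {H : Type*} [NormedAddCommGroup H]
  [InnerProductSpace ℂ H] [CompleteSpace H] {Ω : Type*} [TopologicalSpace Ω] [CompactSpace Ω]

/-- The image of the kernel of `π` under `Ψ`. -/
def imageOfKer (π : A →⋆ₐ[ℂ] B) (Ψ : A →⋆ₐ[ℂ] C(Ω, H →L[ℂ] H)) :
    NonUnitalStarSubalgebra ℂ C(Ω, H →L[ℂ] H) where
  carrier := {g | ∃ a, π a = 0 ∧ Ψ a = g}
  add_mem' := by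
    rintro _ _ ⟨a, ha, rfl⟩ ⟨b, hb, rfl⟩
    exact ⟨a + b, by rw [map_add, ha, hb, add_zero], map_add Ψ a b⟩
  zero_mem' := ⟨0, map_zero π, map_zero Ψ⟩
  mul_mem' := by
    rintro _ _ ⟨a, ha, rfl⟩ ⟨b, hb, rfl⟩
    exact ⟨a * b, by rw [map_mul, ha, zero_mul], map_mul Ψ a b⟩
  smul_mem' := by
    rintro c _ ⟨a, ha, rfl⟩
    exact ⟨c • a, by rw [map_smul, ha, smul_zero], map_smul Ψ c a⟩
  star_mem' := by
    rintro _ ⟨a, ha, rfl⟩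
    exact ⟨star a, by rw [map_star, ha, star_zero], map_star Ψ a⟩

/-- The elementary tensor `f ⊗ S`. -/
noncomputable def tensor (f : C(Ω, ℂ)) (S : H →L[ℂ] H) : C(Ω, H →L[ℂ] H) :=
  ⟨fun ω => f ω • S, by fun_prop⟩

theorem tensor_apply (f : C(Ω, ℂ)) (S : H →L[ℂ] H) (ω : Ω) : tensor f S ω = f ω • S := rfl

/-- If `κ` is an embedding with range `Ψ(ker π)`, where `Ψ` is injective on `ker π`, then
`Ψ⁻¹ ∘ κ` completes `π` to an extension. -/
theorem exists_isExtension {π : A →⋆ₐ[ℂ] B} {Ψ : A →⋆ₐ[ℂ] C(Ω, H →L[ℂ] H)}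
    (hinj : ∀ a, π a = 0 → Ψ a = 0 → a = 0) (hπ : Function.Surjective π) {I : Type*}
    [NonUnitalRing I] [Module ℂ I] [StarRing I] {κ : I →⋆ₙₐ[ℂ] C(Ω, H →L[ℂ] H)}
    (hκ : Function.Injective κ) (hr : ∀ g, g ∈ imageOfKer π Ψ ↔ ∃ x, κ x = g) :
    ∃ j : I →⋆ₙₐ[ℂ] A, IsExtension j π := by
  have hex : ∀ x, ∃ a, π a = 0 ∧ Ψ a = κ x := fun x => (hr _).2 ⟨x, rfl⟩
  choose j hj hj' using hex
  have huniq : ∀ a a', π a = 0 → π a' = 0 → Ψ a = Ψ a' → a = a' := fun a a' h h' h'' =>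
    sub_eq_zero.1 (hinj _ (by rw [map_sub, h, h', sub_zero]) (by rw [map_sub, h'', sub_self]))
  let J : I →⋆ₙₐ[ℂ] A :=
    { toFun := j
      map_smul' := fun c x => huniq _ _ (hj _) (by
        rw [map_smul, hj, smul_zero]) (by rw [hj', map_smul, map_smul, hj']; rfl)
      map_zero' := huniq _ _ (hj _) (map_zero π) (by rw [hj', map_zero, map_zero])
      map_add' := fun x y => huniq _ _ (hj _) (by rw [map_add, hj, hj, add_zero])
        (by rw [hj', map_add, map_add, hj', hj'])
      map_mul' := fun x y => huniq _ _ (hj _) (by rw [map_mul, hj, zero_mul])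
        (by rw [hj', map_mul, map_mul, hj', hj'])
      map_star' := fun x => huniq _ _ (hj _) (by rw [map_star, hj, star_zero])
        (by rw [hj', map_star, map_star, hj']) }
  refine ⟨J, ⟨fun x y hxy => hκ ?_, fun a => ⟨fun ha => ?_, ?_⟩, hπ⟩⟩
  · rw [← hj', ← hj']
    exact congrArg Ψ hxy
  · obtain ⟨x, hx⟩ := (hr _).1 ⟨a, ha, rfl⟩
    exact ⟨x, huniq _ _ (hj x) ha ((hj' x).trans hx)⟩
  · rintro ⟨x, rfl⟩
    exact hj x

namespace IsFockFamily

variable {q : ℝ} {n : ℕ} {χ : C(Ω, ℂ)} {T : A} {Y : Fin n → A} {p₀ : A} {e : (Fin n → ℕ) → A}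
  {γ : C(Ω, ℂ) →⋆ₐ[ℂ] A} {b : HilbertBasis (Fin n → ℕ) ℂ H} {D : H →L[ℂ] H}
  {Z : Fin n → (H →L[ℂ] H)} {Ψ : A →⋆ₐ[ℂ] C(Ω, H →L[ℂ] H)}

/-- These elements supply every tensor of a function with a matrix unit; they lie in `ker π` because
`p₀` does. -/
theorem Ψ_mul_star (h : IsFockFamily q χ T Y p₀ e γ b D Z Ψ) (f : C(Ω, ℂ)) (l k : Fin n → ℕ) :
    Ψ (e l * (p₀ * γ f) * star (e k)) = tensor f (rankOne ℂ (b l) (b k)) := by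
  ext1 ω
  rw [tensor_apply]
  refine clm_ext_of_dense_span b fun m => ?_
  have h1 : Ψ (star (e k)) ω (b m) = if k = m then b 0 else 0 := by
    have h2 := congrArg (fun a => Ψ a ω (b 0)) (h.units.star_mul k m)
    simp only [map_mul, ContinuousMap.mul_apply, mul_apply_eq_comp, h.Ψ_e] at h2
    rw [h2]
    split_ifs
    · exact h.Ψ_p₀ ω
    · rw [map_zero]
      rfl
  rw [map_mul, map_mul, map_mul]
  simp only [ContinuousMap.mul_apply, mul_apply_eq_comp, h1, smul_apply, rankOne_apply]
  classical
  rw [orthonormal_iff_ite.1 b.orthonormal k m]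
  split_ifs
  · rw [h.Ψ_γ, map_smul, map_smul, h.Ψ_p₀, h.Ψ_e, one_smul]
  · simp

theorem Ψ_sum (h : IsFockFamily q χ T Y p₀ e γ b D Z Ψ) (F : Finset (Fin n → ℕ)) :
    Ψ (∑ k ∈ F, e k * star (e k)) = ContinuousMap.const Ω (basisProj b F) := by
  have h1 : ∀ k, e k * star (e k) = e k * (p₀ * γ 1) * star (e k) := fun k => by
    rw [map_one, mul_one, h.units.mul_p₀]
  ext1 ω
  rw [map_sum, Finset.sum_congr rfl fun k _ => congrArg Ψ (h1 k),
    Finset.sum_congr rfl fun k _ => h.Ψ_mul_star 1 k k]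
  simp [basisProj, tensor_apply, ContinuousMap.sum_apply]

variable {π : A →⋆ₐ[ℂ] B} {F : ℕ → Finset (Fin n → ℕ)}

/-- If `Ψ a = 0`, then `a` kills every `e_k`, so `a (1 - P) = a` for the sums `P` along which `a (1
- P)` tends to zero. -/
theorem eq_zero_of_ker (h : IsFockFamily q χ T Y p₀ e γ b D Z Ψ)
    (hF : ∀ a, π a = 0 → Tendsto (fun m => ‖a * (1 - ∑ k ∈ F m, e k * star (e k))‖) atTop (𝓝 0))
    {a : A} (ha : π a = 0) (ha' : Ψ a = 0) : a = 0 := by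
  have h1 := hF a ha
  have h2 : ∀ m, a * (1 - ∑ k ∈ F m, e k * star (e k)) = a := fun m => by
    rw [mul_sub, mul_one, Finset.mul_sum, Finset.sum_eq_zero, sub_zero]
    intro k _
    rw [← mul_assoc, h.mul_e_eq_zero ha', zero_mul]
  simp only [h2] at h1
  exact norm_eq_zero.1 (tendsto_nhds_unique tendsto_const_nhds h1)

/-- The pair `(π, Ψ)` is injective on all of `A`, hence isometric, and its first component vanishes
at `a`. -/
theorem norm_Ψ_of_ker (h : IsFockFamily q χ T Y p₀ e γ b D Z Ψ)
    (hF : ∀ a, π a = 0 → Tendsto (fun m => ‖a * (1 - ∑ k ∈ F m, e k * star (e k))‖) atTop (𝓝 0))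
    {a : A} (ha : π a = 0) : ‖Ψ a‖ = ‖a‖ := by
  have hinj : Function.Injective (π.prod Ψ) := (injective_iff_map_eq_zero (π.prod Ψ)).2 fun a ha =>
    h.eq_zero_of_ker hF (congrArg Prod.fst ha) (congrArg Prod.snd ha)
  rw [← NonUnitalStarAlgHom.norm_map (π.prod Ψ) hinj a]
  have h1 : π.prod Ψ a = (0, Ψ a) := Prod.ext ha rfl
  rw [h1, Prod.norm_def]
  simp

theorem isClosed_imageOfKer (h : IsFockFamily q χ T Y p₀ e γ b D Z Ψ)
    (hF : ∀ a, π a = 0 → Tendsto (fun m => ‖a * (1 - ∑ k ∈ F m, e k * star (e k))‖) atTop (𝓝 0)) :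
    IsClosed (imageOfKer π Ψ : Set C(Ω, H →L[ℂ] H)) := by
  have hcl : IsClosed {a | π a = 0} := isClosed_eq (continuous_starAlgHom π) continuous_const
  have : CompleteSpace {a | π a = 0} := hcl.completeSpace_coe
  have hiso : Isometry fun a : {a | π a = 0} => Ψ a := Isometry.of_dist_eq fun a a' => by
    rw [dist_eq_norm, ← map_sub, h.norm_Ψ_of_ker hF (by rw [map_sub, a.2, a'.2, sub_zero]),
      ← dist_eq_norm]
    rfl
  have h1 : (imageOfKer π Ψ : Set C(Ω, H →L[ℂ] H)) = Set.range fun a : {a | π a = 0} => Ψ a := by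
    ext g
    exact ⟨fun ⟨a, ha, hg⟩ => ⟨⟨a, ha⟩, hg⟩, fun ⟨a, hg⟩ => ⟨a, a.2, hg⟩⟩
  rw [h1]
  exact hiso.isClosedEmbedding.isClosed_range

/-- `π T = 0` gives `π p₀ = 0` through `p₀ = T^* T p₀`. So the image contains the tensors with
finite matrices; being closed, it contains those with compact operators. -/
theorem tensor_mem_imageOfKer (h : IsFockFamily q χ T Y p₀ e γ b D Z Ψ) (hπT : π T = 0)
    (hF : ∀ a, π a = 0 → Tendsto (fun m => ‖a * (1 - ∑ k ∈ F m, e k * star (e k))‖) atTop (𝓝 0))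
    (f : C(Ω, ℂ)) {S : H →L[ℂ] H} (hS : IsCompactOperator S) : tensor f S ∈ imageOfKer π Ψ := by
  have hp₀ : π p₀ = 0 := by
    rw [← h.units.star_T_mul_T, map_mul, map_mul, hπT, mul_zero, zero_mul]
  have hrank : ∀ l k, tensor f (rankOne ℂ (b l) (b k)) ∈ imageOfKer π Ψ := fun l k =>
    ⟨_, by rw [map_mul, map_mul, map_mul, hp₀]; simp, h.Ψ_mul_star f l k⟩
  have hmem : ∀ G : Finset (Fin n → ℕ),
      tensor f (basisProj b G * S * basisProj b G) ∈ imageOfKer π Ψ := by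
    intro G
    have h1 : tensor f (basisProj b G * S * basisProj b G) = ∑ l ∈ G, ∑ k ∈ G,
        (inner ℂ (b l) (S (b k)) : ℂ) • tensor f (rankOne ℂ (b l) (b k)) := by
      ext1 ω
      rw [tensor_apply, basisProj_mul_mul_basisProj]
      simp only [ContinuousMap.sum_apply, ContinuousMap.smul_apply, tensor_apply, Finset.smul_sum,
        smul_comm (f ω)]
    rw [h1]
    exact sum_mem fun l _ => sum_mem fun k _ =>
      SMulMemClass.smul_mem _ (hrank l k)
  refine (h.isClosed_imageOfKer hF).closure_subset (Metric.mem_closure_iff.2 fun ε hε => ?_)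
  obtain ⟨G, hG⟩ := exists_norm_sub_compression_le b hS (ε := ε / (2 * (‖f‖ + 1))) (by positivity)
  refine ⟨_, hmem G, ?_⟩
  have h2 : dist (tensor f S) (tensor f (basisProj b G * S * basisProj b G)) ≤ ε / 2 := by
    rw [ContinuousMap.dist_le (by positivity)]
    intro ω
    rw [dist_eq_norm, tensor_apply, tensor_apply, ← smul_sub, norm_smul]
    calc _ ≤ (‖f‖ + 1) * (ε / (2 * (‖f‖ + 1))) := mul_le_mul
          ((f.norm_coe_le_norm ω).trans (by linarith)) hG (norm_nonneg _) (by positivity)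
      _ = ε / 2 := by field_simp
  linarith

/-- The converse bound on the image: for `a` in the kernel both `a (1 - P)` and `(1 - P) a` are
small in norm, so the compression error is small uniformly in `ω`. -/
theorem exists_compression (h : IsFockFamily q χ T Y p₀ e γ b D Z Ψ)
    (hF : ∀ a, π a = 0 → Tendsto (fun m => ‖a * (1 - ∑ k ∈ F m, e k * star (e k))‖) atTop (𝓝 0))
    {g : C(Ω, H →L[ℂ] H)} (hg : g ∈ imageOfKer π Ψ) {ε : ℝ} (hε : 0 < ε) :
    ∃ G, ∀ ω, ‖g ω - basisProj b G * g ω * basisProj b G‖ ≤ ε := by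
  obtain ⟨a, ha, rfl⟩ := hg
  have ha' : π (star a) = 0 := by rw [map_star, ha, star_zero]
  obtain ⟨m, h1, h2⟩ := (((hF a ha).eventually_lt_const (half_pos hε)).and
    ((hF _ ha').eventually_lt_const (half_pos hε))).exists
  refine ⟨F m, fun ω => ?_⟩
  set P := ∑ k ∈ F m, e k * star (e k) with hP
  have hPs : star P = P := by
    simp only [hP, star_sum, star_mul, star_star]
  have hΨP : Ψ P ω = basisProj b (F m) := by
    rw [hP, h.Ψ_sum]
    rfl
  have h3 : Ψ a ω - basisProj b (F m) * Ψ a ω * basisProj b (F m) =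
      Ψ (a * (1 - P)) ω + Ψ (star (star a * (1 - P))) ω * basisProj b (F m) := by
    simp only [star_mul, star_sub, hPs, star_star, map_mul, map_sub, ContinuousMap.mul_apply,
      ContinuousMap.sub_apply, hΨP, sub_mul, mul_sub, mul_one]
    abel
  have hn : ∀ c, ‖Ψ c ω‖ ≤ ‖c‖ := fun c =>
    ((Ψ c).norm_coe_le_norm ω).trans (NonUnitalStarAlgHom.norm_apply_le Ψ c)
  have h4 : ‖Ψ (star (star a * (1 - P))) ω * basisProj b (F m)‖ ≤ ‖star a * (1 - P)‖ :=
    (norm_mul_le _ _).trans ((mul_le_of_le_one_right (norm_nonneg _)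
      (isStarProjection_basisProj b _).norm_le).trans ((hn _).trans (norm_star _).le))
  rw [h3]
  linarith [norm_add_le (Ψ (a * (1 - P)) ω)
    (Ψ (star (star a * (1 - P))) ω * basisProj b (F m)), hn (a * (1 - P))]

end IsFockFamily

end Extension

end QuantumSphere

namespace QuantumSphere

open SphereAlgebra Filter Topology InnerProductSpace

/-! ### The exact sequences for the spheres -/

section Spheres

theorem exists_hilbertBasis_ellTwo (ι : Type*) [Countable ι] [Infinite ι] :
    Nonempty (HilbertBasis ι ℂ EllTwo) := by
  obtain ⟨_⟩ := nonempty_denumerable ι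
  let f : ι ≃ ℕ := Denumerable.eqv ι
  let b : HilbertBasis ℕ ℂ EllTwo := HilbertBasis.ofRepr (LinearIsometryEquiv.refl ℂ _)
  refine ⟨HilbertBasis.mk (b.orthonormal.comp f f.injective) ?_⟩
  rw [f.surjective.range_comp, b.dense_span]

theorem IsMatrixUnits.isStarProjection_sum {A : Type*} [CStarAlgebra A] {q : ℝ} {n : ℕ} {T : A}
    {Y : Fin n → A} {p₀ : A} {e : (Fin n → ℕ) → A} (h : IsMatrixUnits q 1 T Y p₀ e)
    (F : Finset (Fin n → ℕ)) : IsStarProjection (∑ k ∈ F, e k * star (e k)) where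
  isIdempotentElem := by
    rw [IsIdempotentElem, Finset.sum_mul]
    refine Finset.sum_congr rfl fun k hk => ?_
    rw [Finset.mul_sum, Finset.sum_eq_single k]
    · rw [mul_assoc, ← mul_assoc (star (e k)), h.star_mul, if_pos rfl, ← mul_assoc, h.mul_p₀]
    · intro l _ hl
      rw [mul_assoc, ← mul_assoc (star (e k)), h.star_mul, if_neg hl.symm, zero_mul, mul_zero]
    · exact fun h => (h hk).elim
  isSelfAdjoint := by
    simp only [isSelfAdjoint_iff, star_sum, StarMul.star_mul, star_star]

variable {q : ℝ} {N n : ℕ} {odd : Prop} {Ω : Type*} [TopologicalSpace Ω] [CompactSpace Ω]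

/-- A continuous family of representations induces a homomorphism of the completion. -/
theorem exists_familyHom (ψ : Ω → HilbertRep (SphereAlgebra q N odd) EllTwo)
    (hψ : ∀ i, Continuous fun ω => ψ ω (x i)) :
    ∃ Ψ : CSphere q N odd →⋆ₐ[ℂ] C(Ω, BEllTwo), ∀ a ω, Ψ (toC q N odd a) ω = ψ ω a := by
  have hc : ∀ a, Continuous fun ω => ψ ω a := by
    intro a
    induction a using SphereAlgebra.induct_gen with
    | hc c => simp only [AlgHomClass.commutes]; exact continuous_const
    | hx i => exact hψ i
    | hs i => simp only [map_star]; exact (hψ i).star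
    | hm a b ha hb => simp only [map_mul]; exact ha.mul hb
    | ha a b ha hb => simp only [map_add]; exact ha.add hb
  let Ψ₀ : SphereAlgebra q N odd →⋆ₐ[ℂ] C(Ω, BEllTwo) :=
    { toFun := fun a => ⟨fun ω => ψ ω a, hc a⟩
      map_one' := ContinuousMap.ext fun ω => map_one (ψ ω)
      map_mul' := fun a b => ContinuousMap.ext fun ω => map_mul (ψ ω) a b
      map_zero' := ContinuousMap.ext fun ω => map_zero (ψ ω)
      map_add' := fun a b => ContinuousMap.ext fun ω => map_add (ψ ω) a b
      commutes' := fun c => ContinuousMap.ext fun ω => AlgHomClass.commutes (ψ ω) c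
      map_star' := fun a => ContinuousMap.ext fun ω => map_star (ψ ω) a }
  have hle : ∀ a, ‖Ψ₀ a‖ ≤ ‖toC q N odd a‖ := fun a =>
    (ContinuousMap.norm_le (Ψ₀ a) (norm_nonneg _)).2 fun ω => norm_rep_le_toC (ψ ω) a
  obtain ⟨Ψ, hΨ⟩ := exists_starAlgHom_extension (B := C(Ω, BEllTwo)) (φ := Ψ₀)
    (denseRange_toC (q := q) (n := N) (odd := odd)) hle
  exact ⟨Ψ, fun a ω => by rw [hΨ]; rfl⟩

/-- The structure of the kernel of the quotient map. -/
theorem exists_quotient_structure [Nonempty Ω] (hq : 1 < |q|) (hn : 1 ≤ n)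
    {t : SphereAlgebra q N odd} {y : Fin n → SphereAlgebra q N odd} (hc : IsCoreTuple q t y)
    (hr : coreRadius t y = 1) (hx : ∀ i, (x i : SphereAlgebra q N odd) = 0 ∨ x i = t ∨ ∃ j, x i = y j)
    {Q : SphereAlgebra q N odd →⋆ₐ[ℂ] OddSphere q n} (hQ : IsVacuumQuotient t Q) {χ : C(Ω, ℂ)}
    (hχ : Function.Injective χ) (hχ1 : ∀ ω, star (χ ω) * χ ω = 1)
    (hspec : ∀ W ∈ unitary (CSphere q N odd), (∀ p₀ : CSphere q N odd, star p₀ = p₀ →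
      toC q N odd t * p₀ = p₀ * toC q N odd t → W = toC q N odd t * p₀ + (1 - p₀) →
      spectrum ℂ W ⊆ Set.range χ))
    {b : HilbertBasis (Fin n → ℕ) ℂ EllTwo} {D : BEllTwo} {Z : Fin n → BEllTwo}
    (hD : IsStandardTuple q b D Z) {ψ : Ω → HilbertRep (SphereAlgebra q N odd) EllTwo}
    (hψt : ∀ ω, ψ ω t = χ ω • D) (hψy : ∀ ω i, ψ ω (y i) = Z i) :
    ∃ π : CSphere q N odd →⋆ₐ[ℂ] COddSphere q n,
      (∀ a, π (toC q N odd a) = toC q n True (Q a)) ∧ Function.Surjective π ∧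
      ∃ Ψ : CSphere q N odd →⋆ₐ[ℂ] C(Ω, BEllTwo), (∀ a, π a = 0 → Ψ a = 0 → a = 0) ∧
      IsClosed (imageOfKer π Ψ : Set C(Ω, BEllTwo)) ∧
      (∀ (f : C(Ω, ℂ)) (S : BEllTwo), IsCompactOperator S → tensor f S ∈ imageOfKer π Ψ) ∧
      ∀ g ∈ imageOfKer π Ψ, ∀ ε > 0, ∃ G, ∀ ω,
        ‖g ω - basisProj b G * g ω * basisProj b G‖ ≤ ε := by
  obtain ⟨π, hπ, hπs⟩ := exists_quotientMap hQ.surjective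
  set ι := toC q N odd with hι
  have hcι : IsCoreTuple q (ι t) fun i => ι (y i) := by
    refine ⟨?_, fun i => ?_, fun i => ?_, fun i j hij => ?_, fun i j hij => ?_, fun i => ?_⟩
    · rw [← map_star, ← map_mul, ← map_mul, hc.normal]
    · rw [← map_mul, ← map_mul, ← map_smul, hc.T_mul]
    · rw [← map_star, ← map_mul, ← map_mul, ← map_smul, hc.star_T_mul]
    · rw [← map_mul, ← map_mul, ← map_smul, hc.comm i j hij]
    · rw [← map_star, ← map_mul, ← map_mul, ← map_smul, hc.comm_star i j hij]
    · have := congrArg ι (hc.bracket i)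
      simpa only [map_sub, map_mul, map_star, map_smul, map_add, map_sum] using this
  have hrι : coreRadius (ι t) (fun i => ι (y i)) * 1 = 1 := by
    have := congrArg ι hr
    rw [mul_one]
    simpa only [coreRadius, map_add, map_sum, map_mul, map_star, map_one] using this
  obtain ⟨p₀, e, hM⟩ := exists_isMatrixUnits hq hcι (star_one _) (mul_one 1) (by simp)
    (fun i => by simp) hrι
  have hW := hM.unitary_mem hcι.normal
  -- The unitary extends `T` on the vacuum corner by `1`; `hspec` places its spectrum in the image
  -- of `Ω`.
  obtain ⟨γ, hγ⟩ := exists_functionalCalculus hχ (W := ι t * p₀ + (1 - p₀))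
    ⟨(Unitary.mem_iff.1 hW).1.trans (Unitary.mem_iff.1 hW).2.symm⟩
    (hspec _ hW p₀ hM.star_p₀ hM.T_mul_p₀ rfl)
  obtain ⟨Ψ, hΨ⟩ := exists_familyHom ψ fun i => by
    rcases hx i with h | h | ⟨j, h⟩ <;> simp only [h, map_zero, hψt, hψy] <;> fun_prop
  have hF : IsFockFamily q χ (ι t) (fun i => ι (y i)) p₀ e γ b D Z Ψ := by
    refine ⟨hq, hM, hγ, hχ1, hχ, hD, fun ω => (hΨ _ _).trans (hψt ω),
      fun i ω => (hΨ _ _).trans (hψy ω i), fun S hS h1 h2 h3 h4 a => ?_⟩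
    have hxS : ∀ i, ι (x i) ∈ S ∧ star (ι (x i)) ∈ S := fun i => by
      rcases hx i with h | h | ⟨j, h⟩ <;> rw [h]
      · rw [map_zero, star_zero]
        exact ⟨S.zero_mem, S.zero_mem⟩
      · exact ⟨h1, h2⟩
      · exact ⟨h3 j, h4 j⟩
    refine (denseRange_toC (q := q) (n := N) (odd := odd)).induction_on (p := fun a => a ∈ S) a
      hS fun a => ?_
    induction a using SphereAlgebra.induct_gen with
    | hc c =>
      rw [AlgHomClass.commutes]
      exact S.algebraMap_mem c
    | hx i => exact (hxS i).1
    | hs i =>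
      rw [map_star]
      exact (hxS i).2
    | hm a b ha hb =>
      rw [map_mul]
      exact S.mul_mem ha hb
    | ha a b ha hb =>
      rw [map_add]
      exact S.add_mem ha hb
  -- The tolerances `1/(m+1)` yield projections `P_m` with `T (1 - P_m) → 0`.
  have happ := fun m : ℕ => hM.approx (1 / ((m : ℝ) + 1)) (by positivity)
  choose F hFa using happ
  have : Nonempty (HilbertRep (SphereAlgebra q N odd) EllTwo) := ‹Nonempty Ω›.map ψ
  have hker : ∀ a, π a = 0 →
      Tendsto (fun m => ‖a * (1 - ∑ k ∈ F m, e k * star (e k))‖) atTop (𝓝 0) := fun a ha =>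
    hQ.tendsto hn hπ (fun m => (hM.isStarProjection_sum (F m)).one_sub.norm_le)
      (squeeze_zero (fun _ => norm_nonneg _) hFa tendsto_one_div_add_atTop_nhds_zero_nat) ha
  have hπt : π (ι t) = 0 := by rw [hπ, hQ.map_eq_zero, map_zero]
  exact ⟨π, hπ, hπs, Ψ, fun a => hF.eq_zero_of_ker hker, hF.isClosed_imageOfKer hker,
    fun f S => hF.tensor_mem_imageOfKer hπt hker f, fun g hg ε hε =>
      hF.exists_compression hker hg hε⟩

end Spheres

end QuantumSphere

namespace QuantumSphere

open SphereAlgebra InnerProductSpace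

/-! ### The two exact sequences. -/

section Sequences

variable {q : ℝ} {n : ℕ}

theorem one_sub_add_eq {A : Type*} [CStarAlgebra A] {T p : A} (hp : star p = p) (hT : star T = T)
    (h : T * p = p * T) : IsSelfAdjoint (T * p + (1 - p)) := by
  rw [isSelfAdjoint_iff, star_add, star_mul, star_sub, star_one, hp, hT, h]

theorem infinite_multiIndex (hn : 1 ≤ n) : Infinite (Fin n → ℕ) := by
  have : Nonempty (Fin n) := ⟨⟨0, hn⟩⟩
  infer_instance

/-- Pairs of compact operators as functions on `{1, -1}`. -/
noncomputable def compactPairHom : Compacts × Compacts →⋆ₙₐ[ℂ] C(ℤˣ, BEllTwo) where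
  toFun s := ⟨fun ε => if ε = 1 then s.1 else s.2, continuous_of_discreteTopology⟩
  map_smul' c s := by ext1 ε; by_cases h : ε = 1 <;> simp [h]
  map_zero' := by ext1 ε; by_cases h : ε = 1 <;> simp [h]
  map_add' s t := by ext1 ε; by_cases h : ε = 1 <;> simp [h]
  map_mul' s t := by ext1 ε; by_cases h : ε = 1 <;> simp [h]
  map_star' s := by ext1 ε; by_cases h : ε = 1 <;> simp [h]

/-- Here `Ω` is the two-point space of signs, so functions on it with compact values are pairs of
compact operators. The basis indexed by `ℕ^n` is placed in `ℓ²(ℕ)`, where the representations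
defining the universal norm live. -/
theorem exists_even_extension (hq : 1 < |q|) (hn : 1 ≤ n) :
    ∃ π : CEvenSphere q n →⋆ₐ[ℂ] COddSphere q n,
      (∀ a, π (toC q n False a) = toC q n True (evenToOdd q n a)) ∧
      ∃ j : Compacts × Compacts →⋆ₙₐ[ℂ] CEvenSphere q n, IsExtension j π := by
  have := infinite_multiIndex hn
  obtain ⟨b⟩ := exists_hilbertBasis_ellTwo (Fin n → ℕ)
  obtain ⟨D, Z, hD⟩ := exists_isStandardTuple hq b
  choose ψ hψ0 hψ using exists_evenRep hq hD
  obtain ⟨hc, hsa, hr⟩ := isSphereTuple_even_iff.1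
    (isSphereTuple_x (q := q) (n := n) (odd := False))
  let χ : C(ℤˣ, ℂ) := ⟨fun ε => ((ε : ℤ) : ℂ), continuous_of_discreteTopology⟩
  obtain ⟨π, hπ, hπs, Ψ, hinj, -, htens, hcomp⟩ := exists_quotient_structure hq hn hc hr
    (fun i => by
      induction i using Fin.cases with
      | zero => exact Or.inr (Or.inl rfl)
      | succ i => exact Or.inr (Or.inr ⟨i, rfl⟩))
    (isVacuumQuotient_even hq) (χ := χ) (fun ε ε' h => Units.ext (Int.cast_injective h))
    star_units_mul
    (fun W hW p hp hTp hWe z hz => by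
      -- A self-adjoint unitary has spectrum in `{1, -1}`.
      have hWsa : IsSelfAdjoint W := by
        rw [hWe]
        exact one_sub_add_eq hp (by rw [← map_star, hsa]) hTp
      have h1 := hWsa.mem_spectrum_eq_re hz
      have h2 := spectrum.norm_eq_one_of_unitary hW hz
      rw [h1, Complex.norm_real, Real.norm_eq_abs] at h2
      rcases (abs_eq zero_le_one).1 h2 with h3 | h3
      · exact ⟨1, by rw [h1, h3]; simp [χ]⟩
      · exact ⟨-1, by rw [h1, h3]; simp [χ]⟩)
    hD hψ0 hψ
  refine ⟨π, hπ, exists_isExtension hinj hπs (κ := compactPairHom) (fun s t hst => ?_)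
    fun g => ⟨fun hg => ?_, ?_⟩⟩
  · have h1 := congrArg (fun g : C(ℤˣ, BEllTwo) => g 1) hst
    have h2 := congrArg (fun g : C(ℤˣ, BEllTwo) => g (-1)) hst
    exact Prod.ext (Subtype.ext h1) (Subtype.ext h2)
  · have hcpt : ∀ ε, IsCompactOperator (g ε) := fun ε =>
      isCompactOperator_of_compression b fun δ hδ => by
        obtain ⟨G, hG⟩ := hcomp g hg δ hδ
        exact ⟨G, hG ε⟩
    refine ⟨(⟨g 1, hcpt 1⟩, ⟨g (-1), hcpt (-1)⟩), ContinuousMap.ext fun ε => ?_⟩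
    rcases Int.units_eq_one_or ε with rfl | rfl <;> rfl
  · rintro ⟨s, rfl⟩
    let δ : ℤˣ → C(ℤˣ, ℂ) := fun ε => ⟨fun ε' => if ε' = ε then 1 else 0,
      continuous_of_discreteTopology⟩
    have h1 : compactPairHom s = tensor (δ 1) s.1 + tensor (δ (-1)) s.2 := by
      ext1 ε
      rw [ContinuousMap.add_apply, tensor_apply, tensor_apply]
      rcases Int.units_eq_one_or ε with rfl | rfl <;> simp [compactPairHom, δ]
    rw [h1]
    exact add_mem (htens _ _ s.1.2) (htens _ _ s.2.2)

/-- Here `Ω` is the circle, which contains the spectrum of every unitary. The two inclusions between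
the image of the kernel and `C(S^1) ⊗ 𝒦` come from uniform compression and from closedness of the
image. -/
theorem exists_odd_extension (hq : 1 < |q|) (hn : 1 ≤ n) :
    ∃ π : COddSphere q (n + 1) →⋆ₐ[ℂ] COddSphere q n,
      (∀ a, π (toC q (n + 1) True a) = toC q n True (oddToOdd q n a)) ∧
      ∃ j : CircleTensorCompacts →⋆ₙₐ[ℂ] COddSphere q (n + 1), IsExtension j π := by
  have := infinite_multiIndex hn
  obtain ⟨b⟩ := exists_hilbertBasis_ellTwo (Fin n → ℕ)
  obtain ⟨D, Z, hD⟩ := exists_isStandardTuple hq b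
  choose ψ hψ0 hψ using exists_oddRep hq hD
  obtain ⟨hc, h0, hr⟩ := isSphereTuple_odd_iff.1
    (isSphereTuple_x (q := q) (n := n + 1) (odd := True))
  let χ : C(Circle, ℂ) := ⟨fun z => (z : ℂ), continuous_subtype_val⟩
  obtain ⟨π, hπ, hπs, Ψ, hinj, hcl, htens, hcomp⟩ := exists_quotient_structure hq hn hc hr
    (fun i => by
      induction i using Fin.cases with
      | zero => exact Or.inl h0
      | succ i =>
        induction i using Fin.cases with
        | zero => exact Or.inr (Or.inl rfl)
        | succ i => exact Or.inr (Or.inr ⟨i, rfl⟩))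
    (isVacuumQuotient_odd hq) (χ := χ) (fun _ _ h => Circle.ext h) star_circle_mul
    (fun W hW p hp hTp hWe z hz => ⟨⟨z, spectrum.subset_circle_of_unitary hW hz⟩, rfl⟩)
    hD hψ0 hψ
  have hadj : ∀ (f : C(Circle, ℂ)) (S : BEllTwo), IsCompactOperator S →
      tensor f S ∈ NonUnitalStarAlgebra.adjoin ℂ {g : C(Circle, BEllTwo) |
        ∃ f : C(Circle, ℂ), ∃ T ∈ compactOperators EllTwo, ∀ z, g z = f z • T} :=
    fun f S hS => NonUnitalStarAlgebra.subset_adjoin ℂ _ ⟨f, S, hS, fun _ => rfl⟩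
  let κ : CircleTensorCompacts →⋆ₙₐ[ℂ] C(Circle, BEllTwo) :=
    NonUnitalStarSubalgebraClass.subtype (circleTensorCompact EllTwo)
  refine ⟨π, hπ, exists_isExtension (I := CircleTensorCompacts) (κ := κ) hinj hπs
    Subtype.val_injective fun g => ⟨fun hg => ⟨⟨g, ?_⟩, rfl⟩, ?_⟩⟩
  · refine Metric.mem_closure_iff.2 fun ε hε => ?_
    obtain ⟨G, hG⟩ := hcomp g hg (ε / 2) (half_pos hε)
    -- The matrix entries of `g` are continuous functions on the circle, so a finite compression of
    -- `g` is a finite sum of elementary tensors.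
    let gc : (Fin n → ℕ) → (Fin n → ℕ) → C(Circle, ℂ) := fun l k =>
      ⟨fun z => inner ℂ (b l) (g z (b k)),
        continuous_const.inner (g.continuous.clm_apply continuous_const)⟩
    refine ⟨∑ l ∈ G, ∑ k ∈ G, tensor (gc l k) (rankOne ℂ (b l) (b k)),
      sum_mem fun l _ => sum_mem fun k _ => hadj _ _ (isCompactOperator_rankOne _ _), ?_⟩
    have h1 : dist g (∑ l ∈ G, ∑ k ∈ G, tensor (gc l k) (rankOne ℂ (b l) (b k))) ≤ ε / 2 := by
      rw [ContinuousMap.dist_le (by positivity)]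
      intro z
      rw [dist_eq_norm]
      have h2 := hG z
      rw [basisProj_mul_mul_basisProj] at h2
      simp only [ContinuousMap.sum_apply, tensor_apply]
      exact h2
    linarith
  · rintro ⟨g, rfl⟩
    have hle : NonUnitalStarAlgebra.adjoin ℂ {g : C(Circle, BEllTwo) |
        ∃ f : C(Circle, ℂ), ∃ T ∈ compactOperators EllTwo, ∀ z, g z = f z • T} ≤
        imageOfKer π Ψ := by
      refine NonUnitalStarAlgebra.adjoin_le ?_
      rintro g ⟨f, T, hT, hg⟩
      have : g = tensor f T := ContinuousMap.ext hg
      rw [this]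
      exact htens f T hT
    exact closure_minimal (fun _ h => hle h) hcl g.2

end Sequences

end QuantumSphere

theorem mainTheorem6 (q : ℝ) (hq : 1 < |q|) (n : ℕ) :
    -- irreducible representations of `A(S_q^{2n})`, `n ≥ 1`
    (1 ≤ n → ∃ ψ : ℤˣ → HilbertRep (EvenSphere q n) (Fock n),
      (∀ ε, IsEvenPsi q n ε (ψ ε) ∧ IsIrreducibleRep (ψ ε) ∧
        ¬ FactorsThrough (ψ ε) (evenToOdd q n)) ∧
      (∀ ε ε', UnitarilyEquivalent (ψ ε) (ψ ε') → ε = ε') ∧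
      ∀ (H : Type*) [NormedAddCommGroup H] [InnerProductSpace ℂ H] [CompleteSpace H]
        (φ : HilbertRep (EvenSphere q n) H), IsIrreducibleRep φ →
          FactorsThrough φ (evenToOdd q n) ∨ ∃ ε, UnitarilyEquivalent φ (ψ ε)) ∧
    -- irreducible representations of `A(S_q^{2n+1})`, `n ≥ 0`
    (∃ ψ : Circle → HilbertRep (OddSphere q (n + 1)) (Fock n),
      (∀ z, IsOddPsi q n z (ψ z) ∧ IsIrreducibleRep (ψ z) ∧
        ¬ FactorsThrough (ψ z) (oddToOdd q n)) ∧
      (∀ z z', UnitarilyEquivalent (ψ z) (ψ z') → z = z') ∧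
      ∀ (H : Type*) [NormedAddCommGroup H] [InnerProductSpace ℂ H] [CompleteSpace H]
        (φ : HilbertRep (OddSphere q (n + 1)) H), IsIrreducibleRep φ →
          (1 ≤ n ∧ FactorsThrough φ (oddToOdd q n)) ∨ ∃ z, UnitarilyEquivalent φ (ψ z)) ∧
    -- `0 → 𝒦 ⊕ 𝒦 → C(S_q^{2n}) → C(S_q^{2n-1}) → 0`
    (1 ≤ n → ∃ π : CEvenSphere q n →⋆ₐ[ℂ] COddSphere q n,
      (∀ a, π (toC q n False a) = toC q n True (evenToOdd q n a)) ∧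
      ∃ j : Compacts × Compacts →⋆ₙₐ[ℂ] CEvenSphere q n, IsExtension j π) ∧
    -- `0 → C(S^1) ⊗ 𝒦 → C(S_q^{2n+1}) → C(S_q^{2n-1}) → 0`
    (1 ≤ n → ∃ π : COddSphere q (n + 1) →⋆ₐ[ℂ] COddSphere q n,
      (∀ a, π (toC q (n + 1) True a) = toC q n True (oddToOdd q n a)) ∧
      ∃ j : CircleTensorCompacts →⋆ₙₐ[ℂ] COddSphere q (n + 1), IsExtension j π) := by
  exact ⟨fun _ => exists_even_irreducibles hq n, exists_odd_irreducibles hq n,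
    exists_even_extension hq, exists_odd_extension hq⟩
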